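/- **Setting (non-stationary generalized linear bandits).** Let $d\ge 1$, $T\ge 2$, $\delta\in(0,1)$. Let $\mathcal A\subset\mathbb R^d$ be a nonempty compact set of actions with $\|a\|_2\le 1$, and let $\mu:\mathbb R\to\mathbb R$ be a differentiable non-decreasing link function with $k_\mu=\sup_{[-1,1]}\mu'<\infty$ and $c_\mu=\inf_{[-1,1]}\mu'>0$. The environment fixes $\theta_1,\dots,\theta_T$ with $\|\theta_t\|_2\le 1$ such that $f_t(a)=\mu(a^\top\theta_t)\in[0,1]$ for all $a\in\mathcal A$. In round $t$ the learner plays $a_t\in\mathcal A$ and receives $R_t\in[0,1]$ whose conditional mean, given the past and the learner's choices of round $t$, is $f_t(a_t)$. Write $f_t^\star=\max_{a\in\mathcal A} f_t(a)$, $\textsc{D-Reg}=\sum_{t=1}^T(f_t^\star-R_t)$, $\widehat\Delta=\sum_{t=1}^{T-1}\|\theta_t-\theta_{t+1}\|_2$, $L=1+\#\{t<T:\theta_t\ne\theta_{t+1}\}$, and, for $\Delta(\cdot)\ge 0$, $\Delta_{[s,e]}=\sum_{\tau=s}^{e-1}\Delta(\tau)$. **Base algorithms.** A base algorithm outputs in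 each round, from the policies and rewards it has seen, a policy and a scalar $\widetilde f_t\in[0,1]$. It satisfies *Assumption 1* in the environment $f_1,\dots,f_T$ with $\Delta$ and $\rho$ if: $\Delta(t)\ge\max_a|f_t(a)-f_{t+1}(a)|$ for $t<T$; $\rho$ is non-increasing on $\{1,\dots,T\}$, $\rho(t)\ge 1/\sqrt t$, and $C(t)=t\rho(t)$ is non-decreasing; and, when it is run alone, for every $t\le T$ with $\Delta_{[1,t]}\le\rho(t)$, with probability at least $1-\delta/T$, $$\widetilde f_t\ge\min_{\tau\le t}f_\tau^\star-\Delta_{[1,t]}\quad\text{and}\quad\frac1t\sum_{\tau=1}^t(\widetilde f_\tau-R_\tau)\le\rho(t)+\Delta_{[1,t]}.$$ **GLM-UCB** with parameter $\lambda>0$. Put $\beta=\frac{4k_\mu}{c_\mu}\big(\sqrt{d\log(c_\mu T/(\lambda\delta))}+c_\mu\sqrt\lambda\big)$. With sums over the algorithm's own past rounds, let $\Lambda=\lambda I+\sum_\tau a_\tau a_\tau^\top$ and $g(x)=\lambda c_\mu x+\sum_\tau\mu(a_\tau^\top x)a_\tau$; let $\theta'$ solve $g(\theta')=\sum_\tau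 R_\tau a_\tau$ and let $\widehat\theta\in\arg\min_{\|\theta\|_2\le1}\|g(\theta')-g(\theta)\|_{\Lambda^{-1}}$. The algorithm plays a maximizer over $\mathcal A$ of $\mu(a^\top\widehat\theta)+2\beta\|a\|_{\Lambda^{-1}}$ (ties broken arbitrarily) and outputs the maximum, clipped to $[0,1]$, as $\widetilde f_t$. **MASTER** with input $\rho$. Put $\widehat\rho(t)=6(\log_2T+1)\log(T/\delta)\rho(t)$. MASTER works in consecutive blocks of lengths $2^0,2^1,\dots$. In a block of length $2^n$ starting at round $t_n$, for each $m\le n$, each interval of length $2^m$ of the partition of the block into $2^{n-m}$ such intervals receives, independently and with probability $\rho(2^n)/\rho(2^m)$, an order-$m$ instance of the base algorithm. In each round the shortest instance covering it is active: it plays and is updated, while all others are paused. Its scalar is denoted $\widetilde g_t$. After round $t$ MASTER restarts (the next round starts a new sequence of blocks of lengths $2^0,2^1,\dots$) if some order-$m$ instance on $[s,t]$, $t=s+2^m-1$, has $2^{-m}\sum_{\tau=s}^tR_\tau\ge\min_{\tau\in[t_n,t]}\widetilde g_\tau+9\widehat\rho(2^m)$, or if $\frac1{t-t_n+1}\sum_{\tau=t_n}^t(\widetilde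 g_\tau-R_\tau)\ge3\widehat\rho(t-t_n+1)$. **Theorem.** For every $\kappa\ge1$ there are constants $\kappa_1,\kappa_2,K>0$ and $p\in\mathbb N$, depending only on $\kappa$, such that the following holds for all $d,T,\delta,\mathcal A,\mu,\lambda,(\theta_t)$ as above with $$(T/\delta)^{-\kappa}\le\lambda\le c_\mu\sqrt{T/\delta},\qquad c_\mu\le(T/\delta)^\kappa,\qquad c_\mu\sqrt\lambda\le\kappa\sqrt d .$$ Let $\rho(t)=\kappa_1\beta\sqrt{d\log(T/\delta)/t}$ and $\Delta(t)=\kappa_2\frac{k_\mu^2d}{c_\mu}\sqrt{\log(T/\delta)}\,\|\theta_t-\theta_{t+1}\|_2$. 1. GLM-UCB satisfies Assumption 1 with $\Delta$ and $\rho$. Moreover $C(t)=t\rho(t)=\widetilde{\mathcal O}\big(\frac{k_\mu d}{c_\mu}\sqrt t\big)$ and $\Delta(t)=\widetilde\Theta\big(\frac{k_\mu^2d}{c_\mu}\|\theta_t-\theta_{t+1}\|_2\big)$; that is, $C(t)\le K\log^p(T/\delta)\frac{k_\mu d}{c_\mu}\sqrt t$ for $t\le T$, and for $t<T$ each of $\Delta(t)$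 and $\frac{k_\mu^2d}{c_\mu}\|\theta_t-\theta_{t+1}\|_2$ is at most $K\log^p(T/\delta)$ times the other. 2. MASTER with input $\rho$ and base algorithm GLM-UCB satisfies, with probability at least $1-\delta$, $$\textsc{D-Reg}\le K\log^p(T/\delta)\,\min\Big\{\frac{k_\mu}{c_\mu}d\sqrt{LT},\ \frac{k_\mu^{4/3}}{c_\mu}d\,\widehat\Delta^{1/3}T^{2/3}+\frac{k_\mu}{c_\mu}d\sqrt T\Big\}.$$ -/

import Mathlib

open MeasureTheory ProbabilityTheory
open scoped Matrix

universe u v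

noncomputable section

/-! ### Non-stationary online decision making

Rounds are numbered `1, …, T`; `f t π` is the mean reward of the policy `π` in round `t`. -/

/-- A base algorithm, given by its decision rule: `alg h π x` says that after the history `h`
(the policies it played so far, with the rewards received) the algorithm may output the policy `π`
and the auxiliary scalar `x` for its next round. A relation, so that ties may be broken in any way,
also at random. -/
abbrev BaseAlg (Pol : Type v) : Type v := List (Pol × ℝ) → Pol → ℝ → Prop

/-- The optimal mean reward in round `t`. -/
def optReward {Pol : Type v} (f : ℕ → Pol → ℝ) (t : ℕ) : ℝ := ⨆ π, f t π

/-- The total drift `Δ_{[s, e]} = ∑_{τ = s}^{e - 1} Δ(τ)`. -/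
def drift (Δ : ℕ → ℝ) (s e : ℕ) : ℝ := ∑ τ ∈ Finset.Ico s e, Δ τ

open Classical in
/-- The number of stationary pieces, `L = 1 + #{τ ∈ [1, T - 1] : Δ(τ) ≠ 0}`. -/
def numPieces (Δ : ℕ → ℝ) (T : ℕ) : ℕ := 1 + ((Finset.Ico 1 T).filter fun τ => Δ τ ≠ 0).card

/-- The dynamic regret `∑_{t = 1}^T (f*_t - R_t)` along one sequence of rewards. -/
def dynRegret {Pol : Type v} (f : ℕ → Pol → ℝ) (T : ℕ) (R : ℕ → ℝ) : ℝ :=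
  ∑ t ∈ Finset.Icc 1 T, (optReward f t - R t)

/-- A learner playing the policies `π t` and announcing the scalars `x t` against the environment
`f`. Here `ℱ t` is the information available after round `t` and `𝒢 t` the information available
in round `t` just before the reward `R t` is drawn (so it contains the learner's own random choices
of round `t`). The reward lies in `[0, 1]` and has conditional mean `f t (π t)`. -/
structure Interaction {Pol : Type v} [MeasurableSpace Pol] {Ω : Type u} {mΩ : MeasurableSpace Ω}
    (P : Measure Ω) (f : ℕ → Pol → ℝ) (T : ℕ) (ℱ : Filtration ℕ mΩ) (𝒢 : ℕ → MeasurableSpace Ω)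
    (π : ℕ → Ω → Pol) (x R : ℕ → Ω → ℝ) : Prop where
  past_le : ∀ t ∈ Finset.Icc 1 T, ℱ (t - 1) ≤ 𝒢 t
  le_after : ∀ t ∈ Finset.Icc 1 T, 𝒢 t ≤ ℱ t
  policy_meas : ∀ t ∈ Finset.Icc 1 T, Measurable[𝒢 t] (π t)
  scalar_meas : ∀ t ∈ Finset.Icc 1 T, Measurable[𝒢 t] (x t)
  reward_meas : ∀ t ∈ Finset.Icc 1 T, Measurable[ℱ t] (R t)
  reward_mem : ∀ t ∈ Finset.Icc 1 T, ∀ ω, R t ω ∈ Set.Icc (0 : ℝ) 1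
  reward_mean : ∀ t ∈ Finset.Icc 1 T, P[R t | 𝒢 t] =ᵐ[P] fun ω => f t (π t ω)

/-- The base algorithm `alg` run alone for `T` rounds. -/
structure IsAlgRun {Pol : Type v} [MeasurableSpace Pol] {Ω : Type u} {mΩ : MeasurableSpace Ω}
    (alg : BaseAlg Pol) (P : Measure Ω) (f : ℕ → Pol → ℝ) (T : ℕ) (ℱ : Filtration ℕ mΩ)
    (𝒢 : ℕ → MeasurableSpace Ω) (π : ℕ → Ω → Pol) (x R : ℕ → Ω → ℝ) : Prop
    extends Interaction P f T ℱ 𝒢 π x R where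
  step : ∀ t ∈ Finset.Icc 1 T, ∀ ω,
    alg ((List.range' 1 (t - 1)).map fun τ => (π τ ω, R τ ω)) (π t ω) (x t ω)

/-- The requirement on a base algorithm: run alone in the environment `f`, in every round `t` up to
which the drift is at most `ρ t`, with probability at least `1 - δ / T` its scalar is optimistic
and its average regret against its own scalars is at most `ρ t`, both up to the drift. -/
structure Assumption1 {Pol : Type v} [MeasurableSpace Pol] (alg : BaseAlg Pol)
    (f : ℕ → Pol → ℝ) (T : ℕ) (δ : ℝ) (Δ ρ : ℕ → ℝ) : Prop where
  /-- `Δ` is a non-stationarity measure. -/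
  nonstationarity : ∀ t ∈ Finset.Ico 1 T, ∀ π, |f t π - f (t + 1) π| ≤ Δ t
  scalar_mem : ∀ h π x, alg h π x → x ∈ Set.Icc (0 : ℝ) 1
  rho_antitone : AntitoneOn ρ (Set.Icc 1 T)
  rho_lower : ∀ t ∈ Finset.Icc 1 T, 1 / Real.sqrt t ≤ ρ t
  /-- `C(t) = t ρ(t)` is non-decreasing. -/
  cum_monotone : MonotoneOn (fun t : ℕ => (t : ℝ) * ρ t) (Set.Icc 1 T)
  guarantee : ∀ (Ω : Type u) (mΩ : MeasurableSpace Ω) (P : Measure Ω) [IsProbabilityMeasure P]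
    (ℱ : Filtration ℕ mΩ) (𝒢 : ℕ → MeasurableSpace Ω) (π : ℕ → Ω → Pol) (x R : ℕ → Ω → ℝ),
    IsAlgRun alg P f T ℱ 𝒢 π x R → ∀ t ∈ Finset.Icc 1 T, drift Δ 1 t ≤ ρ t →
      ENNReal.ofReal (1 - δ / T) ≤ P {ω |
        sInf (optReward f '' Set.Icc 1 t) - drift Δ 1 t ≤ x t ω ∧
        (1 / (t : ℝ)) * ∑ τ ∈ Finset.Icc 1 t, (x τ ω - R τ ω) ≤ ρ t + drift Δ 1 t}

/-! ### MALG and MASTER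

Along one sample path, `U s m` is the uniform seed of the coin that decides whether an instance of
order `m` (that is, of length `2 ^ m`) is scheduled to start in round `s`. -/

/-- A block of `2 ^ order` rounds beginning with round `start`. -/
structure Block where
  start : ℕ
  order : ℕ

namespace Block

/-- In the block `B`, an instance of order `m` starts in round `s`: the round `s` is a left end
point of the partition of the block into intervals of length `2 ^ m`, and the coin with success
probability `ρ (2 ^ n) / ρ (2 ^ m)` succeeded, where `n` is the order of the block. -/
def Scheduled (ρ : ℕ → ℝ) (U : ℕ → ℕ → ℝ) (B : Block) (m s : ℕ) : Prop :=
  m ≤ B.order ∧ B.start ≤ s ∧ s < B.start + 2 ^ B.order ∧ 2 ^ m ∣ s - B.start ∧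
    U s m ≤ ρ (2 ^ B.order) / ρ (2 ^ m)

/-- The left end point of the interval of length `2 ^ m` of the partition that contains `t`. -/
def instStart (B : Block) (m t : ℕ) : ℕ := B.start + 2 ^ m * ((t - B.start) / 2 ^ m)

/-- The order of the active instance in round `t`: the shortest one that covers `t`. -/
def activeOrder (ρ : ℕ → ℝ) (U : ℕ → ℕ → ℝ) (B : Block) (t : ℕ) : ℕ :=
  sInf {m | B.Scheduled ρ U m (B.instStart m t)}

/-- What the active instance of round `t` has seen before round `t`: the policies and rewards of
the earlier rounds since its start in which it was active. -/
def activeHistory {Pol : Type v} (ρ : ℕ → ℝ) (U : ℕ → ℕ → ℝ) (B : Block) (π : ℕ → Pol)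
    (R : ℕ → ℝ) (t : ℕ) : List (Pol × ℝ) :=
  let m := B.activeOrder ρ U t
  let s := B.instStart m t
  ((List.range' s (t - s)).filter fun τ => decide (B.activeOrder ρ U τ = m)).map
    fun τ => (π τ, R τ)

/-- Test 1 fails at the end of round `t`: some instance ends in this round whose average reward
exceeds the smallest scalar `U_t` of the block so far by `9 ρhat (2 ^ m)`. -/
def Test1Fails (ρ ρhat : ℕ → ℝ) (U : ℕ → ℕ → ℝ) (B : Block) (g R : ℕ → ℝ) (t : ℕ) : Prop :=
  ∃ m s, B.Scheduled ρ U m s ∧ s + 2 ^ m = t + 1 ∧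
    sInf (g '' Set.Icc B.start t) + 9 * ρhat (2 ^ m) ≤
      (1 / (2 : ℝ) ^ m) * ∑ τ ∈ Finset.Icc s t, R τ

/-- Test 2 fails at the end of round `t`. -/
def Test2Fails (ρhat : ℕ → ℝ) (B : Block) (g R : ℕ → ℝ) (t : ℕ) : Prop :=
  3 * ρhat (t - B.start + 1) ≤
    (1 / ((t - B.start + 1 : ℕ) : ℝ)) * ∑ τ ∈ Finset.Icc B.start t, (g τ - R τ)

end Block

open Classical in
/-- The block of MASTER that contains round `t` (for `t ≥ 1`): after a failed test the next round
begins a block of order `0`; after a completed block of order `n` the next round begins a block of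
order `n + 1`. -/
def masterBlock (ρ ρhat : ℕ → ℝ) (U : ℕ → ℕ → ℝ) (g R : ℕ → ℝ) : ℕ → Block
  | 0 => ⟨1, 0⟩
  | 1 => ⟨1, 0⟩
  | t + 2 =>
    let B := masterBlock ρ ρhat U g R (t + 1)
    if B.Test1Fails ρ ρhat U g R (t + 1) ∨ B.Test2Fails ρhat g R (t + 1) then ⟨t + 2, 0⟩
    else if t + 2 = B.start + 2 ^ B.order then ⟨t + 2, B.order + 1⟩
    else B

/-- `ρhat(t) = 6 (log₂ T + 1) log(T / δ) ρ(t)`. -/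
def rhoHat (T : ℕ) (δ : ℝ) (ρ : ℕ → ℝ) (t : ℕ) : ℝ :=
  6 * (Real.logb 2 T + 1) * Real.log (T / δ) * ρ t

/-- MASTER with the base algorithm `alg`, run for `T` rounds: the seeds of round `t` are independent
uniform variables on `[0, 1]`, drawn independently of everything before that round, and the policy
and the scalar of round `t` are those of the active instance of the current block. -/
structure IsMasterRun {Pol : Type v} [MeasurableSpace Pol] {Ω : Type u} {mΩ : MeasurableSpace Ω}
    (alg : BaseAlg Pol) (ρ : ℕ → ℝ) (δ : ℝ) (P : Measure Ω) (f : ℕ → Pol → ℝ) (T : ℕ)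
    (ℱ : Filtration ℕ mΩ) (𝒢 : ℕ → MeasurableSpace Ω) (U : ℕ → ℕ → Ω → ℝ)
    (π : ℕ → Ω → Pol) (g R : ℕ → Ω → ℝ) : Prop
    extends Interaction P f T ℱ 𝒢 π g R where
  seed_meas : ∀ t ∈ Finset.Icc 1 T, ∀ m, Measurable[𝒢 t] (U t m)
  seed_mem : ∀ t ∈ Finset.Icc 1 T, ∀ m ω, U t m ω ∈ Set.Icc (0 : ℝ) 1
  seed_law : ∀ t ∈ Finset.Icc 1 T, ∀ m,
    P.map (U t m) = (volume : Measure ℝ).restrict (Set.Icc 0 1)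
  seed_indep : ∀ t ∈ Finset.Icc 1 T, iIndepFun (fun m => U t m) P
  seed_fresh : ∀ t ∈ Finset.Icc 1 T,
    Indep (⨆ m, MeasurableSpace.comap (U t m) inferInstance) (ℱ (t - 1)) P
  step : ∀ t ∈ Finset.Icc 1 T, ∀ ω,
    alg ((masterBlock ρ (rhoHat T δ ρ) (fun s m => U s m ω) (fun τ => g τ ω) (fun τ => R τ ω)
        t).activeHistory ρ (fun s m => U s m ω) (fun τ => π τ ω) (fun τ => R τ ω) t)
      (π t ω) (g t ω)

/-! ### Generalized linear bandits and GLM-UCB -/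

/-- The mean reward `μ(aᵀ θ_t)` of the action `a` in round `t`. -/
def glmReward {d : ℕ} (A : Set (EuclideanSpace ℝ (Fin d))) (μ : ℝ → ℝ)
    (θ : ℕ → EuclideanSpace ℝ (Fin d)) (t : ℕ) (a : A) : ℝ :=
  μ (inner ℝ (a : EuclideanSpace ℝ (Fin d)) (θ t))

/-- `k_μ`, the supremum of the derivative of the link function on `[-1, 1]`. -/
def kLink (μ : ℝ → ℝ) : ℝ := sSup (deriv μ '' Set.Icc (-1) 1)

/-- `c_μ`, the infimum of the derivative of the link function on `[-1, 1]`. -/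
def cLink (μ : ℝ → ℝ) : ℝ := sInf (deriv μ '' Set.Icc (-1) 1)

/-- `β = (4 k_μ / c_μ) (√(d log(c_μ T / (lam δ))) + c_μ √lam)`. -/
def glmBeta (d T : ℕ) (δ : ℝ) (μ : ℝ → ℝ) (lam : ℝ) : ℝ :=
  4 * kLink μ / cLink μ *
    (Real.sqrt (d * Real.log (cLink μ * T / (lam * δ))) + cLink μ * Real.sqrt lam)

/-- `Λ = lam I + ∑ a aᵀ`, the sum over the history. -/
def glmGram {d : ℕ} {A : Set (EuclideanSpace ℝ (Fin d))} (lam : ℝ) (h : List (A × ℝ)) :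
    Matrix (Fin d) (Fin d) ℝ :=
  lam • (1 : Matrix (Fin d) (Fin d) ℝ) +
    (h.map fun p => Matrix.vecMulVec (p.1 : EuclideanSpace ℝ (Fin d)).ofLp
      (p.1 : EuclideanSpace ℝ (Fin d)).ofLp).sum

/-- `‖x‖_{M⁻¹} = √(xᵀ M⁻¹ x)`. -/
def invNorm {d : ℕ} (M : Matrix (Fin d) (Fin d) ℝ) (x : EuclideanSpace ℝ (Fin d)) : ℝ :=
  Real.sqrt (x.ofLp ⬝ᵥ (M⁻¹ *ᵥ x.ofLp))

/-- `g(x) = lam c_μ x + ∑ μ(aᵀ x) a`, the sum over the history. -/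
def glmMap {d : ℕ} {A : Set (EuclideanSpace ℝ (Fin d))} (μ : ℝ → ℝ) (lam : ℝ)
    (h : List (A × ℝ)) (x : EuclideanSpace ℝ (Fin d)) : EuclideanSpace ℝ (Fin d) :=
  (lam * cLink μ) • x +
    (h.map fun p => μ (inner ℝ (p.1 : EuclideanSpace ℝ (Fin d)) x) •
      (p.1 : EuclideanSpace ℝ (Fin d))).sum

/-- `θhat` is an estimator for the history `h`: for the solution `θ₀` of `g(θ₀) = ∑ R a`, it
minimizes `‖g(θ₀) - g(θ)‖_{Λ⁻¹}` over the unit ball. -/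
def IsGlmEstimator {d : ℕ} {A : Set (EuclideanSpace ℝ (Fin d))} (μ : ℝ → ℝ) (lam : ℝ)
    (h : List (A × ℝ)) (θhat : EuclideanSpace ℝ (Fin d)) : Prop :=
  ∃ θ₀, glmMap μ lam h θ₀ = (h.map fun p => p.2 • (p.1 : EuclideanSpace ℝ (Fin d))).sum ∧
    ‖θhat‖ ≤ 1 ∧ ∀ θ, ‖θ‖ ≤ 1 →
      invNorm (glmGram lam h) (glmMap μ lam h θ₀ - glmMap μ lam h θhat) ≤
        invNorm (glmGram lam h) (glmMap μ lam h θ₀ - glmMap μ lam h θ)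

/-- The index `μ(aᵀ θhat) + 2 β ‖a‖_{Λ⁻¹}` of the action `a`. -/
def glmIndex {d : ℕ} {A : Set (EuclideanSpace ℝ (Fin d))} (T : ℕ) (δ : ℝ) (μ : ℝ → ℝ) (lam : ℝ)
    (h : List (A × ℝ)) (θhat : EuclideanSpace ℝ (Fin d)) (a : A) : ℝ :=
  μ (inner ℝ (a : EuclideanSpace ℝ (Fin d)) θhat) +
    2 * glmBeta d T δ μ lam * invNorm (glmGram lam h) a

/-- GLM-UCB: play an action of maximal index, and output this maximal index, clipped to `[0, 1]`. -/
def glmUCB {d : ℕ} (A : Set (EuclideanSpace ℝ (Fin d))) (T : ℕ) (δ : ℝ) (μ : ℝ → ℝ) (lam : ℝ) :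
    BaseAlg A := fun h a x =>
  ∃ θhat, IsGlmEstimator μ lam h θhat ∧
    (∀ b : A, glmIndex T δ μ lam h θhat b ≤ glmIndex T δ μ lam h θhat a) ∧
    x = max 0 (min 1 (glmIndex T δ μ lam h θhat a))

/-- `ρ(t) = κ β √(d log(T / δ) / t)`. -/
def glmRho (κ : ℝ) (d T : ℕ) (δ : ℝ) (μ : ℝ → ℝ) (lam : ℝ) (t : ℕ) : ℝ :=
  κ * (glmBeta d T δ μ lam * Real.sqrt (d * Real.log (T / δ) / t))

/-- `Δ(t) = κ (k_μ² d / c_μ) √(log(T / δ)) ‖θ_t - θ_{t+1}‖`. -/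
def glmDelta (κ : ℝ) {d : ℕ} (T : ℕ) (δ : ℝ) (μ : ℝ → ℝ) (θ : ℕ → EuclideanSpace ℝ (Fin d))
    (t : ℕ) : ℝ :=
  κ * (kLink μ ^ 2 * d / cLink μ * Real.sqrt (Real.log (T / δ)) * ‖θ t - θ (t + 1)‖)

end

/-! The proof has a statistical part, a scheduling part and a final optimization.

Statistics of GLM-UCB. In round `τ` the estimator is compared with the current parameter `θ τ`. The
residual of the estimating equation at `θ τ` is noise, plus the bias due to older parameters, plus
regularization (`invNorm_estimating_error_le`). For the noise, the squared norm of its sum in the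
inverse Gram matrix is expanded one round at a time by the Sherman–Morrison formula. It is dominated
by a predictable linear form in the noise, minus the quadratic compensator of Hoeffding's lemma,
plus the elliptical potential (`two_mul_quadInv_subSum_le`); the first two terms form the exponent
of a supermartingale (`Interaction.expSuper`, `noise_tail`). The bias over a window of `w` rounds
with path length `V` is at most `k_μ V √w`, a small fraction of the confidence radius while the
drift is at most `ρ w` (`GlmParams.bias_le`). Strong monotonicity of the estimating map turns the
residual bound into an error bound for every index (`GlmParams.index_error`). Hence the scalars are
optimistic against the current optimum, and their excess over the mean rewards is summed by the
elliptical potential (`GlmParams.instance_guarantee`). That statement is pathwise and allows an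
arbitrary set `J` of active rounds, so it serves both GLM-UCB run alone (`GlmParams.assumption1`)
and the paused and resumed instances inside MASTER.

Scheduling in MASTER. All probability is collected in `GoodPath`, which holds with probability at
least `1 - δ` (`GlmParams.goodPath`); what follows is deterministic. Time is cut greedily into
nearly stationary pieces, whose drift is at most `ρ` of their length. Within a piece, the instances
together are optimistic and have regret of order `√w` up to logarithms on a window of `w` rounds
(`GoodPath.window`). Two consequences follow. A restart requires a piece boundary inside the current
block (`no_false_alarm`), so there are at most `log₂ T + 1` blocks per piece. And an instance that
starts after a large gap `f* - g` was seen in the same piece, and is completed inside the piece and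
the block, makes the first test fail (`not_scheduled_of_isCandidate`). So at most one of the coins
at such candidate rounds succeeds, for each order and block; as these coins have known success
probabilities, candidates are rare (`card_candidates_le`).

The regret splits as `(f* - g) + (g - R)`. The second part is controlled by the second test. The
first is decomposed over dyadic gap sizes, and the rounds with a gap of given size are charged to
candidates and to the pairs of a block and a piece (`card_gap_le`, `sum_gap_le`). The result is `c
√(ℓ T)` up to logarithms, for `ℓ` pieces (`GoodPath.regret_le`).

Rates. Every completed piece contains a change of the parameter, so `ℓ ≤ L`; and its drift exceeds
`ρ` of its length, which bounds `ℓ` by the total drift (`pieceCount_le_drift`). The two bounds give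
the two entries of the minimum. -/

/-! ### Quadratic forms of inverse matrices -/

section QuadInv

variable {d : ℕ}

/-- The quadratic form `xᵀ M⁻¹ x`. -/
noncomputable def quadInv (M : Matrix (Fin d) (Fin d) ℝ) (x : Fin d → ℝ) : ℝ := x ⬝ᵥ (M⁻¹ *ᵥ x)

variable {M : Matrix (Fin d) (Fin d) ℝ}

lemma Matrix.PosDef.isUnit_det_real (hM : M.PosDef) : IsUnit M.det :=
  isUnit_iff_ne_zero.2 hM.det_pos.ne'

lemma Matrix.PosDef.mulVec_inv (hM : M.PosDef) (x : Fin d → ℝ) : M *ᵥ (M⁻¹ *ᵥ x) = x := by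
  rw [Matrix.mulVec_mulVec, Matrix.mul_nonsing_inv _ hM.isUnit_det_real, Matrix.one_mulVec]

lemma Matrix.PosDef.inv_mulVec (hM : M.PosDef) (x : Fin d → ℝ) : M⁻¹ *ᵥ (M *ᵥ x) = x := by
  rw [Matrix.mulVec_mulVec, Matrix.nonsing_inv_mul _ hM.isUnit_det_real, Matrix.one_mulVec]

lemma Matrix.PosDef.transpose_eq (hM : M.PosDef) : Mᵀ = M := by
  have h := hM.isHermitian
  rwa [Matrix.IsHermitian, Matrix.conjTranspose_eq_transpose_of_trivial] at h

lemma Matrix.PosDef.dotProduct_mulVec_comm (hM : M.PosDef) (x y : Fin d → ℝ) :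
    x ⬝ᵥ (M *ᵥ y) = y ⬝ᵥ (M *ᵥ x) := by
  rw [Matrix.dotProduct_mulVec, ← Matrix.mulVec_transpose, hM.transpose_eq, dotProduct_comm]

lemma quadInv_nonneg (hM : M.PosDef) (x : Fin d → ℝ) : 0 ≤ quadInv M x := by
  have := hM.inv.posSemidef.dotProduct_mulVec_nonneg x
  simpa [quadInv] using this

lemma quadForm_nonneg (hM : M.PosDef) (x : Fin d → ℝ) : 0 ≤ x ⬝ᵥ (M *ᵥ x) := by
  have := hM.posSemidef.dotProduct_mulVec_nonneg x
  simpa using this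

lemma quadInv_add (hM : M.PosDef) (x y : Fin d → ℝ) :
    quadInv M (x + y) = quadInv M x + 2 * (x ⬝ᵥ (M⁻¹ *ᵥ y)) + quadInv M y := by
  have := hM.inv.dotProduct_mulVec_comm x y
  simp only [quadInv, Matrix.mulVec_add, add_dotProduct, dotProduct_add]
  linarith

lemma quadInv_smul (c : ℝ) (x : Fin d → ℝ) : quadInv M (c • x) = c ^ 2 * quadInv M x := by
  simp only [quadInv, Matrix.mulVec_smul, smul_dotProduct, dotProduct_smul, smul_eq_mul]
  ring

lemma quadInv_mulVec (hM : M.PosDef) (v : Fin d → ℝ) : quadInv M (M *ᵥ v) = v ⬝ᵥ (M *ᵥ v) := by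
  rw [quadInv, hM.inv_mulVec, dotProduct_comm]

/-- Nonnegativity of the inverse form at `x - M z`. This variational inequality yields the
Cauchy–Schwarz inequality between dual norms and, for one choice of `z`, a lower bound on the
inverse form. -/
lemma two_mul_dotProduct_sub_le_quadInv (hM : M.PosDef) (x z : Fin d → ℝ) :
    2 * (x ⬝ᵥ z) - z ⬝ᵥ (M *ᵥ z) ≤ quadInv M x := by
  have h := quadInv_nonneg hM (x + (-1 : ℝ) • (M *ᵥ z))
  rw [quadInv_add hM, quadInv_smul, quadInv_mulVec hM, Matrix.mulVec_smul, hM.inv_mulVec,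
    dotProduct_smul, smul_eq_mul] at h
  linarith

/-- The variational inequality along the line `s • v` says that a quadratic polynomial in `s` is
nonnegative, so its discriminant is not positive. -/
lemma sq_dotProduct_le_quadInv_mul (hM : M.PosDef) (x v : Fin d → ℝ) :
    (x ⬝ᵥ v) ^ 2 ≤ quadInv M x * (v ⬝ᵥ (M *ᵥ v)) := by
  have h : ∀ s : ℝ, 0 ≤ (v ⬝ᵥ (M *ᵥ v)) * (s * s) + (-(2 * (x ⬝ᵥ v))) * s + quadInv M x := by
    intro s
    have := two_mul_dotProduct_sub_le_quadInv hM x (s • v)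
    simp only [Matrix.mulVec_smul, smul_dotProduct, dotProduct_smul, smul_eq_mul] at this
    linarith
  have := discrim_le_zero h
  rw [discrim] at this
  linarith

lemma sq_dotProduct_inv_le (hM : M.PosDef) (x y : Fin d → ℝ) :
    (x ⬝ᵥ (M⁻¹ *ᵥ y)) ^ 2 ≤ quadInv M x * quadInv M y := by
  have h := sq_dotProduct_le_quadInv_mul hM x (M⁻¹ *ᵥ y)
  rwa [hM.mulVec_inv, dotProduct_comm (M⁻¹ *ᵥ y) y] at h

lemma sqrt_quadInv_add_le (hM : M.PosDef) (x y : Fin d → ℝ) :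
    √(quadInv M (x + y)) ≤ √(quadInv M x) + √(quadInv M y) := by
  have hx := quadInv_nonneg hM x
  have hy := quadInv_nonneg hM y
  apply Real.sqrt_le_iff.2 ⟨by positivity, ?_⟩
  rw [quadInv_add hM, add_sq, Real.sq_sqrt hx, Real.sq_sqrt hy]
  have h : x ⬝ᵥ (M⁻¹ *ᵥ y) ≤ √(quadInv M x) * √(quadInv M y) := by
    rw [← Real.sqrt_mul hx]
    exact Real.le_sqrt_of_sq_le (sq_dotProduct_inv_le hM x y)
  linarith

lemma sqrt_quadInv_neg (x : Fin d → ℝ) : √(quadInv M (-x)) = √(quadInv M x) := by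
  rw [← neg_one_smul ℝ x, quadInv_smul]; simp

/-- The rank-one update of a matrix. -/
lemma posDef_add_vecMulVec (hM : M.PosDef) (a : Fin d → ℝ) :
    (M + Matrix.vecMulVec a a).PosDef := by
  refine hM.add_posSemidef ?_
  have := Matrix.posSemidef_vecMulVec_self_star a
  simpa using this

/-- The Sherman–Morrison formula, proved by exhibiting the solution of the updated linear system and
checking it. -/
lemma quadInv_rankOne (hM : M.PosDef) (a y : Fin d → ℝ) :
    quadInv (M + Matrix.vecMulVec a a) y =
      quadInv M y - (a ⬝ᵥ (M⁻¹ *ᵥ y)) ^ 2 / (1 + quadInv M a) := by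
  have hw := quadInv_nonneg hM a
  have hM' := posDef_add_vecMulVec hM a
  set c := (a ⬝ᵥ (M⁻¹ *ᵥ y)) / (1 + quadInv M a) with hc
  have key : (M + Matrix.vecMulVec a a) *ᵥ (M⁻¹ *ᵥ y - c • (M⁻¹ *ᵥ a)) = y := by
    rw [Matrix.add_mulVec, Matrix.mulVec_sub, Matrix.mulVec_smul, hM.mulVec_inv, hM.mulVec_inv,
      Matrix.vecMulVec_mulVec, dotProduct_sub, dotProduct_smul, ← quadInv, smul_eq_mul]
    have : a ⬝ᵥ (M⁻¹ *ᵥ y) - c * quadInv M a = c := by rw [hc]; field_simp; ring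
    rw [this]
    ext i; simp [mul_comm]
  have h2 : (M + Matrix.vecMulVec a a)⁻¹ *ᵥ y = M⁻¹ *ᵥ y - c • (M⁻¹ *ᵥ a) := by
    conv_lhs => rw [← key]
    exact hM'.inv_mulVec _
  rw [quadInv, h2, dotProduct_sub, dotProduct_smul, ← quadInv, hM.inv.dotProduct_mulVec_comm y a,
    smul_eq_mul, hc]
  ring

/-- The same vector enters the matrix and the vector being measured. This is the one-round evolution
of a self-normalized sum, and both the noise bound and the bias bound start from it. -/
lemma quadInv_rankOne_add_smul (hM : M.PosDef) (a x : Fin d → ℝ) (η : ℝ) :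
    quadInv (M + Matrix.vecMulVec a a) (x + η • a) = quadInv M x +
      (2 * η * (a ⬝ᵥ (M⁻¹ *ᵥ x)) + η ^ 2 * quadInv M a - (a ⬝ᵥ (M⁻¹ *ᵥ x)) ^ 2) /
        (1 + quadInv M a) := by
  have hw := quadInv_nonneg hM a
  rw [quadInv_rankOne hM, quadInv_add hM, quadInv_smul, Matrix.mulVec_add, Matrix.mulVec_smul,
    dotProduct_add, dotProduct_smul, dotProduct_smul, hM.inv.dotProduct_mulVec_comm x a, ← quadInv]
  simp only [smul_eq_mul]
  field_simp
  ring

/-- The slack equals the square of `η - a ⬝ᵥ M⁻¹ x` divided by `1 + quadInv M a`. -/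
lemma quadInv_rankOne_add_smul_le (hM : M.PosDef) (a x : Fin d → ℝ) (η : ℝ) :
    quadInv (M + Matrix.vecMulVec a a) (x + η • a) ≤ quadInv M x + η ^ 2 := by
  have hw := quadInv_nonneg hM a
  rw [quadInv_rankOne_add_smul hM]
  have : (2 * η * (a ⬝ᵥ (M⁻¹ *ᵥ x)) + η ^ 2 * quadInv M a - (a ⬝ᵥ (M⁻¹ *ᵥ x)) ^ 2) /
        (1 + quadInv M a) ≤ η ^ 2 := by
    rw [div_le_iff₀ (by linarith)]
    nlinarith [sq_nonneg (η - a ⬝ᵥ (M⁻¹ *ᵥ x))]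
  linarith

lemma quadInv_rankOne_le (hM : M.PosDef) (a x : Fin d → ℝ) :
    quadInv (M + Matrix.vecMulVec a a) x ≤ quadInv M x := by
  simpa using quadInv_rankOne_add_smul_le hM a x 0

lemma det_rankOne (hM : M.PosDef) (a : Fin d → ℝ) :
    (M + Matrix.vecMulVec a a).det = M.det * (1 + quadInv M a) := by
  have := Matrix.det_add_replicateCol_mul_replicateRow (ι := Unit) hM.isUnit_det_real a a
  rw [← Matrix.vecMulVec_eq] at this
  rw [this]
  congr 1
  simp [Matrix.det_unique, quadInv, Matrix.mul_apply, dotProduct, Matrix.mulVec, Finset.sum_mul,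
    Finset.mul_sum]
  rw [Finset.sum_comm]
  refine Finset.sum_congr rfl fun i _ => Finset.sum_congr rfl fun j _ => ?_
  ring

/-- A positive definite matrix whose quadratic form is at most `b ‖x‖²` has determinant at most
`b ^ d`. -/
lemma det_le_pow_of_quadForm_le (hM : M.PosDef) {b : ℝ}
    (hb : ∀ x : Fin d → ℝ, x ⬝ᵥ (M *ᵥ x) ≤ b * (x ⬝ᵥ x)) : M.det ≤ b ^ d := by
  have hH := hM.isHermitian
  have h1 : M.det = ∏ i, hH.eigenvalues i := by
    simpa using hH.det_eq_prod_eigenvalues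
  rw [h1]
  calc ∏ i, hH.eigenvalues i ≤ ∏ _i : Fin d, b := by
        refine Finset.prod_le_prod (fun i _ => (hM.eigenvalues_pos i).le) fun i _ => ?_
        set e : Fin d → ℝ := (hH.eigenvectorBasis i).ofLp with he
        have h2 := hH.mulVec_eigenvectorBasis i
        have h3 : e ⬝ᵥ e = 1 := by
          have := hH.eigenvectorBasis.orthonormal.1 i
          have h4 : inner ℝ (hH.eigenvectorBasis i) (hH.eigenvectorBasis i) = (1 : ℝ) := by
            rw [real_inner_self_eq_norm_sq, this]; norm_num
          rw [PiLp.inner_apply] at h4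
          simpa [dotProduct, sq] using h4
        have h5 := hb e
        rw [h2, dotProduct_smul, h3] at h5
        simpa using h5
    _ = b ^ d := by simp

end QuadInv


/-! ### Exponential supermartingales -/

section ExpSupermartingale

/-- Hoeffding's lemma for a Bernoulli variable. -/
lemma bernoulli_mgf_le {p : ℝ} (hp0 : 0 ≤ p) (hp1 : p ≤ 1) (s : ℝ) :
    1 + p * (Real.exp s - 1) ≤ Real.exp (s * p + s ^ 2 / 8) := by
  -- The two-point law with mean `p`: Hoeffding's lemma for variables in `[0, 1]`, applied to the
  -- identity under this law, is the claim up to the factor `exp (s p)`.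
  set ν : Measure ℝ := ENNReal.ofReal (1 - p) • Measure.dirac 0 + ENNReal.ofReal p • Measure.dirac 1
    with hν
  have hprob : IsProbabilityMeasure ν := by
    constructor
    simp only [hν, Measure.coe_add, Pi.add_apply, Measure.smul_apply, measure_univ, smul_eq_mul,
      mul_one]
    rw [← ENNReal.ofReal_add (by linarith) hp0]; simp
  have hint : ∀ g : ℝ → ℝ, Measurable g → ∫ x, g x ∂ν = (1 - p) * g 0 + p * g 1 := by
    intro g hg
    have hd : ∀ c : ℝ, Integrable g (Measure.dirac c) := fun c =>
      (integrable_dirac (by simp [enorm_lt_top]))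
    rw [hν, integral_add_measure ((hd 0).smul_measure (by simp)) ((hd 1).smul_measure (by simp)),
      integral_smul_measure, integral_smul_measure, integral_dirac, integral_dirac,
      ENNReal.toReal_ofReal (by linarith), ENNReal.toReal_ofReal hp0, smul_eq_mul, smul_eq_mul]
  have hae : ∀ᵐ x ∂ν, x ∈ Set.Icc (0 : ℝ) 1 := by
    rw [hν, ae_add_measure_iff]
    constructor <;> refine Measure.ae_smul_measure ?_ _ <;>
      simp
  have h := (hasSubgaussianMGF_of_mem_Icc (X := fun x : ℝ => x) (μ := ν)
    measurable_id.aemeasurable hae).mgf_le s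
  have hm : ∫ x, x ∂ν = p := by rw [hint (fun x => x) measurable_id]; ring
  rw [mgf, hm, hint (fun x => Real.exp (s * (x - p))) (by fun_prop)] at h
  have e1 : Real.exp (s * (0 - p)) = Real.exp (-(s * p)) := by ring_nf
  have e2 : Real.exp (s * (1 - p)) = Real.exp s * Real.exp (-(s * p)) := by
    rw [← Real.exp_add]; ring_nf
  have e3 : Real.exp (s * p + s ^ 2 / 8) = Real.exp (s * p) * Real.exp (s ^ 2 / 8) :=
    Real.exp_add _ _
  have e4 : Real.exp (s * p) * Real.exp (-(s * p)) = 1 := by rw [← Real.exp_add]; simp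
  have e5 : ((((‖(1 : ℝ) - 0‖₊ / 2) ^ 2 : NNReal) : ℝ)) * s ^ 2 / 2 = s ^ 2 / 8 := by
    push_cast
    rw [sub_zero, norm_one]; ring
  rw [e5, e1, e2] at h
  rw [e3]
  have := mul_le_mul_of_nonneg_left h (Real.exp_pos (s * p)).le
  calc 1 + p * (Real.exp s - 1) = Real.exp (s * p) * Real.exp (-(s * p)) *
        (1 + p * (Real.exp s - 1)) := by rw [e4]; ring
    _ ≤ _ := by linarith

/-- The chord of the exponential over `[0, s]`. It replaces a reward in `[0, 1]` by a Bernoulli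
variable with the same mean. -/
lemma exp_mul_le_one_add {s r : ℝ} (h0 : 0 ≤ r) (h1 : r ≤ 1) :
    Real.exp (s * r) ≤ 1 + r * (Real.exp s - 1) := by
  have := convexOn_exp.2 (Set.mem_univ 0) (Set.mem_univ s) (by linarith : (0:ℝ) ≤ 1 - r) h0
    (by ring)
  simp only [smul_eq_mul, mul_zero, zero_add, Real.exp_zero, mul_one] at this
  rw [mul_comm s r]; linarith

/-- Completing the square gives `2 η ^ 2` as the maximum over `s`. The tilts used later are
predictable without a uniform bound, and this keeps the exponents bounded all the same. -/
lemma mul_sub_sq_le_two {s η : ℝ} (h : |η| ≤ 1) : s * η - s ^ 2 / 8 ≤ 2 := by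
  have : η ^ 2 ≤ 1 := by rw [← sq_abs]; nlinarith [abs_nonneg η]
  nlinarith [sq_nonneg (s - 4 * η)]

variable {Ω : Type u} {mΩ : MeasurableSpace Ω} {P : Measure Ω} [IsProbabilityMeasure P]

lemma integrable_of_bounded {m : MeasurableSpace Ω} (hm : m ≤ mΩ) {W : Ω → ℝ}
    (hW : Measurable[m] W) {c : ℝ} (hc : ∀ ω, |W ω| ≤ c) : Integrable W P :=
  Integrable.of_bound (hW.mono hm le_rfl).aestronglyMeasurable c
    (Filter.Eventually.of_forall fun ω => by simpa using hc ω)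

/-- A bounded `𝒢`-measurable weight sees a variable only through its conditional mean. -/
lemma integral_mul_of_condExp {𝒢 : MeasurableSpace Ω} (h𝒢 : 𝒢 ≤ mΩ) {R F W : Ω → ℝ}
    (hR : Measurable[mΩ] R) (hR01 : ∀ ω, R ω ∈ Set.Icc (0 : ℝ) 1) (hmean : P[R | 𝒢] =ᵐ[P] F)
    (hW : Measurable[𝒢] W) {c : ℝ} (hc : ∀ ω, |W ω| ≤ c) :
    ∫ ω, W ω * R ω ∂P = ∫ ω, W ω * F ω ∂P := by
  have hRint : Integrable R P := integrable_of_bounded le_rfl hR (c := 1) fun ω => by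
    rw [abs_of_nonneg (hR01 ω).1]; exact (hR01 ω).2
  have h1 := condExp_stronglyMeasurable_mul_of_bound h𝒢 hW.stronglyMeasurable hRint c
    (Filter.Eventually.of_forall fun ω => by simpa using hc ω)
  calc ∫ ω, W ω * R ω ∂P = ∫ ω, (P[W * R | 𝒢]) ω ∂P := (integral_condExp h𝒢).symm
    _ = ∫ ω, W ω * F ω ∂P := by
      refine integral_congr_ae ?_
      filter_upwards [h1, hmean] with ω h2 h3
      rw [h2, Pi.mul_apply, h3]

/-- Conditional Hoeffding inequality for rewards in `[0, 1]`, tested against a weight. -/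
lemma integral_mul_exp_reward_le {𝒢 : MeasurableSpace Ω} (h𝒢 : 𝒢 ≤ mΩ) {R F W s : Ω → ℝ}
    (hR : Measurable[mΩ] R) (hR01 : ∀ ω, R ω ∈ Set.Icc (0 : ℝ) 1) (hmean : P[R | 𝒢] =ᵐ[P] F)
    (hF : Measurable[𝒢] F) (hF01 : ∀ ω, F ω ∈ Set.Icc (0 : ℝ) 1)
    (hs : Measurable[𝒢] s) (hW : Measurable[𝒢] W) (hW0 : ∀ ω, 0 ≤ W ω) {c : ℝ}
    (hc : ∀ ω, W ω ≤ c) :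
    ∫ ω, W ω * Real.exp (s ω * (R ω - F ω) - s ω ^ 2 / 8) ∂P ≤ ∫ ω, W ω ∂P := by
  -- By the chord bound the integrand is at most `A + B R`, affine in `R` with bounded coefficients
  -- that are known before the reward. Conditioning then merely replaces `R` by its mean `F`, and
  -- the Bernoulli bound finishes.
  set A : Ω → ℝ := fun ω => W ω * Real.exp (-(s ω * F ω) - s ω ^ 2 / 8) with hA
  set B : Ω → ℝ := fun ω => W ω * (Real.exp (s ω * (1 - F ω) - s ω ^ 2 / 8) -
    Real.exp (-(s ω * F ω) - s ω ^ 2 / 8)) with hB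
  have hc' : ∀ ω, |W ω| ≤ c := fun ω => by rw [abs_of_nonneg (hW0 ω)]; exact hc ω
  have hc0 : ∀ _ω : Ω, 0 ≤ c := fun ω => (hW0 ω).trans (hc ω)
  have hAm : Measurable[𝒢] A := by
    apply hW.mul; apply Real.measurable_exp.comp
    exact ((hs.mul hF).neg).sub ((hs.pow_const 2).div_const 8)
  have hBm : Measurable[𝒢] B := by
    apply hW.mul
    apply Measurable.sub
    · apply Real.measurable_exp.comp
      exact (hs.mul (measurable_const.sub hF)).sub ((hs.pow_const 2).div_const 8)
    · apply Real.measurable_exp.comp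
      exact ((hs.mul hF).neg).sub ((hs.pow_const 2).div_const 8)
  have b1 : ∀ ω, Real.exp (-(s ω * F ω) - s ω ^ 2 / 8) ≤ Real.exp 2 := fun ω => by
    apply Real.exp_le_exp.2
    have := mul_sub_sq_le_two (s := s ω) (η := -F ω)
      (by rw [abs_neg, abs_of_nonneg (hF01 ω).1]; exact (hF01 ω).2)
    linarith
  have b2 : ∀ ω, Real.exp (s ω * (1 - F ω) - s ω ^ 2 / 8) ≤ Real.exp 2 := fun ω => by
    apply Real.exp_le_exp.2
    exact mul_sub_sq_le_two (by rw [abs_le]; constructor <;> linarith [(hF01 ω).1, (hF01 ω).2])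
  have hAb : ∀ ω, |A ω| ≤ c * Real.exp 2 := fun ω => by
    rw [hA, abs_mul, abs_of_pos (Real.exp_pos _)]
    exact mul_le_mul (hc' ω) (b1 ω) (Real.exp_pos _).le (hc0 ω)
  have hBb : ∀ ω, |B ω| ≤ c * Real.exp 2 := fun ω => by
    rw [hB, abs_mul]
    refine mul_le_mul (hc' ω) ?_ (abs_nonneg _) (hc0 ω)
    rw [abs_le]
    constructor <;> linarith [b1 ω, b2 ω, Real.exp_pos (s ω * (1 - F ω) - s ω ^ 2 / 8),
      Real.exp_pos (-(s ω * F ω) - s ω ^ 2 / 8)]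
  have hAi : Integrable A P := integrable_of_bounded h𝒢 hAm hAb
  have hBRi : Integrable (fun ω => B ω * R ω) P := by
    refine integrable_of_bounded le_rfl ((hBm.mono h𝒢 le_rfl).mul hR) (c := c * Real.exp 2)
      fun ω => ?_
    rw [abs_mul, abs_of_nonneg (hR01 ω).1]
    calc _ ≤ c * Real.exp 2 * 1 := mul_le_mul (hBb ω) (hR01 ω).2 (hR01 ω).1
          ((abs_nonneg _).trans (hBb ω))
      _ = _ := mul_one _
  have hBFi : Integrable (fun ω => B ω * F ω) P := by
    refine integrable_of_bounded h𝒢 (hBm.mul hF) (c := c * Real.exp 2) fun ω => ?_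
    rw [abs_mul, abs_of_nonneg (hF01 ω).1]
    calc _ ≤ c * Real.exp 2 * 1 := mul_le_mul (hBb ω) (hF01 ω).2 (hF01 ω).1
          ((abs_nonneg _).trans (hBb ω))
      _ = _ := mul_one _
  have hexp : ∀ ω, Real.exp (s ω * (1 - F ω) - s ω ^ 2 / 8) =
      Real.exp (-(s ω * F ω) - s ω ^ 2 / 8) * Real.exp (s ω) := fun ω => by
    rw [← Real.exp_add]; ring_nf
  calc ∫ ω, W ω * Real.exp (s ω * (R ω - F ω) - s ω ^ 2 / 8) ∂P
      ≤ ∫ ω, (A ω + B ω * R ω) ∂P := by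
        refine integral_mono_of_nonneg (Filter.Eventually.of_forall fun ω =>
          mul_nonneg (hW0 ω) (Real.exp_pos _).le) (hAi.add hBRi)
          (Filter.Eventually.of_forall fun ω => ?_)
        have h1 := exp_mul_le_one_add (s := s ω) (hR01 ω).1 (hR01 ω).2
        have h2 : Real.exp (s ω * (R ω - F ω) - s ω ^ 2 / 8) =
          Real.exp (-(s ω * F ω) - s ω ^ 2 / 8) * Real.exp (s ω * R ω) := by
          rw [← Real.exp_add]; ring_nf
        simp only [hA, hB]
        rw [h2, hexp]
        have := mul_le_mul_of_nonneg_left h1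
          (mul_nonneg (hW0 ω) (Real.exp_pos (-(s ω * F ω) - s ω ^ 2 / 8)).le)
        linarith
    _ = ∫ ω, (A ω + B ω * F ω) ∂P := by
        rw [integral_add hAi hBRi, integral_add hAi hBFi,
          integral_mul_of_condExp h𝒢 hR hR01 hmean hBm hBb]
    _ ≤ ∫ ω, W ω ∂P := by
        refine integral_mono (hAi.add hBFi) (integrable_of_bounded h𝒢 hW hc') fun ω => ?_
        have h1 := bernoulli_mgf_le (hF01 ω).1 (hF01 ω).2 (s ω)
        have h2 : Real.exp (-(s ω * F ω) - s ω ^ 2 / 8) *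
            Real.exp (s ω * F ω + s ω ^ 2 / 8) = 1 := by rw [← Real.exp_add]; simp
        simp only [hA, hB]
        rw [hexp]
        have := mul_le_mul_of_nonneg_left h1
          (mul_nonneg (hW0 ω) (Real.exp_pos (-(s ω * F ω) - s ω ^ 2 / 8)).le)
        rw [mul_assoc (W ω) _ (Real.exp (s ω * F ω + s ω ^ 2 / 8)), h2] at this
        linarith

/-- Weighted exponential inequality for a variable independent of the weight. -/
lemma integral_mul_exp_indicator_le {𝓗 𝒦 : MeasurableSpace Ω} (h𝓗 : 𝓗 ≤ mΩ) (h𝒦 : 𝒦 ≤ mΩ)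
    (hind : Indep 𝒦 𝓗 P) {Y W : Ω → ℝ} {D : Set Ω} (hD : MeasurableSet[𝓗] D)
    (hY : Measurable[𝒦] Y) {b : ℝ} (hYb : ∀ ω, Y ω ≤ b) (hY1 : ∫ ω, Real.exp (Y ω) ∂P ≤ 1)
    (hW : Measurable[𝓗] W) (hW0 : ∀ ω, 0 ≤ W ω) {c : ℝ} (hc : ∀ ω, W ω ≤ c) :
    ∫ ω, W ω * Real.exp (D.indicator Y ω) ∂P ≤ ∫ ω, W ω ∂P := by
  have hc' : ∀ ω, |W ω| ≤ c := fun ω => by rw [abs_of_nonneg (hW0 ω)]; exact hc ω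
  have hWi : Integrable W P := integrable_of_bounded h𝓗 hW hc'
  have hWD : Measurable[𝓗] (D.indicator W) := hW.indicator hD
  have hYe : Measurable[𝒦] (fun ω => Real.exp (Y ω) - 1) :=
    (Real.measurable_exp.comp hY).sub measurable_const
  have hYeb : ∀ ω, |Real.exp (Y ω) - 1| ≤ Real.exp b + 1 := fun ω => by
    have h1 := Real.exp_le_exp.2 (hYb ω)
    have h2 := Real.exp_pos (Y ω)
    rw [abs_le]; constructor <;> linarith
  have hWDb : ∀ ω, |D.indicator W ω| ≤ c := fun ω => by
    by_cases h : ω ∈ D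
    · simpa [h] using hc' ω
    · simpa [h] using (hW0 ω).trans (hc ω)
  have hif : IndepFun (D.indicator W) (fun ω => Real.exp (Y ω) - 1) P := by
    refine (IndepFun_iff_Indep _ _ _).2 ?_
    exact indep_of_indep_of_le_left (indep_of_indep_of_le_right hind.symm hYe.comap_le)
      hWD.comap_le
  have hprod := hif.integral_fun_mul_eq_mul_integral
    (hWD.mono h𝓗 le_rfl).aestronglyMeasurable (hYe.mono h𝒦 le_rfl).aestronglyMeasurable
  have hDi : Integrable (fun ω => D.indicator W ω * (Real.exp (Y ω) - 1)) P := by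
    refine integrable_of_bounded le_rfl
      ((hWD.mono h𝓗 le_rfl).mul (hYe.mono h𝒦 le_rfl)) (c := c * (Real.exp b + 1)) fun ω => ?_
    rw [abs_mul]
    exact mul_le_mul (hWDb ω) (hYeb ω) (abs_nonneg _) ((hW0 ω).trans (hc ω))
  -- Off `D` the exponential factor is `1`. The excess is a product of two independent factors, one
  -- nonnegative and one with nonpositive mean.
  have heq : ∀ ω, W ω * Real.exp (D.indicator Y ω) =
      W ω + D.indicator W ω * (Real.exp (Y ω) - 1) := fun ω => by
    by_cases h : ω ∈ D
    · simp [h]; ring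
    · simp [h]
  have hYei : Integrable (fun ω => Real.exp (Y ω)) P :=
    integrable_of_bounded h𝒦 (Real.measurable_exp.comp hY) (c := Real.exp b) fun ω => by
      rw [abs_of_pos (Real.exp_pos _)]; exact Real.exp_le_exp.2 (hYb ω)
  have h3 : ∫ ω, (Real.exp (Y ω) - 1) ∂P ≤ 0 := by
    rw [integral_sub hYei (integrable_const _)]; simpa using hY1
  have h4 : 0 ≤ ∫ ω, D.indicator W ω ∂P :=
    integral_nonneg fun ω => Set.indicator_nonneg (fun ω _ => hW0 ω) ω
  calc ∫ ω, W ω * Real.exp (D.indicator Y ω) ∂P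
      = ∫ ω, (W ω + D.indicator W ω * (Real.exp (Y ω) - 1)) ∂P := by simp_rw [heq]
    _ = ∫ ω, W ω ∂P + (∫ ω, D.indicator W ω ∂P) * ∫ ω, (Real.exp (Y ω) - 1) ∂P := by
        rw [integral_add hWi hDi, hprod]
    _ ≤ _ := by nlinarith

/-- The increments `Z 1, …, Z T` have exponential moments at most `1` given the past. -/
structure ExpSuper (P : Measure Ω) (T : ℕ) (ℱ : Filtration ℕ mΩ) (Z : ℕ → Ω → ℝ) : Prop where
  meas : ∀ t ∈ Finset.Icc 1 T, Measurable[ℱ t] (Z t)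
  bdd : ∃ C, ∀ t ∈ Finset.Icc 1 T, ∀ ω, Z t ω ≤ C
  step : ∀ t ∈ Finset.Icc 1 T, ∀ W : Ω → ℝ, Measurable[ℱ (t - 1)] W → (∀ ω, 0 ≤ W ω) →
    (∃ c, ∀ ω, W ω ≤ c) → ∫ ω, W ω * Real.exp (Z t ω) ∂P ≤ ∫ ω, W ω ∂P

/-- Measurability, boundedness and the integral bound have to be carried through the induction
together, because the partial exponential is itself the weight against which the next increment is
tested. -/
lemma ExpSuper.integral_exp_le {T : ℕ} {ℱ : Filtration ℕ mΩ} {Z : ℕ → Ω → ℝ}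
    (h : ExpSuper P T ℱ Z) {n : ℕ} (hn : n ≤ T) :
    Measurable[ℱ n] (fun ω => ∑ τ ∈ Finset.Icc 1 n, Z τ ω) ∧
    (∃ c, ∀ ω, Real.exp (∑ τ ∈ Finset.Icc 1 n, Z τ ω) ≤ c) ∧
    ∫ ω, Real.exp (∑ τ ∈ Finset.Icc 1 n, Z τ ω) ∂P ≤ 1 := by
  obtain ⟨C, hC⟩ := h.bdd
  induction n with
  | zero => simp only [zero_lt_one, Finset.Icc_eq_empty_of_lt, Finset.sum_empty, Real.exp_zero]
            exact ⟨measurable_const, ⟨1, fun _ => le_rfl⟩, by simp⟩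
  | succ n ih =>
    obtain ⟨h1, ⟨c, h2⟩, h3⟩ := ih (by omega)
    have hmem : n + 1 ∈ Finset.Icc 1 T := by simp; omega
    simp only [Finset.sum_Icc_succ_top (Nat.le_add_left 1 n), Real.exp_add]
    refine ⟨(h1.mono (ℱ.mono (Nat.le_succ n)) le_rfl).add (h.meas _ hmem),
      ⟨c * Real.exp C, fun ω => ?_⟩, ?_⟩
    · exact mul_le_mul (h2 ω) (Real.exp_le_exp.2 (hC _ hmem ω)) (Real.exp_pos _).le
        ((Real.exp_pos _).le.trans (h2 ω))
    · exact (h.step _ hmem _ (Real.measurable_exp.comp h1) (fun ω => (Real.exp_pos _).le)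
        ⟨c, h2⟩).trans h3

/-- Markov's inequality for the exponential of the sum. -/
lemma ExpSuper.tail {T : ℕ} {ℱ : Filtration ℕ mΩ} {Z : ℕ → Ω → ℝ}
    (h : ExpSuper P T ℱ Z) {n : ℕ} (hn : n ≤ T) {ζ : ℝ} (hζ : 0 < ζ) :
    P {ω | Real.log (1 / ζ) < ∑ τ ∈ Finset.Icc 1 n, Z τ ω} ≤ ENNReal.ofReal ζ := by
  obtain ⟨h1, ⟨c, h2⟩, h3⟩ := h.integral_exp_le hn
  have hint : Integrable (fun ω => Real.exp (∑ τ ∈ Finset.Icc 1 n, Z τ ω)) P :=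
    integrable_of_bounded (ℱ.le n) (Real.measurable_exp.comp h1) (c := c) fun ω => by
      rw [abs_of_pos (Real.exp_pos _)]; exact h2 ω
  have hmk := mul_meas_ge_le_integral_of_nonneg
    (Filter.Eventually.of_forall fun ω => (Real.exp_pos _).le) hint (1 / ζ)
  have hle : P.real {ω | 1 / ζ ≤ Real.exp (∑ τ ∈ Finset.Icc 1 n, Z τ ω)} ≤ ζ := by
    have := hmk.trans h3
    rw [one_div, inv_mul_le_iff₀ hζ] at this
    simpa using this
  calc P {ω | Real.log (1 / ζ) < ∑ τ ∈ Finset.Icc 1 n, Z τ ω}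
      ≤ P {ω | 1 / ζ ≤ Real.exp (∑ τ ∈ Finset.Icc 1 n, Z τ ω)} := by
        refine measure_mono fun ω hω => ?_
        have h4 : Real.log (1 / ζ) < _ := hω
        have h5 := Real.exp_lt_exp.2 h4
        rw [Real.exp_log (by positivity)] at h5
        exact h5.le
    _ ≤ ENNReal.ofReal ζ := by
        rw [← ENNReal.ofReal_toReal (measure_ne_top P _)]
        exact ENNReal.ofReal_le_ofReal hle

/-- If bad events indexed by a finite set have probability at most `ζ` each, then outside an event
of probability at most `N ζ` none of them happens. -/
lemma ofReal_one_sub_le_of_union {ι : Type*} (s : Finset ι) (bad : ι → Set Ω) {ζ ε : ℝ}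
    (hζ : 0 ≤ ζ) (hbad : ∀ i ∈ s, P (bad i) ≤ ENNReal.ofReal ζ) (hε : s.card * ζ ≤ ε)
    {good : Set Ω} (hgood : ∀ ω, (∀ i ∈ s, ω ∉ bad i) → ω ∈ good) :
    ENNReal.ofReal (1 - ε) ≤ P good := by
  have h1 : P (⋃ i ∈ s, bad i) ≤ ENNReal.ofReal ε := by
    calc P (⋃ i ∈ s, bad i) ≤ ∑ i ∈ s, P (bad i) := measure_biUnion_finset_le _ _
      _ ≤ ∑ _i ∈ s, ENNReal.ofReal ζ := Finset.sum_le_sum hbad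
      _ = ENNReal.ofReal (s.card * ζ) := by
        rw [Finset.sum_const, nsmul_eq_mul, ENNReal.ofReal_mul (by positivity),
          ENNReal.ofReal_natCast]
      _ ≤ _ := ENNReal.ofReal_le_ofReal hε
  have h2 : (Set.univ : Set Ω) ⊆ good ∪ ⋃ i ∈ s, bad i := by
    intro ω _
    by_cases h : ∀ i ∈ s, ω ∉ bad i
    · exact Or.inl (hgood ω h)
    · push Not at h
      obtain ⟨i, hi, hω⟩ := h
      exact Or.inr (Set.mem_biUnion hi hω)
  have h3 : (1 : ENNReal) ≤ P good + ENNReal.ofReal ε := by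
    calc (1 : ENNReal) = P Set.univ := measure_univ.symm
      _ ≤ P (good ∪ ⋃ i ∈ s, bad i) := measure_mono h2
      _ ≤ P good + P (⋃ i ∈ s, bad i) := measure_union_le _ _
      _ ≤ _ := by gcongr
  have hε0 : 0 ≤ ε := le_trans (by positivity) hε
  rw [ENNReal.ofReal_sub _ hε0, ENNReal.ofReal_one]
  exact tsub_le_iff_right.2 h3

end ExpSupermartingale


/-! ### GLM-UCB along one sample path -/

section GlmPath

open Classical in
/-- The policies and rewards of the rounds `1, …, n` that satisfy `J`. -/
noncomputable def subHistory {Pol : Type v} (J : ℕ → Prop) (π : ℕ → Pol) (R : ℕ → ℝ) (n : ℕ) :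
    List (Pol × ℝ) :=
  ((List.range' 1 n).filter fun τ => decide (J τ)).map fun τ => (π τ, R τ)

open Classical in
lemma subHistory_succ {Pol : Type v} (J : ℕ → Prop) (π : ℕ → Pol) (R : ℕ → ℝ) (n : ℕ) :
    subHistory J π R (n + 1) =
      if J (n + 1) then subHistory J π R n ++ [(π (n + 1), R (n + 1))] else subHistory J π R n := by
  rw [subHistory, List.range'_1_concat, List.filter_append, List.map_append, add_comm 1 n]
  by_cases h : J (n + 1) <;> simp [h, subHistory]

@[simp] lemma subHistory_zero {Pol : Type v} (J : ℕ → Prop) (π : ℕ → Pol) (R : ℕ → ℝ) :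
    subHistory J π R 0 = [] := rfl

open Classical in
/-- The sum of `y τ • z τ` over the rounds `1, …, n` that satisfy `J`. -/
noncomputable def subSum {d : ℕ} (J : ℕ → Prop) (y : ℕ → ℝ) (z : ℕ → Fin d → ℝ) (n : ℕ) :
    Fin d → ℝ :=
  ∑ τ ∈ Finset.Icc 1 n, if J τ then y τ • z τ else 0

variable {d : ℕ} {A : Set (EuclideanSpace ℝ (Fin d))}

lemma inner_eq_dotProduct (x y : EuclideanSpace ℝ (Fin d)) :
    inner ℝ x y = x.ofLp ⬝ᵥ y.ofLp := by
  simp [PiLp.inner_apply, dotProduct, mul_comm]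

lemma norm_sq_eq_dotProduct (x : EuclideanSpace ℝ (Fin d)) : ‖x‖ ^ 2 = x.ofLp ⬝ᵥ x.ofLp := by
  rw [← real_inner_self_eq_norm_sq, inner_eq_dotProduct]

lemma glmGram_nil (lam : ℝ) : glmGram (A := A) lam [] = lam • 1 := by simp [glmGram]

lemma glmGram_append (lam : ℝ) (h : List (A × ℝ)) (p : A × ℝ) :
    glmGram lam (h ++ [p]) = glmGram lam h + Matrix.vecMulVec p.1.1.ofLp p.1.1.ofLp := by
  simp [glmGram, add_assoc]

lemma glmGram_posDef {lam : ℝ} (hlam : 0 < lam) (h : List (A × ℝ)) : (glmGram lam h).PosDef := by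
  induction h using List.reverseRecOn with
  | nil => rw [glmGram_nil]; exact Matrix.PosDef.one.smul hlam
  | append_singleton h p ih => rw [glmGram_append]; exact posDef_add_vecMulVec ih _

lemma quadInv_smul_one {lam : ℝ} (hlam : 0 < lam) (x : Fin d → ℝ) :
    quadInv (lam • (1 : Matrix (Fin d) (Fin d) ℝ)) x = (x ⬝ᵥ x) / lam := by
  have : (lam • (1 : Matrix (Fin d) (Fin d) ℝ))⁻¹ = lam⁻¹ • 1 := by
    apply Matrix.inv_eq_right_inv
    simp [smul_smul, hlam.ne']
  rw [quadInv, this, Matrix.smul_mulVec, Matrix.one_mulVec, dotProduct_smul, smul_eq_mul]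
  field_simp

lemma quadInv_glmGram_le {lam : ℝ} (hlam : 0 < lam) (h : List (A × ℝ)) (x : Fin d → ℝ) :
    quadInv (glmGram lam h) x ≤ (x ⬝ᵥ x) / lam := by
  induction h using List.reverseRecOn with
  | nil => rw [glmGram_nil, quadInv_smul_one hlam]
  | append_singleton h p ih =>
    rw [glmGram_append]; exact (quadInv_rankOne_le (glmGram_posDef hlam h) _ _).trans ih

lemma quadForm_glmGram_le (hA : ∀ a ∈ A, ‖a‖ ≤ 1) {lam : ℝ} (h : List (A × ℝ)) (x : Fin d → ℝ) :
    x ⬝ᵥ (glmGram lam h *ᵥ x) ≤ (lam + h.length) * (x ⬝ᵥ x) := by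
  induction h using List.reverseRecOn with
  | nil => simp [glmGram_nil, Matrix.smul_mulVec]
  | append_singleton h p ih =>
    have h1 : (p.1.1.ofLp ⬝ᵥ x) ^ 2 ≤ x ⬝ᵥ x := by
      have h2 := real_inner_mul_inner_self_le p.1.1 (WithLp.toLp 2 x)
      rw [inner_eq_dotProduct, inner_eq_dotProduct, ← norm_sq_eq_dotProduct p.1.1,
        inner_eq_dotProduct] at h2
      have h3 : ‖p.1.1‖ ^ 2 ≤ 1 := pow_le_one₀ (norm_nonneg _) (hA _ p.1.2)
      have h4 : 0 ≤ x ⬝ᵥ x := by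
        rw [show x = (WithLp.toLp 2 x : EuclideanSpace ℝ (Fin d)).ofLp from rfl,
          ← norm_sq_eq_dotProduct]
        positivity
      simp only at h2
      nlinarith
    rw [glmGram_append, Matrix.add_mulVec, dotProduct_add, Matrix.vecMulVec_mulVec]
    simp only [List.length_append, List.length_singleton, Nat.cast_add, Nat.cast_one,
      dotProduct_smul, MulOpposite.smul_eq_mul_unop, MulOpposite.unop_op]
    rw [dotProduct_comm x p.1.1.ofLp]
    nlinarith

/-- The Gram form is at most `lam + n` times the Euclidean one, so its inverse is at least the
reciprocal multiple: take `z = x / (lam + n)` in the variational inequality. This is what makes a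
trivial bound on the error comparable to the confidence width. -/
lemma dotProduct_le_mul_quadInv_glmGram (hA : ∀ a ∈ A, ‖a‖ ≤ 1) {lam : ℝ} (hlam : 0 < lam)
    (h : List (A × ℝ)) (x : Fin d → ℝ) :
    x ⬝ᵥ x ≤ (lam + h.length) * quadInv (glmGram lam h) x := by
  set b := lam + (h.length : ℝ) with hb
  have hb0 : 0 < b := by positivity
  have h1 := two_mul_dotProduct_sub_le_quadInv (glmGram_posDef hlam h) x (b⁻¹ • x)
  have h2 := quadForm_glmGram_le hA (lam := lam) h (b⁻¹ • x)
  rw [← hb] at h2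
  simp only [dotProduct_smul, smul_dotProduct, smul_eq_mul] at h1 h2
  have h3 : b * (b⁻¹ * (b⁻¹ * (x ⬝ᵥ x))) = b⁻¹ * (x ⬝ᵥ x) := by field_simp
  have h4 : b⁻¹ * (x ⬝ᵥ x) ≤ quadInv (glmGram lam h) x := by linarith
  rwa [inv_mul_le_iff₀ hb0] at h4

lemma det_glmGram_nil (lam : ℝ) : (glmGram (A := A) lam []).det = lam ^ d := by
  simp [glmGram_nil]

lemma log_det_glmGram_le (hA : ∀ a ∈ A, ‖a‖ ≤ 1) {lam : ℝ} (hlam : 0 < lam) (h : List (A × ℝ)) :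
    Real.log (glmGram lam h).det - d * Real.log lam ≤ d * Real.log (1 + h.length / lam) := by
  have h1 := det_le_pow_of_quadForm_le (glmGram_posDef hlam h) (quadForm_glmGram_le hA h)
  have h2 := Real.log_le_log (glmGram_posDef hlam h).det_pos h1
  rw [Real.log_pow] at h2
  have h3 : lam + h.length = lam * (1 + h.length / lam) := by field_simp
  rw [h3, Real.log_mul hlam.ne' (by positivity)] at h2
  linarith

/-! #### Properties of the link function -/

lemma kLink_nonneg_and_le {μ : ℝ → ℝ} (hb : BddAbove (deriv μ '' Set.Icc (-1) 1)) {x : ℝ}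
    (hx : x ∈ Set.Icc (-1 : ℝ) 1) : deriv μ x ≤ kLink μ :=
  le_csSup hb ⟨x, hx, rfl⟩

lemma cLink_le_deriv {μ : ℝ → ℝ} (hm : Monotone μ) {x : ℝ} (hx : x ∈ Set.Icc (-1 : ℝ) 1) :
    cLink μ ≤ deriv μ x :=
  csInf_le ⟨0, by rintro _ ⟨y, _, rfl⟩; exact hm.deriv_nonneg⟩ ⟨x, hx, rfl⟩

lemma cLink_le_kLink {μ : ℝ → ℝ} (hm : Monotone μ) (hb : BddAbove (deriv μ '' Set.Icc (-1) 1)) :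
    cLink μ ≤ kLink μ :=
  (cLink_le_deriv hm (x := 0) (by simp)).trans (kLink_nonneg_and_le hb (by simp))

lemma link_sub_bounds {μ : ℝ → ℝ} (hd : Differentiable ℝ μ) (hm : Monotone μ)
    (hb : BddAbove (deriv μ '' Set.Icc (-1) 1)) {x y : ℝ} (hx : x ∈ Set.Icc (-1 : ℝ) 1)
    (hy : y ∈ Set.Icc (-1 : ℝ) 1) (hxy : x ≤ y) :
    cLink μ * (y - x) ≤ μ y - μ x ∧ μ y - μ x ≤ kLink μ * (y - x) :=
  ⟨(convex_Icc (-1 : ℝ) 1).mul_sub_le_image_sub_of_le_deriv hd.continuous.continuousOn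
      hd.differentiableOn (fun _ hz => cLink_le_deriv hm (interior_subset hz)) x hx y hy hxy,
    (convex_Icc (-1 : ℝ) 1).image_sub_le_mul_sub_of_deriv_le hd.continuous.continuousOn
      hd.differentiableOn (fun _ hz => kLink_nonneg_and_le hb (interior_subset hz)) x hx y hy hxy⟩

lemma abs_link_sub_le {μ : ℝ → ℝ} (hd : Differentiable ℝ μ) (hm : Monotone μ)
    (hb : BddAbove (deriv μ '' Set.Icc (-1) 1)) {x y : ℝ} (hx : x ∈ Set.Icc (-1 : ℝ) 1)
    (hy : y ∈ Set.Icc (-1 : ℝ) 1) : |μ x - μ y| ≤ kLink μ * |x - y| := by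
  rcases le_total x y with h | h
  · rw [abs_sub_comm, abs_sub_comm x y, abs_of_nonneg (by linarith [hm h]),
      abs_of_nonneg (by linarith)]
    exact (link_sub_bounds hd hm hb hx hy h).2
  · rw [abs_of_nonneg (by linarith [hm h]), abs_of_nonneg (by linarith)]
    exact (link_sub_bounds hd hm hb hy hx h).2

lemma mul_sq_le_link_sub_mul {μ : ℝ → ℝ} (hd : Differentiable ℝ μ) (hm : Monotone μ)
    (hb : BddAbove (deriv μ '' Set.Icc (-1) 1)) {x y : ℝ} (hx : x ∈ Set.Icc (-1 : ℝ) 1)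
    (hy : y ∈ Set.Icc (-1 : ℝ) 1) : cLink μ * (x - y) ^ 2 ≤ (μ x - μ y) * (x - y) := by
  rcases le_total x y with h | h
  · nlinarith [(link_sub_bounds hd hm hb hx hy h).1]
  · nlinarith [(link_sub_bounds hd hm hb hy hx h).1]

lemma inner_mem_Icc {a θ : EuclideanSpace ℝ (Fin d)} (ha : ‖a‖ ≤ 1) (hθ : ‖θ‖ ≤ 1) :
    inner ℝ a θ ∈ Set.Icc (-1 : ℝ) 1 := by
  have h := abs_real_inner_le_norm a θ
  have : ‖a‖ * ‖θ‖ ≤ 1 := mul_le_one₀ ha (norm_nonneg _) hθ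
  exact abs_le.1 (h.trans this)

lemma glmMap_append (μ : ℝ → ℝ) (lam : ℝ) (h : List (A × ℝ)) (p : A × ℝ)
    (x : EuclideanSpace ℝ (Fin d)) :
    glmMap μ lam (h ++ [p]) x = glmMap μ lam h x + μ (inner ℝ p.1.1 x) • p.1.1 := by
  simp [glmMap, add_assoc]

/-- Strong monotonicity of the map `g`. -/
lemma glmMap_strong_mono {μ : ℝ → ℝ} (hd : Differentiable ℝ μ) (hm : Monotone μ)
    (hb : BddAbove (deriv μ '' Set.Icc (-1) 1)) (hA : ∀ a ∈ A, ‖a‖ ≤ 1) (lam : ℝ)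
    (h : List (A × ℝ)) {x y : EuclideanSpace ℝ (Fin d)} (hx : ‖x‖ ≤ 1) (hy : ‖y‖ ≤ 1) :
    cLink μ * ((x - y).ofLp ⬝ᵥ (glmGram lam h *ᵥ (x - y).ofLp)) ≤
      (glmMap μ lam h x - glmMap μ lam h y).ofLp ⬝ᵥ (x - y).ofLp := by
  induction h using List.reverseRecOn with
  | nil =>
    simp [glmGram_nil, glmMap, Matrix.smul_mulVec, ← smul_sub]
    rw [← mul_assoc, mul_comm (cLink μ) lam]
    apply le_of_eq
    ring
  | append_singleton h p ih =>
    have hp := hA _ p.1.2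
    have h1 := mul_sq_le_link_sub_mul hd hm hb (inner_mem_Icc hp hx) (inner_mem_Icc hp hy)
    rw [← inner_sub_right, inner_eq_dotProduct p.1.1 (x - y)] at h1
    have e1 : glmMap μ lam (h ++ [p]) x - glmMap μ lam (h ++ [p]) y =
        (glmMap μ lam h x - glmMap μ lam h y) +
          (μ (inner ℝ p.1.1 x) - μ (inner ℝ p.1.1 y)) • p.1.1 := by
      rw [glmMap_append, glmMap_append, sub_smul]; abel
    rw [e1, glmGram_append, Matrix.add_mulVec, dotProduct_add, Matrix.vecMulVec_mulVec,
      WithLp.ofLp_add, add_dotProduct, WithLp.ofLp_smul, smul_dotProduct]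
    simp only [dotProduct_smul, MulOpposite.smul_eq_mul_unop, MulOpposite.unop_op, smul_eq_mul]
    rw [dotProduct_comm (x - y).ofLp p.1.1.ofLp]
    nlinarith

/-- Estimation error of the projected estimator in a fixed direction. -/
lemma abs_inner_sub_le_of_isGlmEstimator {μ : ℝ → ℝ} (hd : Differentiable ℝ μ) (hm : Monotone μ)
    (hb : BddAbove (deriv μ '' Set.Icc (-1) 1)) (hc : 0 < cLink μ) (hA : ∀ a ∈ A, ‖a‖ ≤ 1)
    {lam : ℝ} (hlam : 0 < lam) {h : List (A × ℝ)} {θhat θ : EuclideanSpace ℝ (Fin d)}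
    (hest : IsGlmEstimator μ lam h θhat) (hθ : ‖θ‖ ≤ 1) {E : ℝ}
    (hE : invNorm (glmGram lam h) ((h.map fun p => p.2 • (p.1 : EuclideanSpace ℝ (Fin d))).sum -
      glmMap μ lam h θ) ≤ E) (a : EuclideanSpace ℝ (Fin d)) :
    |inner ℝ a θhat - inner ℝ a θ| ≤ invNorm (glmGram lam h) a * (2 * E / cLink μ) := by
  obtain ⟨θ₀, h0, hhat, hmin⟩ := hest
  have hM := glmGram_posDef hlam h
  set M := glmGram lam h with hMdef
  set v := θhat - θ with hv
  set y := glmMap μ lam h θhat - glmMap μ lam h θ with hy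
  have h1 := glmMap_strong_mono hd hm hb hA lam h hhat hθ
  rw [← hMdef, ← hv, ← hy] at h1
  set q := v.ofLp ⬝ᵥ (M *ᵥ v.ofLp) with hq
  have hq0 : 0 ≤ q := quadForm_nonneg hM _
  have h2 := sq_dotProduct_le_quadInv_mul hM y.ofLp v.ofLp
  rw [← hq] at h2
  -- The triangle inequality through the unprojected solution `θ₀`; by minimality the residual of
  -- `θhat` is no larger than that of `θ`, whence the factor `2`.
  have hy2 : √(quadInv M y.ofLp) ≤ 2 * E := by
    have e : y = (glmMap μ lam h θ₀ - glmMap μ lam h θ) +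
        -(glmMap μ lam h θ₀ - glmMap μ lam h θhat) := by rw [hy]; abel
    have h3 := hmin θ hθ
    rw [h0] at h3 e
    rw [e, WithLp.ofLp_add, WithLp.ofLp_neg]
    refine (sqrt_quadInv_add_le hM _ _).trans ?_
    rw [sqrt_quadInv_neg]
    have h4 : invNorm M _ ≤ E := hE
    have h5 := h3.trans h4
    rw [invNorm, ← quadInv] at h4 h5
    linarith
  have hE0 : 0 ≤ 2 * E := (Real.sqrt_nonneg _).trans hy2
  have hyq : quadInv M y.ofLp ≤ (2 * E) ^ 2 := by
    have := Real.sqrt_le_left hE0 |>.1 hy2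
    exact this
  -- Strong monotonicity bounds `cLink μ * q` by the pairing of `y` with `v`, and duality bounds
  -- this pairing by the norm of `y` times `√q`. Cancelling one `√q` gives the error in the norm of
  -- the Gram matrix.
  have h6 : cLink μ * q ≤ 2 * E * √q := by
    refine h1.trans ?_
    apply le_of_sq_le_sq _ (by positivity)
    rw [mul_pow, Real.sq_sqrt hq0]
    exact h2.trans (mul_le_mul_of_nonneg_right hyq hq0)
  have h7 : √q ≤ 2 * E / cLink μ := by
    rw [le_div_iff₀ hc]
    rcases hq0.eq_or_lt with h | h
    · rw [← h]; simpa using hE0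
    · have hs : 0 < √q := Real.sqrt_pos.2 h
      have e : cLink μ * (√q * √q) ≤ 2 * E * √q := by rwa [Real.mul_self_sqrt hq0]
      nlinarith
  rw [← inner_sub_right, ← hv, inner_eq_dotProduct]
  calc |a.ofLp ⬝ᵥ v.ofLp| ≤ √(quadInv M a.ofLp) * √q := by
        rw [← Real.sqrt_mul (quadInv_nonneg hM _)]
        exact Real.abs_le_sqrt (sq_dotProduct_le_quadInv_mul hM _ _)
    _ ≤ _ := mul_le_mul_of_nonneg_left h7 (Real.sqrt_nonneg _)

/-! #### Self-normalized sums -/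

variable (J : ℕ → Prop) (lam : ℝ) (a : ℕ → A) (R : ℕ → ℝ)

/-- The Gram matrix of the rounds `1, …, n` that satisfy `J`. -/
noncomputable def subGram (n : ℕ) : Matrix (Fin d) (Fin d) ℝ := glmGram lam (subHistory J a R n)

/-- The squared width of the action of round `τ`. -/
noncomputable def subWidth (τ : ℕ) : ℝ := quadInv (subGram J lam a R (τ - 1)) (a τ).1.ofLp

open Classical in
/-- The elliptical potential of the rounds `1, …, n` that satisfy `J`. -/
noncomputable def subPotential (n : ℕ) : ℝ :=
  ∑ τ ∈ Finset.Icc 1 n,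
    if J τ then subWidth J lam a R τ / (1 + subWidth J lam a R τ) else 0

open Classical in
/-- The tilt of round `τ` in the exponential supermartingale for the noise `η`. -/
noncomputable def subTilt (η : ℕ → ℝ) (τ : ℕ) : ℝ :=
  if J τ then 4 * ((a τ).1.ofLp ⬝ᵥ
    ((subGram J lam a R (τ - 1))⁻¹ *ᵥ subSum J η (fun σ => (a σ).1.ofLp) (τ - 1))) /
      (1 + subWidth J lam a R τ) else 0

variable {J lam a R}

lemma subGram_posDef (hlam : 0 < lam) (n : ℕ) : (subGram J lam a R n).PosDef :=
  glmGram_posDef hlam _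

lemma subWidth_nonneg (hlam : 0 < lam) (τ : ℕ) : 0 ≤ subWidth J lam a R τ :=
  quadInv_nonneg (subGram_posDef hlam _) _

open Classical in
lemma subGram_succ (n : ℕ) : subGram J lam a R (n + 1) =
    if J (n + 1) then subGram J lam a R n +
      Matrix.vecMulVec (a (n + 1)).1.ofLp (a (n + 1)).1.ofLp else subGram J lam a R n := by
  rw [subGram, subHistory_succ]
  by_cases h : J (n + 1) <;> simp [h, subGram, glmGram_append]

open Classical in
lemma subSum_succ (y : ℕ → ℝ) (z : ℕ → Fin d → ℝ) (n : ℕ) : subSum J y z (n + 1) =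
    if J (n + 1) then subSum J y z n + y (n + 1) • z (n + 1) else subSum J y z n := by
  rw [subSum, Finset.sum_Icc_succ_top (Nat.le_add_left 1 n)]
  by_cases h : J (n + 1) <;> simp [h, subSum]

/-- Telescoping the rank-one formula. With `w` the squared width and `x` the pairing of the new
action with the old sum, a round adds `2 (2 η x + η ^ 2 w - x ^ 2) / (1 + w)`. The tilt is chosen so
that the cross term is exactly tilt times noise; the negative term then covers the compensator `tilt
^ 2 / 8`, and `η ^ 2 ≤ 1` leaves the potential. No covering or mixture argument is needed. -/
lemma two_mul_quadInv_subSum_le (hlam : 0 < lam) {η : ℕ → ℝ} {n : ℕ}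
    (hη : ∀ τ ∈ Finset.Icc 1 n, |η τ| ≤ 1) :
    2 * quadInv (subGram J lam a R n) (subSum J η (fun σ => (a σ).1.ofLp) n) ≤
      ∑ τ ∈ Finset.Icc 1 n, (subTilt J lam a R η τ * η τ - subTilt J lam a R η τ ^ 2 / 8) +
        2 * subPotential J lam a R n := by
  induction n with
  | zero => simp [subSum, subPotential, quadInv]
  | succ n ih =>
    have ih' := ih fun τ hτ => hη τ (by simp at hτ ⊢; omega)
    rw [Finset.sum_Icc_succ_top (Nat.le_add_left 1 n), subPotential,
      Finset.sum_Icc_succ_top (Nat.le_add_left 1 n), ← subPotential, subGram_succ, subSum_succ]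
    by_cases h : J (n + 1)
    · rw [if_pos h, if_pos h, if_pos h, quadInv_rankOne_add_smul (subGram_posDef hlam n)]
      have hw : 0 ≤ quadInv (subGram J lam a R n) (a (n + 1)).1.ofLp := subWidth_nonneg hlam (n + 1)
      have hη' : η (n + 1) ^ 2 ≤ 1 := by
        rw [← sq_abs]; have := hη (n + 1) (by simp); nlinarith [abs_nonneg (η (n + 1))]
      have e1 : subWidth J lam a R (n + 1) = quadInv (subGram J lam a R n) (a (n + 1)).1.ofLp := rfl
      have e2 : subTilt J lam a R η (n + 1) = 4 * ((a (n + 1)).1.ofLp ⬝ᵥ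
          ((subGram J lam a R n)⁻¹ *ᵥ subSum J η (fun σ => (a σ).1.ofLp) n)) /
          (1 + quadInv (subGram J lam a R n) (a (n + 1)).1.ofLp) := by
        rw [subTilt, if_pos h]; rfl
      rw [e2, e1]
      set w := quadInv (subGram J lam a R n) (a (n + 1)).1.ofLp
      set x := (a (n + 1)).1.ofLp ⬝ᵥ
        ((subGram J lam a R n)⁻¹ *ᵥ subSum J η (fun σ => (a σ).1.ofLp) n)
      have key : 2 * ((2 * η (n + 1) * x + η (n + 1) ^ 2 * w - x ^ 2) / (1 + w)) ≤
          (4 * x / (1 + w) * η (n + 1) - (4 * x / (1 + w)) ^ 2 / 8) + 2 * (w / (1 + w)) := by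
        have h1 : (4 * x / (1 + w)) ^ 2 / 8 ≤ 2 * x ^ 2 / (1 + w) := by
          rw [div_pow, div_div, div_le_div_iff₀ (by positivity) (by positivity)]
          nlinarith [mul_nonneg (mul_nonneg (sq_nonneg x) hw) (by linarith : (0:ℝ) ≤ 1 + w)]
        have h2 : η (n + 1) ^ 2 * w / (1 + w) ≤ w / (1 + w) := by
          gcongr; nlinarith
        have e : 2 * ((2 * η (n + 1) * x + η (n + 1) ^ 2 * w - x ^ 2) / (1 + w)) =
          4 * x / (1 + w) * η (n + 1) - 2 * x ^ 2 / (1 + w) +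
            2 * (η (n + 1) ^ 2 * w / (1 + w)) := by ring
        rw [e]; linarith
      linarith
    · simpa [h, subTilt] using ih'

-- For the bias there is no cancellation to exploit, but each round adds at most `b τ ^ 2`, so the
-- bound does not depend on the dimension.
open Classical in
lemma quadInv_subSum_le_sum_sq (hlam : 0 < lam) (b : ℕ → ℝ) (n : ℕ) :
    quadInv (subGram J lam a R n) (subSum J b (fun σ => (a σ).1.ofLp) n) ≤
      ∑ τ ∈ (Finset.Icc 1 n).filter J, b τ ^ 2 := by
  rw [Finset.sum_filter]
  induction n with
  | zero => simp [subSum, quadInv]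
  | succ n ih =>
    rw [Finset.sum_Icc_succ_top (Nat.le_add_left 1 n), subGram_succ, subSum_succ]
    by_cases h : J (n + 1)
    · rw [if_pos h, if_pos h, if_pos h]
      linarith [quadInv_rankOne_add_smul_le (subGram_posDef hlam n (J := J) (a := a) (R := R))
        (a (n + 1)).1.ofLp (subSum J b (fun σ => (a σ).1.ofLp) n) (b (n + 1))]
    · simpa [h] using ih

lemma subHistory_length_le {Pol : Type v} (π : ℕ → Pol) (n : ℕ) :
    (subHistory J π R n).length ≤ n := by
  rw [subHistory, List.length_map]
  exact (List.length_filter_le _ _).trans (by simp)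

/-- The logarithm of the determinant grows by `log (1 + w)` in an active round, and `log (1 + w) ≥ 1
- 1 / (1 + w) = w / (1 + w)`. -/
lemma subPotential_le_log_det (hlam : 0 < lam) (n : ℕ) :
    subPotential J lam a R n ≤ Real.log (subGram J lam a R n).det - d * Real.log lam := by
  induction n with
  | zero => simp [subPotential, subGram, det_glmGram_nil, Real.log_pow]
  | succ n ih =>
    rw [subPotential, Finset.sum_Icc_succ_top (Nat.le_add_left 1 n), ← subPotential, subGram_succ]
    by_cases h : J (n + 1)
    · have hw : 0 ≤ subWidth J lam a R (n + 1) := subWidth_nonneg hlam (n + 1)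
      have e1 : quadInv (subGram J lam a R n) (a (n + 1)).1.ofLp = subWidth J lam a R (n + 1) := rfl
      rw [if_pos h, if_pos h, det_rankOne (subGram_posDef hlam n), e1,
        Real.log_mul (subGram_posDef hlam n).det_pos.ne' (by positivity)]
      have h1 := Real.one_sub_inv_le_log_of_pos (by linarith : 0 < 1 + subWidth J lam a R (n + 1))
      have h2 : 1 - (1 + subWidth J lam a R (n + 1))⁻¹ =
          subWidth J lam a R (n + 1) / (1 + subWidth J lam a R (n + 1)) := by field_simp; ring
      linarith
    · simpa [h] using ih

lemma subPotential_le (hA : ∀ a ∈ A, ‖a‖ ≤ 1) (hlam : 0 < lam) {n T : ℕ} (hn : n ≤ T) :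
    subPotential J lam a R n ≤ d * Real.log (1 + T / lam) := by
  refine (subPotential_le_log_det hlam n).trans ((log_det_glmGram_le hA hlam _).trans ?_)
  gcongr
  exact_mod_cast (subHistory_length_le a n).trans hn

open Classical in
/-- Cauchy–Schwarz for the truncated widths. -/
lemma sum_min_width_le (hlam : 0 < lam) {B : ℝ} (hB : 1 ≤ B) (n : ℕ) :
    ∑ τ ∈ (Finset.Icc 1 n).filter J, min 1 (B * √(subWidth J lam a R τ)) ≤
      B * √(((Finset.Icc 1 n).filter J).card * (2 * subPotential J lam a R n)) := by
  have hw : ∀ τ, 0 ≤ subWidth J lam a R τ := subWidth_nonneg hlam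
  set x : ℕ → ℝ := fun τ => subWidth J lam a R τ / (1 + subWidth J lam a R τ) with hx
  have hx0 : ∀ τ, 0 ≤ x τ := fun τ => div_nonneg (hw τ) (by linarith [hw τ])
  -- Truncation makes the bounded potential sufficient: if `w ≤ 1` then `w ≤ 2 w / (1 + w)`, and if
  -- `w ≥ 1` then `2 w / (1 + w) ≥ 1`, so that `B ≥ 1` beats the constant `1`.
  have h1 : ∀ τ, min 1 (B * √(subWidth J lam a R τ)) ≤ B * √(2 * x τ) := by
    intro τ
    rcases le_total (subWidth J lam a R τ) 1 with h | h
    · refine (min_le_right _ _).trans ?_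
      gcongr
      simp only [hx]
      rw [← mul_div_assoc, le_div_iff₀ (by linarith [hw τ])]
      nlinarith [hw τ]
    · refine (min_le_left _ _).trans (hB.trans ?_)
      refine le_mul_of_one_le_right (by linarith) (Real.one_le_sqrt.2 ?_)
      simp only [hx]
      rw [← mul_div_assoc, le_div_iff₀ (by linarith [hw τ])]
      linarith
  have h2 : subPotential J lam a R n = ∑ τ ∈ (Finset.Icc 1 n).filter J, x τ := by
    rw [Finset.sum_filter]; rfl
  refine (Finset.sum_le_sum fun τ _ => h1 τ).trans ?_
  rw [← Finset.mul_sum, h2]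
  refine mul_le_mul_of_nonneg_left ?_ (by linarith)
  refine Real.le_sqrt_of_sq_le ?_
  refine (sq_sum_le_card_mul_sum_sq).trans ?_
  gcongr
  rw [Finset.mul_sum]
  exact Finset.sum_le_sum fun τ _ => (Real.sq_sqrt (by linarith [hx0 τ])).le

lemma subSum_add (y y' : ℕ → ℝ) (z : ℕ → Fin d → ℝ) (n : ℕ) :
    subSum J (fun τ => y τ + y' τ) z n = subSum J y z n + subSum J y' z n := by
  rw [subSum, subSum, subSum, ← Finset.sum_add_distrib]
  refine Finset.sum_congr rfl fun τ _ => ?_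
  split_ifs
  · rw [add_smul]
  · simp

/-- Only the errors at `θ` and the regularization survive in the residual. The errors are later
split into noise around the true means and bias of the true means. -/
lemma estimating_equation_eq (μ : ℝ → ℝ) (θ : EuclideanSpace ℝ (Fin d)) (n : ℕ) :
    (((subHistory J a R n).map fun p => p.2 • (p.1 : EuclideanSpace ℝ (Fin d))).sum -
      glmMap μ lam (subHistory J a R n) θ).ofLp =
      subSum J (fun τ => R τ - μ (inner ℝ (a τ).1 θ)) (fun σ => (a σ).1.ofLp) n +
        -((lam * cLink μ) • θ.ofLp) := by
  induction n with
  | zero => simp [glmMap, subSum]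
  | succ n ih =>
    rw [subHistory_succ, subSum_succ]
    by_cases h : J (n + 1)
    · rw [if_pos h, if_pos h, glmMap_append, List.map_append, List.sum_append]
      rw [WithLp.ofLp_sub] at ih ⊢
      rw [WithLp.ofLp_add, WithLp.ofLp_add]
      have : subSum J (fun τ => R τ - μ (inner ℝ (a τ).1 θ)) (fun σ => (a σ).1.ofLp) n =
          (((subHistory J a R n).map fun p => p.2 • (p.1 : EuclideanSpace ℝ (Fin d))).sum).ofLp -
          (glmMap μ lam (subHistory J a R n) θ).ofLp + (lam * cLink μ) • θ.ofLp := by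
        rw [ih]; abel
      rw [this]
      simp [sub_smul]
      abel
    · rw [if_neg h, if_neg h, ih]

open Classical in
/-- The error in the estimating equation: noise, bias and regularization. -/
lemma invNorm_estimating_error_le (hlam : 0 < lam) {μ : ℝ → ℝ} (hc : 0 < cLink μ)
    {θ : EuclideanSpace ℝ (Fin d)} (hθ : ‖θ‖ ≤ 1) (F : ℕ → ℝ) (n : ℕ) :
    invNorm (subGram J lam a R n)
      (((subHistory J a R n).map fun p => p.2 • (p.1 : EuclideanSpace ℝ (Fin d))).sum -
        glmMap μ lam (subHistory J a R n) θ) ≤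
      √(quadInv (subGram J lam a R n) (subSum J (fun τ => R τ - F τ) (fun σ => (a σ).1.ofLp) n)) +
      √(∑ τ ∈ (Finset.Icc 1 n).filter J, (F τ - μ (inner ℝ (a τ).1 θ)) ^ 2) +
      cLink μ * √lam := by
  have hM := subGram_posDef hlam n (J := J) (a := a) (R := R)
  rw [invNorm, ← quadInv, estimating_equation_eq]
  have e : (fun τ => R τ - μ (inner ℝ (a τ).1 θ)) =
      fun τ => (R τ - F τ) + (F τ - μ (inner ℝ (a τ).1 θ)) := by ext; ring
  rw [e, subSum_add]
  refine (sqrt_quadInv_add_le hM _ _).trans (add_le_add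
    ((sqrt_quadInv_add_le hM _ _).trans (add_le_add le_rfl ?_)) ?_)
  · exact Real.sqrt_le_sqrt (quadInv_subSum_le_sum_sq hlam _ n)
  · rw [sqrt_quadInv_neg, quadInv_smul]
    have h1 := quadInv_glmGram_le hlam (subHistory J a R n) θ.ofLp
    rw [← norm_sq_eq_dotProduct] at h1
    have h2 : ‖θ‖ ^ 2 ≤ 1 := pow_le_one₀ (norm_nonneg _) hθ
    have h3 : quadInv (subGram J lam a R n) θ.ofLp ≤ 1 / lam :=
      h1.trans (by gcongr)
    apply Real.sqrt_le_iff.2 ⟨by positivity, ?_⟩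
    rw [mul_pow, mul_pow, Real.sq_sqrt hlam.le]
    calc lam ^ 2 * cLink μ ^ 2 * quadInv (subGram J lam a R n) θ.ofLp
        ≤ lam ^ 2 * cLink μ ^ 2 * (1 / lam) := by gcongr
      _ = cLink μ ^ 2 * lam := by field_simp

end GlmPath


/-! ### Guarantees of GLM-UCB along one sample path -/

section GlmGuarantee

/-- The standing assumptions on the parameters of a generalized linear bandit. -/
structure GlmParams (κ : ℝ) (d T : ℕ) (δ : ℝ) (A : Set (EuclideanSpace ℝ (Fin d))) (μ : ℝ → ℝ)
    (lam : ℝ) : Prop where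
  kappa : 1 ≤ κ
  dim : 1 ≤ d
  horizon : 2 ≤ T
  delta_pos : 0 < δ
  delta_lt : δ < 1
  nonempty : A.Nonempty
  norm_le : ∀ a ∈ A, ‖a‖ ≤ 1
  diff : Differentiable ℝ μ
  mono : Monotone μ
  bdd : BddAbove (deriv μ '' Set.Icc (-1) 1)
  c_pos : 0 < cLink μ
  lam_ge : ((T : ℝ) / δ) ^ (-κ) ≤ lam
  lam_le : lam ≤ cLink μ * √(T / δ)
  c_le : cLink μ ≤ ((T : ℝ) / δ) ^ κ
  c_lam : cLink μ * √lam ≤ κ * √d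

/-- The failure probability of a single concentration inequality. -/
noncomputable def confLevel (T : ℕ) (δ : ℝ) : ℝ := δ / (4 * (T : ℝ) ^ 5)

namespace GlmParams

variable {κ : ℝ} {d T : ℕ} {δ : ℝ} {A : Set (EuclideanSpace ℝ (Fin d))} {μ : ℝ → ℝ} {lam : ℝ}

section
variable (hp : GlmParams κ d T δ A μ lam)
include hp

lemma two_le_T : (2 : ℝ) ≤ T := by exact_mod_cast hp.horizon

lemma T_le_ratio : (T : ℝ) ≤ T / δ := by
  rw [le_div_iff₀ hp.delta_pos]
  nlinarith [hp.two_le_T, hp.delta_lt]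

lemma two_le_ratio : (2 : ℝ) ≤ T / δ := hp.two_le_T.trans hp.T_le_ratio

lemma log_two_le : 0.69 ≤ Real.log (T / δ) := by
  have h1 := Real.log_le_log (by norm_num) hp.two_le_ratio
  have h2 := Real.log_two_gt_d9
  linarith

lemma log_pos : 0 < Real.log (T / δ) := by linarith [hp.log_two_le]

lemma lam_pos : 0 < lam :=
  (Real.rpow_pos_of_pos (by linarith [hp.two_le_ratio]) _).trans_le hp.lam_ge

lemma one_le_d : (1 : ℝ) ≤ d := by exact_mod_cast hp.dim

lemma k_pos : 0 < kLink μ := hp.c_pos.trans_le (cLink_le_kLink hp.mono hp.bdd)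

lemma one_le_k_div_c : 1 ≤ kLink μ / cLink μ := by
  rw [one_le_div hp.c_pos]; exact cLink_le_kLink hp.mono hp.bdd

lemma arg_eq : cLink μ * T / (lam * δ) = cLink μ * (T / δ) / lam := by
  have := hp.delta_pos
  have := hp.lam_pos
  field_simp

/-- This is where the upper bound on `lam` enters: the logarithm inside `β` is then at least half of
`log (T / δ)`, so `β` also pays for the failure probabilities. -/
lemma sqrt_ratio_le_arg : √(T / δ) ≤ cLink μ * T / (lam * δ) := by
  have hX : (0 : ℝ) ≤ T / δ := by linarith [hp.two_le_ratio]
  rw [hp.arg_eq, le_div_iff₀ hp.lam_pos]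
  calc √(T / δ) * lam ≤ √(T / δ) * (cLink μ * √(T / δ)) := by gcongr; exact hp.lam_le
    _ = cLink μ * (√(T / δ) * √(T / δ)) := by ring
    _ = _ := by rw [Real.mul_self_sqrt hX]

lemma half_log_le : Real.log (T / δ) / 2 ≤ Real.log (cLink μ * T / (lam * δ)) := by
  have hX : (0 : ℝ) < T / δ := by linarith [hp.two_le_ratio]
  rw [← Real.log_sqrt hX.le]
  exact Real.log_le_log (Real.sqrt_pos.2 hX) hp.sqrt_ratio_le_arg

lemma ratio_rpow_inv_le : 1 / lam ≤ (T / δ : ℝ) ^ κ := by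
  have hX : (0 : ℝ) < T / δ := by linarith [hp.two_le_ratio]
  rw [one_div, inv_le_comm₀ hp.lam_pos (Real.rpow_pos_of_pos hX _), ← Real.rpow_neg hX.le]
  exact hp.lam_ge

lemma log_arg_le : Real.log (cLink μ * T / (lam * δ)) ≤ (2 * κ + 1) * Real.log (T / δ) := by
  have hX : (0 : ℝ) < T / δ := by linarith [hp.two_le_ratio]
  rw [← Real.log_rpow hX]
  refine Real.log_le_log ((Real.sqrt_pos.2 hX).trans_le hp.sqrt_ratio_le_arg) ?_
  rw [hp.arg_eq, show 2 * κ + 1 = κ + 1 + κ by ring, Real.rpow_add hX, Real.rpow_add hX,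
    Real.rpow_one, div_eq_mul_one_div]
  have := hp.c_le
  have := hp.ratio_rpow_inv_le
  have := hp.lam_pos
  gcongr

lemma log_one_add_le : Real.log (1 + T / lam) ≤ (κ + 2) * Real.log (T / δ) := by
  have hX : (0 : ℝ) < T / δ := by linarith [hp.two_le_ratio]
  have hκ := hp.kappa
  rw [← Real.log_rpow hX]
  have hlam := hp.lam_pos
  refine Real.log_le_log (by positivity) ?_
  have h1 : (T : ℝ) / lam ≤ (T / δ) * (T / δ : ℝ) ^ κ := by
    rw [div_eq_mul_one_div]
    have := hp.ratio_rpow_inv_le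
    have := hp.T_le_ratio
    gcongr
  have h2 : (1 : ℝ) ≤ (T / δ : ℝ) ^ κ :=
    Real.one_le_rpow (by linarith [hp.two_le_ratio]) (by linarith)
  rw [Real.rpow_add hX, Real.rpow_two]
  nlinarith [hp.two_le_ratio, mul_le_mul_of_nonneg_left hp.two_le_ratio hX.le]

/-- Unless the confidence width exceeds the trivial bound, the elliptical potential is controlled by
the logarithm in `β`. -/
lemma log_one_add_le_of_lt (hc : 2 < cLink μ * √(lam + T)) :
    Real.log (1 + T / lam) ≤ 4 * Real.log (cLink μ * T / (lam * δ)) := by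
  have hX2 := hp.two_le_ratio
  have hX : (0 : ℝ) < T / δ := by linarith
  have hlam := hp.lam_pos
  have hcp := hp.c_pos
  have hT := hp.two_le_T
  have hTX := hp.T_le_ratio
  have hs := hp.sqrt_ratio_le_arg
  have hy0 : 0 < cLink μ * T / (lam * δ) := (Real.sqrt_pos.2 hX).trans_le hs
  have e : 4 * Real.log (cLink μ * T / (lam * δ)) =
      Real.log ((cLink μ * T / (lam * δ)) ^ 4) := by
    rw [Real.log_pow]; norm_num
  rw [e]
  refine Real.log_le_log (by positivity) ?_
  set y := cLink μ * T / (lam * δ) with hy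
  have h1 : T / δ ≤ y ^ 2 := by
    calc (T : ℝ) / δ = √(T / δ) ^ 2 := (Real.sq_sqrt hX.le).symm
      _ ≤ y ^ 2 := by gcongr
  have hy4 : y ^ 4 = y ^ 2 * y ^ 2 := by ring
  -- Since `y ^ 2 ≥ T / δ ≥ 2`, the target is immediate for large `lam`. For `lam ≤ 1` the
  -- hypothesis gives `cLink μ ^ 2 * (T / δ) ≥ 2`, hence `2 (T / δ) / lam ≤ y ^ 2`.
  rcases le_total (T : ℝ) lam with hTl | hTl
  · have : (T : ℝ) / lam ≤ 1 := by rwa [div_le_one hlam]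
    rw [hy4]; nlinarith
  · rcases le_total 1 lam with h | h
    · have : (T : ℝ) / lam ≤ T := div_le_self (by linarith) h
      rw [hy4]; nlinarith
    · have h2 : 4 < cLink μ ^ 2 * (lam + T) := by
        have h3 := Real.sq_sqrt (by linarith : 0 ≤ lam + T)
        have : (2:ℝ) ^ 2 < (cLink μ * √(lam + T)) ^ 2 := by gcongr
        rw [mul_pow, h3] at this
        linarith
      have h3 : 2 ≤ cLink μ ^ 2 * (T / δ) := by
        have : cLink μ ^ 2 * (lam + T) ≤ cLink μ ^ 2 * (2 * (T / δ)) := by gcongr; linarith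
        linarith
      have h4 : 2 * (T / δ) / lam ≤ y ^ 2 := by
        have e2 : y ^ 2 = cLink μ ^ 2 * (T / δ) * (T / δ) / lam ^ 2 := by
          rw [hy, hp.arg_eq]; ring
        rw [e2, div_le_div_iff₀ hlam (by positivity)]
        have : lam ^ 2 ≤ 1 * lam := by nlinarith
        have h5 : 2 * (T / δ) * lam ^ 2 ≤ 2 * (T / δ) * (1 * lam) := by gcongr
        have h6 : 2 * ((T / δ) * lam) ≤ cLink μ ^ 2 * (T / δ) * ((T / δ) * lam) := by gcongr
        linarith
      have h5 : 1 + T / lam ≤ 2 * (T / δ) / lam := by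
        rw [← sub_nonneg]
        have : 2 * (T / δ) / lam - (1 + T / lam) = (2 * (T / δ) - lam - T) / lam := by field_simp; ring
        rw [this]; apply div_nonneg _ hlam.le; linarith
      have h6 : 1 ≤ y ^ 2 := by linarith
      rw [hy4]; nlinarith

/-- `β c / k = 4 (√(d log(c T / (lam δ))) + c √lam)`. -/
lemma beta_mul : glmBeta d T δ μ lam * cLink μ / kLink μ =
    4 * (√(d * Real.log (cLink μ * T / (lam * δ))) + cLink μ * √lam) := by
  have := hp.k_pos
  have := hp.c_pos
  rw [glmBeta]; field_simp

lemma le_beta : 4 * kLink μ / cLink μ * √(d * Real.log (cLink μ * T / (lam * δ))) ≤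
    glmBeta d T δ μ lam := by
  have := hp.k_pos
  have := hp.c_pos
  rw [glmBeta]
  have : 0 ≤ cLink μ * √lam := by positivity
  gcongr
  linarith

lemma half_lt_sqrt : 1 / 2 < √(d * Real.log (cLink μ * T / (lam * δ))) := by
  refine Real.lt_sqrt_of_sq_lt ?_
  have h1 := hp.half_log_le
  have h2 := hp.log_two_le
  have h3 := hp.one_le_d
  nlinarith

lemma two_le_beta : 2 ≤ glmBeta d T δ μ lam := by
  refine le_trans ?_ hp.le_beta
  have h1 := hp.one_le_k_div_c
  have h2 := hp.half_lt_sqrt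
  rw [mul_div_assoc]
  nlinarith

lemma beta_le : glmBeta d T δ μ lam ≤
    16 * κ * (kLink μ / cLink μ) * √(d * Real.log (T / δ)) := by
  have hk := hp.k_pos
  have hc := hp.c_pos
  have hκ := hp.kappa
  have hL := hp.log_two_le
  have h1 : √(d * Real.log (cLink μ * T / (lam * δ))) ≤ 2 * κ * √(d * Real.log (T / δ)) := by
    apply Real.sqrt_le_iff.2 ⟨by positivity, ?_⟩
    rw [mul_pow, Real.sq_sqrt (by positivity)]
    have h2 := hp.log_arg_le
    have h3 : 2 * κ + 1 ≤ (2 * κ) ^ 2 := by nlinarith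
    calc (d : ℝ) * Real.log (cLink μ * T / (lam * δ)) ≤ d * ((2 * κ) ^ 2 * Real.log (T / δ)) := by
          gcongr
          exact h2.trans (by gcongr)
      _ = _ := by ring
  have h4 : cLink μ * √lam ≤ 2 * κ * √(d * Real.log (T / δ)) := by
    refine hp.c_lam.trans ?_
    rw [Real.sqrt_mul (by positivity)]
    have : 1 / 2 ≤ √(Real.log (T / δ)) := Real.le_sqrt_of_sq_le (by linarith)
    have h5 : 0 ≤ κ * √d := by positivity
    nlinarith
  rw [glmBeta]
  calc 4 * kLink μ / cLink μ * (√(d * Real.log (cLink μ * T / (lam * δ))) + cLink μ * √lam)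
      ≤ 4 * kLink μ / cLink μ * (2 * κ * √(d * Real.log (T / δ)) +
        2 * κ * √(d * Real.log (T / δ))) := by gcongr
    _ = _ := by ring

lemma confLevel_pos : 0 < confLevel T δ := by
  have := hp.delta_pos
  have := hp.two_le_T
  rw [confLevel]; positivity

/-- As `T ^ 2 ≥ 4` and `δ < 1`, one has `4 T ^ 5 / δ ≤ (T / δ) ^ 7`. -/
lemma log_inv_confLevel_le : Real.log (1 / confLevel T δ) ≤ 7 * Real.log (T / δ) := by
  have hδ := hp.delta_pos
  have hT := hp.two_le_T
  have hX : (0 : ℝ) < T / δ := by linarith [hp.two_le_ratio]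
  have e : 7 * Real.log (T / δ) = Real.log ((T / δ) ^ 7) := by rw [Real.log_pow]; norm_num
  rw [e]
  have := hp.confLevel_pos
  refine Real.log_le_log (by positivity) ?_
  rw [confLevel, one_div_div, div_pow, div_le_div_iff₀ hδ (by positivity)]
  have h1 : δ ^ 7 ≤ δ := pow_le_of_le_one hδ.le hp.delta_lt.le (by norm_num)
  have h2 : 4 * (T : ℝ) ^ 5 ≤ (T : ℝ) ^ 7 := by
    have : (4 : ℝ) ≤ T ^ 2 := by nlinarith
    calc 4 * (T : ℝ) ^ 5 ≤ T ^ 2 * (T : ℝ) ^ 5 := by gcongr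
      _ = _ := by ring
  gcongr

end

/-- There are two regimes. If `cLink μ * √(lam + T) ≤ 2`, then `β` is at least `kLink μ * √(lam +
T)`, and the trivial bound `2 kLink μ ‖a‖` is already below the width. Otherwise the logarithm in
`β` controls the elliptical potential, the residual is at most `β cLink μ / kLink μ`, and the
estimator bound gives exactly the width `2 β ‖a‖` in the inverse Gram norm. -/
lemma index_error (hp : GlmParams κ d T δ A μ lam) {h : List (A × ℝ)} (hlen : h.length ≤ T)
    {θhat θ : EuclideanSpace ℝ (Fin d)} (hest : IsGlmEstimator μ lam h θhat) (hθ : ‖θ‖ ≤ 1)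
    {N B : ℝ} (hE : invNorm (glmGram lam h)
      ((h.map fun p => p.2 • (p.1 : EuclideanSpace ℝ (Fin d))).sum - glmMap μ lam h θ) ≤
        √N + B + cLink μ * √lam)
    (hN : N ≤ d * Real.log (1 + T / lam) + Real.log (1 / confLevel T δ) / 2)
    (hB : B ≤ glmBeta d T δ μ lam * cLink μ / kLink μ / 100) (a : A) :
    |μ (inner ℝ a.1 θhat) - μ (inner ℝ a.1 θ)| ≤
      2 * glmBeta d T δ μ lam * invNorm (glmGram lam h) a.1 := by
  have hc := hp.c_pos
  have hk := hp.k_pos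
  have hd1 := hp.one_le_d
  have hlam := hp.lam_pos
  have hβ := hp.two_le_beta
  have ha := hp.norm_le _ a.2
  have hhat : ‖θhat‖ ≤ 1 := hest.choose_spec.2.1
  have h1 := abs_link_sub_le hp.diff hp.mono hp.bdd (inner_mem_Icc ha hhat) (inner_mem_Icc ha hθ)
  set ℓ := Real.log (cLink μ * T / (lam * δ)) with hℓ
  have hℓ0 : 0 < ℓ := by linarith [hp.half_log_le, hp.log_pos]
  rcases le_or_gt (cLink μ * √(lam + T)) 2 with hcase | hcase
  · refine h1.trans ?_
    have h2 : ‖a.1‖ ≤ √(lam + T) * invNorm (glmGram lam h) a.1 := by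
      rw [invNorm, ← quadInv, ← Real.sqrt_mul (by positivity)]
      refine Real.le_sqrt_of_sq_le ?_
      rw [norm_sq_eq_dotProduct]
      refine (dotProduct_le_mul_quadInv_glmGram hp.norm_le hlam h _).trans ?_
      have := quadInv_nonneg (glmGram_posDef hlam h) a.1.ofLp
      gcongr
    have h3 : |inner ℝ a.1 θhat - inner ℝ a.1 θ| ≤ 2 * ‖a.1‖ := by
      rw [← inner_sub_right]
      refine (abs_real_inner_le_norm _ _).trans ?_
      have : ‖θhat - θ‖ ≤ 2 := (norm_sub_le _ _).trans (by linarith)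
      rw [mul_comm]; gcongr
    have h4 : kLink μ * √(lam + T) ≤ glmBeta d T δ μ lam := by
      refine le_trans ?_ hp.le_beta
      have h5 : √(lam + T) ≤ 2 / cLink μ := by rw [le_div_iff₀ hc]; linarith
      calc kLink μ * √(lam + T) ≤ kLink μ * (2 / cLink μ) := by gcongr
        _ = 4 * kLink μ / cLink μ * (1 / 2) := by ring
        _ ≤ _ := by gcongr; exact hp.half_lt_sqrt.le
    have h6 : 0 ≤ invNorm (glmGram lam h) a.1 := Real.sqrt_nonneg _
    calc kLink μ * |inner ℝ a.1 θhat - inner ℝ a.1 θ|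
        ≤ kLink μ * (2 * (√(lam + T) * invNorm (glmGram lam h) a.1)) := by
          gcongr; exact h3.trans (by gcongr)
      _ = 2 * (kLink μ * √(lam + T)) * invNorm (glmGram lam h) a.1 := by ring
      _ ≤ _ := by gcongr
  · have h2 := hp.log_one_add_le_of_lt hcase
    rw [← hℓ] at h2
    -- The potential contributes `4 d ℓ` and the failure probability at most `7 ℓ`, together at most
    -- `11 d ℓ`, which is below `(7 / 2) ^ 2 d ℓ`. The room between `7 / 2` and the factor `4` in
    -- `β` is left for the bias.
    have hNle : N ≤ (7 / 2 * √(d * ℓ)) ^ 2 := by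
      rw [mul_pow, Real.sq_sqrt (by positivity)]
      have h3 := hp.log_inv_confLevel_le
      have h4 := hp.half_log_le
      rw [← hℓ] at h4
      have h5 : (d : ℝ) * Real.log (1 + T / lam) ≤ d * (4 * ℓ) := by gcongr
      nlinarith
    have hsN : √N ≤ 7 / 2 * √(d * ℓ) := Real.sqrt_le_iff.2 ⟨by positivity, hNle⟩
    have hbm := hp.beta_mul
    rw [← hℓ] at hbm
    have hcl : 0 ≤ cLink μ * √lam := by positivity
    have hsd : 0 ≤ √(d * ℓ) := Real.sqrt_nonneg _
    have hEβ : √N + B + cLink μ * √lam ≤ glmBeta d T δ μ lam * cLink μ / kLink μ := by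
      rw [hbm] at hB ⊢; linarith
    have h3 := abs_inner_sub_le_of_isGlmEstimator hp.diff hp.mono hp.bdd hc hp.norm_le hlam hest hθ
      (hE.trans hEβ) a.1
    refine h1.trans ((mul_le_mul_of_nonneg_left h3 hk.le).trans (le_of_eq ?_))
    field_simp

end GlmParams

variable {κ : ℝ} {d T : ℕ} {δ : ℝ} {A : Set (EuclideanSpace ℝ (Fin d))} {μ : ℝ → ℝ} {lam : ℝ}

lemma norm_sub_le_sum (θ : ℕ → EuclideanSpace ℝ (Fin d)) {s t σ τ : ℕ} (hs : s ≤ σ) (hστ : σ ≤ τ)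
    (ht : τ ≤ t) : ‖θ σ - θ τ‖ ≤ ∑ i ∈ Finset.Ico s t, ‖θ i - θ (i + 1)‖ := by
  have h1 := dist_le_Ico_sum_dist θ hστ
  simp only [dist_eq_norm] at h1
  exact h1.trans (Finset.sum_le_sum_of_subset_of_nonneg
    (Finset.Ico_subset_Ico hs ht) fun _ _ _ => norm_nonneg _)

lemma drift_glmDelta (κ₂ : ℝ) (θ : ℕ → EuclideanSpace ℝ (Fin d)) (s t : ℕ) :
    drift (glmDelta κ₂ T δ μ θ) s t = κ₂ * (kLink μ ^ 2 * d / cLink μ * √(Real.log (T / δ)) *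
      ∑ i ∈ Finset.Ico s t, ‖θ i - θ (i + 1)‖) := by
  simp only [drift, glmDelta, Finset.mul_sum]

/-- The coefficient `c₁` with `ρ(t) = c₁ / √t`. -/
noncomputable def rhoCoef (κ₁ : ℝ) (d T : ℕ) (δ : ℝ) (μ : ℝ → ℝ) (lam : ℝ) : ℝ :=
  κ₁ * glmBeta d T δ μ lam * √(d * Real.log (T / δ))

lemma glmRho_eq (κ₁ : ℝ) (t : ℕ) :
    glmRho κ₁ d T δ μ lam t = rhoCoef κ₁ d T δ μ lam / √t := by
  rw [glmRho, rhoCoef, Real.sqrt_div' _ (by positivity)]; ring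

/-- The bias of the estimator is negligible while the drift is at most `ρ`. -/
lemma GlmParams.bias_le (hp : GlmParams κ d T δ A μ lam) {κ₁ : ℝ} (hκ₁ : 0 < κ₁) {V : ℝ}
    {w : ℕ} (hw : 1 ≤ w)
    (hV : 100 * κ₁ * (kLink μ ^ 2 * d / cLink μ * √(Real.log (T / δ)) * V) ≤
      glmRho κ₁ d T δ μ lam w) :
    kLink μ * V * √w ≤ glmBeta d T δ μ lam * cLink μ / kLink μ / 100 := by
  have hk := hp.k_pos
  have hc := hp.c_pos
  have hd := hp.one_le_d
  have hL := hp.log_pos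
  have hβ := hp.two_le_beta
  have hw0 : (0 : ℝ) < √w := Real.sqrt_pos.2 (by exact_mod_cast hw)
  have hsL : 0 < √(Real.log (T / δ)) := Real.sqrt_pos.2 hL
  have hsd : 1 ≤ √(d : ℝ) := Real.one_le_sqrt.2 hd
  rw [glmRho_eq, rhoCoef, Real.sqrt_mul (by positivity), le_div_iff₀ hw0] at hV
  set s := √(Real.log (T / δ)) with hs
  -- Both sides of the drift hypothesis are written with a common positive factor. A factor `√d ≥ 1`
  -- remains on the side of the bias and is discarded.
  have e : 100 * κ₁ * (kLink μ ^ 2 * d / cLink μ * s * V) * √w =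
      (100 * κ₁ * s * (kLink μ / cLink μ) * √d) * (√d * (kLink μ * V * √w)) := by
    conv_lhs => rw [← Real.mul_self_sqrt (by positivity : (0:ℝ) ≤ (d : ℝ))]
    field_simp
  have e2 : κ₁ * glmBeta d T δ μ lam * (√d * s) = (100 * κ₁ * s * (kLink μ / cLink μ) * √d) *
      (glmBeta d T δ μ lam * cLink μ / kLink μ / 100) := by field_simp
  rw [e, e2] at hV
  have h1 := le_of_mul_le_mul_left hV (by positivity)
  rcases le_total 0 (kLink μ * V * √w) with h | h
  · nlinarith
  · exact h.trans (by positivity)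

open Classical in
/-- Optimism and regret of an instance of GLM-UCB that is active in the rounds satisfying `J`, while
the drift since round `s` is at most `ρ`. -/
theorem GlmParams.instance_guarantee (hp : GlmParams κ d T δ A μ lam)
    {θ : ℕ → EuclideanSpace ℝ (Fin d)} (hθ : ∀ t ∈ Finset.Icc 1 T, ‖θ t‖ ≤ 1)
    (hf : ∀ t ∈ Finset.Icc 1 T, ∀ a, glmReward A μ θ t a ∈ Set.Icc (0 : ℝ) 1)
    {J : ℕ → Prop} {a : ℕ → A} {x R : ℕ → ℝ} {s t : ℕ} (hst : s ≤ t) (ht : t ≤ T)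
    (hJ : ∀ τ, 1 ≤ τ → J τ → s ≤ τ)
    (halg : ∀ τ ∈ Finset.Icc 1 t, J τ →
      glmUCB A T δ μ lam (subHistory J a R (τ - 1)) (a τ) (x τ))
    (hnoise : ∀ n < T, quadInv (subGram J lam a R n)
      (subSum J (fun τ => R τ - glmReward A μ θ τ (a τ)) (fun σ => (a σ).1.ofLp) n) ≤
        subPotential J lam a R n + Real.log (1 / confLevel T δ) / 2)
    (hdrift : drift (glmDelta (100 * (32 * (κ + 2))) T δ μ θ) s t ≤
      glmRho (32 * (κ + 2)) d T δ μ lam (t - s + 1)) :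
    (∀ τ ∈ (Finset.Icc 1 t).filter J, optReward (glmReward A μ θ) τ ≤ x τ) ∧
    ∑ τ ∈ (Finset.Icc 1 t).filter J, (x τ - glmReward A μ θ τ (a τ)) ≤
      rhoCoef (32 * (κ + 2)) d T δ μ lam / 4 * √((Finset.Icc 1 t).filter J).card := by
  have hκ := hp.kappa
  have hlam := hp.lam_pos
  have hk := hp.k_pos
  have hβ := hp.two_le_beta
  have hL := hp.log_pos
  rw [drift_glmDelta] at hdrift
  have hbias := hp.bias_le (by linarith : 0 < 32 * (κ + 2)) (by omega : 1 ≤ t - s + 1) hdrift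
  set V := ∑ i ∈ Finset.Ico s t, ‖θ i - θ (i + 1)‖ with hV
  have hV0 : 0 ≤ V := Finset.sum_nonneg fun _ _ => norm_nonneg _
  -- the index of every action is accurate
  have key : ∀ τ ∈ (Finset.Icc 1 t).filter J, optReward (glmReward A μ θ) τ ≤ x τ ∧
      x τ - glmReward A μ θ τ (a τ) ≤
        min 1 (4 * glmBeta d T δ μ lam * √(subWidth J lam a R τ)) := by
    intro τ hτ
    obtain ⟨hτ1, hτJ⟩ := Finset.mem_filter.1 hτ
    obtain ⟨hτ1, hτt⟩ := Finset.mem_Icc.1 hτ1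
    have hτT : τ ∈ Finset.Icc 1 T := Finset.mem_Icc.2 ⟨hτ1, hτt.trans ht⟩
    obtain ⟨θhat, hest, hmax, hx⟩ := halg τ (Finset.mem_Icc.2 ⟨hτ1, hτt⟩) hτJ
    -- The reference parameter is that of the current round `τ`. Each active past round lies in the
    -- window, so its bias is at most `kLink μ * V`, and there are at most `t - s + 1` of them.
    have hsum : √(∑ σ ∈ (Finset.Icc 1 (τ - 1)).filter J,
        (glmReward A μ θ σ (a σ) - μ (inner ℝ (a σ).1 (θ τ))) ^ 2) ≤
          kLink μ * V * √((t - s + 1 : ℕ) : ℝ) := by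
      apply Real.sqrt_le_iff.2 ⟨by positivity, ?_⟩
      rw [mul_pow, Real.sq_sqrt (by positivity), mul_comm, ← nsmul_eq_mul]
      have hsub : (Finset.Icc 1 (τ - 1)).filter J ⊆ Finset.Icc s t := by
        intro σ hσ
        simp only [Finset.mem_filter, Finset.mem_Icc] at hσ ⊢
        exact ⟨hJ σ hσ.1.1 hσ.2, by omega⟩
      have hcard : ((Finset.Icc 1 (τ - 1)).filter J).card ≤ t - s + 1 := by
        refine (Finset.card_le_card hsub).trans ?_
        simp; omega
      refine (Finset.sum_le_card_nsmul _ _ ((kLink μ * V) ^ 2) fun σ hσ => ?_).trans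
        (nsmul_le_nsmul_left (by positivity) hcard)
      simp only [Finset.mem_filter, Finset.mem_Icc] at hσ
      have hσT : σ ∈ Finset.Icc 1 T := Finset.mem_Icc.2 ⟨hσ.1.1, by omega⟩
      have h1 := abs_link_sub_le hp.diff hp.mono hp.bdd
        (inner_mem_Icc (hp.norm_le _ (a σ).2) (hθ σ hσT))
        (inner_mem_Icc (hp.norm_le _ (a σ).2) (hθ τ hτT))
      rw [← inner_sub_right] at h1
      have h2 := abs_real_inner_le_norm (a σ).1 (θ σ - θ τ)
      have h3 := norm_sub_le_sum θ (hJ σ hσ.1.1 hσ.2) (by omega : σ ≤ τ) hτt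
      have h4 := hp.norm_le _ (a σ).2
      have h5 : |glmReward A μ θ σ (a σ) - μ (inner ℝ (a σ).1 (θ τ))| ≤ kLink μ * V := by
        refine h1.trans (mul_le_mul_of_nonneg_left (h2.trans ?_) hk.le)
        calc ‖(a σ).1‖ * ‖θ σ - θ τ‖ ≤ 1 * V := by gcongr
          _ = V := one_mul V
      rw [← sq_abs]
      gcongr
    have hE := invNorm_estimating_error_le (J := J) (lam := lam) (a := a) (R := R) hlam hp.c_pos
      (hθ τ hτT) (fun σ => glmReward A μ θ σ (a σ)) (τ - 1)
    have hE' := hE.trans (add_le_add (add_le_add le_rfl (hsum.trans hbias)) le_rfl)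
    have herr := fun b => hp.index_error
      (h := subHistory J a R (τ - 1)) ((subHistory_length_le a _).trans (by omega)) hest
      (hθ τ hτT) hE' ((hnoise (τ - 1) (by omega)).trans (add_le_add
        (subPotential_le hp.norm_le hlam (by omega)) le_rfl)) le_rfl b
    have hidx : ∀ b : A, glmReward A μ θ τ b ≤
        glmIndex T δ μ lam (subHistory J a R (τ - 1)) θhat b := fun b => by
      have := (abs_le.1 (herr b)).1
      rw [glmIndex, glmReward]; linarith
    constructor
    · have : Nonempty A := hp.nonempty.to_subtype
      refine ciSup_le fun b => ?_
      rw [hx]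
      exact le_max_of_le_right (le_min (hf τ hτT b).2 ((hidx b).trans (hmax b)))
    · have h1 := (abs_le.1 (herr (a τ))).2
      have h2 := hf τ hτT (a τ)
      have h3 : invNorm (glmGram lam (subHistory J a R (τ - 1))) (a τ).1 =
        √(subWidth J lam a R τ) := rfl
      rw [h3] at h1
      have hi : glmIndex T δ μ lam (subHistory J a R (τ - 1)) θhat (a τ) ≤
          glmReward A μ θ τ (a τ) + 4 * glmBeta d T δ μ lam * √(subWidth J lam a R τ) := by
        rw [glmIndex, h3, glmReward]; linarith
      have hw : 0 ≤ 4 * glmBeta d T δ μ lam * √(subWidth J lam a R τ) := by positivity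
      rw [hx]
      refine le_min ?_ ?_
      · have : max 0 (min 1 (glmIndex T δ μ lam (subHistory J a R (τ - 1)) θhat (a τ))) ≤ 1 :=
          max_le zero_le_one (min_le_left _ _)
        linarith [h2.1]
      · rw [sub_le_iff_le_add]
        refine max_le (by linarith [h2.1]) ((min_le_right _ _).trans (by linarith))
  refine ⟨fun τ hτ => (key τ hτ).1, (Finset.sum_le_sum fun τ hτ => (key τ hτ).2).trans ?_⟩
  refine (sum_min_width_le hlam (by linarith) t).trans ?_
  set k := ((Finset.Icc 1 t).filter J).card with hkdef
  have hpot := (subPotential_le (J := J) (a := a) (R := R) hp.norm_le hlam ht).trans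
    (mul_le_mul_of_nonneg_left hp.log_one_add_le (by positivity))
  -- The constant `2 (κ + 2)` bounds the square root of twice the potential constant `κ + 2`.
  -- Multiplied by `4 β` it gives `8 (κ + 2)`, a quarter of the constant in `ρ`; the other three
  -- quarters remain for later losses.
  have h1 : √(k * (2 * subPotential J lam a R t)) ≤
      2 * (κ + 2) * (√(d * Real.log (T / δ)) * √k) := by
    apply Real.sqrt_le_iff.2 ⟨by positivity, ?_⟩
    rw [mul_pow, mul_pow (√(d * Real.log (T / δ))), Real.sq_sqrt (by positivity),
      Real.sq_sqrt (by positivity)]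
    calc (k : ℝ) * (2 * subPotential J lam a R t)
        ≤ k * (2 * (d * ((κ + 2) * Real.log (T / δ)))) := by gcongr
      _ = 2 * (κ + 2) * (d * Real.log (T / δ) * k) := by ring
      _ ≤ (2 * (κ + 2)) ^ 2 * (d * Real.log (T / δ) * k) := by
        gcongr
        nlinarith
  calc 4 * glmBeta d T δ μ lam * √(k * (2 * subPotential J lam a R t))
      ≤ 4 * glmBeta d T δ μ lam * (2 * (κ + 2) * (√(d * Real.log (T / δ)) * √k)) := by gcongr
    _ = _ := by rw [rhoCoef]; ring

end GlmGuarantee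


/-! ### Concentration for GLM-UCB -/

section GlmConcentration

/-- Cramer's rule: the inverse is the reciprocal determinant times the adjugate, both polynomial in
the entries. With the convention for singular matrices the formula holds everywhere. -/
lemma measurable_matrix_inv_apply {Ω : Type u} {m : MeasurableSpace Ω} {d : ℕ}
    {M : Ω → Matrix (Fin d) (Fin d) ℝ} (hM : ∀ i j, Measurable fun ω => M ω i j) (i j : Fin d) :
    Measurable fun ω => (M ω)⁻¹ i j := by
  have hM' : Measurable (fun ω => (fun i j => M ω i j : Fin d → Fin d → ℝ)) :=
    measurable_pi_iff.2 fun i => measurable_pi_iff.2 fun j => hM i j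
  have h1 : Measurable fun ω => (M ω).det := by
    have hc : Continuous fun N : Fin d → Fin d → ℝ => (Matrix.of N).det :=
      Continuous.matrix_det (continuous_id)
    exact hc.measurable.comp hM'
  have h2 : Measurable fun ω => (M ω).adjugate i j := by
    have hc : Continuous fun N : Fin d → Fin d → ℝ => (Matrix.of N).adjugate i j :=
      (Continuous.matrix_adjugate (continuous_id)).matrix_elem i j
    exact hc.measurable.comp hM'
  simp only [Matrix.inv_def, Matrix.smul_apply, Ring.inverse_eq_inv', smul_eq_mul]
  exact h1.inv.mul h2

lemma measurable_dotProduct_inv {Ω : Type u} {m : MeasurableSpace Ω} {d : ℕ}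
    {M : Ω → Matrix (Fin d) (Fin d) ℝ} (hM : ∀ i j, Measurable fun ω => M ω i j)
    {x y : Ω → Fin d → ℝ} (hx : ∀ i, Measurable fun ω => x ω i)
    (hy : ∀ i, Measurable fun ω => y ω i) :
    Measurable fun ω => x ω ⬝ᵥ ((M ω)⁻¹ *ᵥ y ω) := by
  simp only [dotProduct, Matrix.mulVec]
  exact Finset.measurable_sum _ fun i _ => (hx i).mul (Finset.measurable_sum _ fun j _ =>
    (measurable_matrix_inv_apply hM i j).mul (hy j))

variable {d : ℕ} {A : Set (EuclideanSpace ℝ (Fin d))}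

lemma measurable_action_apply {Ω : Type u} {m : MeasurableSpace Ω} {a : Ω → A}
    (ha : Measurable a) (i : Fin d) : Measurable fun ω => (a ω).1.ofLp i := by
  have hc : Continuous fun x : EuclideanSpace ℝ (Fin d) => x.ofLp i := by fun_prop
  exact hc.measurable.comp (measurable_subtype_coe.comp ha)

lemma measurable_glmReward {μ : ℝ → ℝ} (hμ : Differentiable ℝ μ)
    (θ : ℕ → EuclideanSpace ℝ (Fin d)) (t : ℕ) : Measurable (glmReward A μ θ t) := by
  have hc : Continuous fun x : EuclideanSpace ℝ (Fin d) => μ (inner ℝ x (θ t)) :=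
    hμ.continuous.comp (by fun_prop)
  exact hc.measurable.comp measurable_subtype_coe

lemma measurable_subGram {Ω : Type u} {m : MeasurableSpace Ω} {J : ℕ → Ω → Prop} (lam : ℝ)
    {a : ℕ → Ω → A} (R : ℕ → Ω → ℝ) {n : ℕ}
    (hJ : ∀ σ ∈ Finset.Icc 1 n, MeasurableSet {ω | J σ ω})
    (ha : ∀ σ ∈ Finset.Icc 1 n, Measurable (a σ)) (i j : Fin d) :
    Measurable fun ω => subGram (fun σ => J σ ω) lam (fun σ => a σ ω) (fun σ => R σ ω) n i j := by
  induction n with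
  | zero => simp only [subGram, subHistory_zero, glmGram_nil]; exact measurable_const
  | succ n ih =>
    have ih' := ih (fun σ hσ => hJ σ (by simp at hσ ⊢; omega))
      (fun σ hσ => ha σ (by simp at hσ ⊢; omega))
    have hn : n + 1 ∈ Finset.Icc 1 (n + 1) := by simp
    classical
    have : (fun ω => subGram (fun σ => J σ ω) lam (fun σ => a σ ω) (fun σ => R σ ω) (n + 1) i j) =
        fun ω => if J (n + 1) ω then subGram (fun σ => J σ ω) lam (fun σ => a σ ω)
          (fun σ => R σ ω) n i j + (a (n + 1) ω).1.ofLp i * (a (n + 1) ω).1.ofLp j else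
          subGram (fun σ => J σ ω) lam (fun σ => a σ ω) (fun σ => R σ ω) n i j := by
      ext ω
      rw [subGram_succ]
      by_cases h : J (n + 1) ω <;> simp [h, Matrix.vecMulVec_apply]
    rw [this]
    exact Measurable.ite (hJ _ hn) (ih'.add ((measurable_action_apply (ha _ hn) i).mul
      (measurable_action_apply (ha _ hn) j))) ih'

lemma measurable_subSum {Ω : Type u} {m : MeasurableSpace Ω} {J : ℕ → Ω → Prop}
    {a : ℕ → Ω → A} {η : ℕ → Ω → ℝ} {n : ℕ}
    (hJ : ∀ σ ∈ Finset.Icc 1 n, MeasurableSet {ω | J σ ω})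
    (ha : ∀ σ ∈ Finset.Icc 1 n, Measurable (a σ)) (hη : ∀ σ ∈ Finset.Icc 1 n, Measurable (η σ))
    (i : Fin d) :
    Measurable fun ω => subSum (fun σ => J σ ω) (fun σ => η σ ω) (fun σ => (a σ ω).1.ofLp) n i := by
  classical
  simp only [subSum, Finset.sum_apply]
  refine Finset.measurable_sum _ fun σ hσ => ?_
  have h2 : Measurable fun ω => if J σ ω then η σ ω * (a σ ω).1.ofLp i else 0 :=
    Measurable.ite (hJ σ hσ) ((hη σ hσ).mul (measurable_action_apply (ha σ hσ) i))
      measurable_const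
  convert h2 using 2 with ω
  split_ifs <;> simp

variable {Ω : Type u} {mΩ : MeasurableSpace Ω} {P : Measure Ω} [IsProbabilityMeasure P]
  {T : ℕ} {ℱ : Filtration ℕ mΩ} {𝒢 : ℕ → MeasurableSpace Ω}

/-- Predictable tilts of the reward noise give an exponential supermartingale. -/
lemma Interaction.expSuper {Pol : Type v} [MeasurableSpace Pol] {f : ℕ → Pol → ℝ}
    {π : ℕ → Ω → Pol} {x R : ℕ → Ω → ℝ} (hI : Interaction P f T ℱ 𝒢 π x R)
    (hfm : ∀ t ∈ Finset.Icc 1 T, Measurable (f t))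
    (hf : ∀ t ∈ Finset.Icc 1 T, ∀ a, f t a ∈ Set.Icc (0 : ℝ) 1) {s : ℕ → Ω → ℝ}
    (hs : ∀ t ∈ Finset.Icc 1 T, Measurable[𝒢 t] (s t)) :
    ExpSuper P T ℱ fun t ω => s t ω * (R t ω - f t (π t ω)) - s t ω ^ 2 / 8 where
  meas := fun t ht => by
    have h1 := (hs t ht).mono (hI.le_after t ht) le_rfl
    have h2 : Measurable[ℱ t] fun ω => f t (π t ω) :=
      ((hfm t ht).comp (hI.policy_meas t ht)).mono (hI.le_after t ht) le_rfl
    exact (h1.mul ((hI.reward_meas t ht).sub h2)).sub ((h1.pow_const 2).div_const 8)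
  bdd := ⟨2, fun t ht ω => mul_sub_sq_le_two (by
    have h1 := hI.reward_mem t ht ω
    have h2 := hf t ht (π t ω)
    rw [abs_le]; constructor <;> linarith [h1.1, h1.2, h2.1, h2.2])⟩
  step := fun t ht W hW hW0 ⟨c, hc⟩ => by
    have hG : 𝒢 t ≤ mΩ := (hI.le_after t ht).trans (ℱ.le t)
    exact integral_mul_exp_reward_le hG ((hI.reward_meas t ht).mono (ℱ.le t) le_rfl)
      (hI.reward_mem t ht) (hI.reward_mean t ht) ((hfm t ht).comp (hI.policy_meas t ht))
      (fun ω => hf t ht _) (hs t ht) (hW.mono (hI.past_le t ht) le_rfl) hW0 hc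

open Classical in
/-- Deviation of the rewards from their means over a window. -/
lemma Interaction.deviation_tail {Pol : Type v} [MeasurableSpace Pol] {f : ℕ → Pol → ℝ}
    {π : ℕ → Ω → Pol} {x R : ℕ → Ω → ℝ} (hI : Interaction P f T ℱ 𝒢 π x R)
    (hfm : ∀ t ∈ Finset.Icc 1 T, Measurable (f t))
    (hf : ∀ t ∈ Finset.Icc 1 T, ∀ a, f t a ∈ Set.Icc (0 : ℝ) 1) {L ζ : ℝ} (hL : 0 < L)
    (hζ : 0 < ζ) (hζL : Real.log (1 / ζ) ≤ 7 * L) {s t : ℕ} (hs : 1 ≤ s) (hst : s ≤ t)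
    (ht : t ≤ T) {ε : ℝ} (hε : ε = 1 ∨ ε = -1) :
    P {ω | 8 * √L * √((t - s + 1 : ℕ) : ℝ) <
      ε * ∑ τ ∈ Finset.Icc s t, (R τ ω - f τ (π τ ω))} ≤ ENNReal.ofReal ζ := by
  have hε2 : ε ^ 2 = 1 := by rcases hε with h | h <;> rw [h] <;> norm_num
  set w : ℕ := t - s + 1 with hw
  have hw0 : (0 : ℝ) < w := by exact_mod_cast Nat.succ_pos _
  -- A constant tilt on the window and none before it. A deviation of `8 √L √w` contributes `8 L`,
  -- the compensator costs only `L / 8`, and the difference still exceeds `7 L`.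
  set σ : ℝ := √L / √w with hσ
  have hσ0 : 0 < σ := by positivity
  have h := (hI.expSuper hfm hf (s := fun τ _ => if s ≤ τ then σ * ε else 0)
    (fun t _ => measurable_const)).tail ht hζ
  refine (measure_mono fun ω hω => ?_).trans h
  simp only [Set.mem_ofPred_eq] at hω ⊢
  have e : ∑ τ ∈ Finset.Icc 1 t, ((if s ≤ τ then σ * ε else 0) * (R τ ω - f τ (π τ ω)) -
      (if s ≤ τ then σ * ε else 0) ^ 2 / 8) =
      σ * (ε * ∑ τ ∈ Finset.Icc s t, (R τ ω - f τ (π τ ω))) - w * (σ ^ 2 / 8) := by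
    have h1 : (Finset.Icc 1 t).filter (fun τ => s ≤ τ) = Finset.Icc s t := by
      ext τ; simp; omega
    have h2 : ∀ τ, ((if s ≤ τ then σ * ε else 0) * (R τ ω - f τ (π τ ω)) -
      (if s ≤ τ then σ * ε else 0) ^ 2 / 8) =
        if s ≤ τ then (σ * ε * (R τ ω - f τ (π τ ω)) - σ ^ 2 / 8) else 0 := by
      intro τ; split_ifs
      · rw [mul_pow, hε2, mul_one]
      · simp
    simp only [h2]
    rw [← Finset.sum_filter, h1, Finset.sum_sub_distrib, ← Finset.mul_sum, Finset.sum_const,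
      Nat.card_Icc, nsmul_eq_mul, show t + 1 - s = w by omega]
    ring
  rw [e]
  refine hζL.trans_lt ?_
  have h3 := mul_lt_mul_of_pos_left hω hσ0
  have e1 : σ * (8 * √L * √(w : ℝ)) = 8 * L := by
    rw [hσ]; field_simp; rw [Real.sq_sqrt hL.le]
  have e2 : (w : ℝ) * (σ ^ 2 / 8) = L / 8 := by
    rw [hσ, div_pow, Real.sq_sqrt hL.le, Real.sq_sqrt hw0.le]; field_simp
  rw [e1] at h3
  linarith

variable {μ : ℝ → ℝ} {θ : ℕ → EuclideanSpace ℝ (Fin d)} {a : ℕ → Ω → A} {x R : ℕ → Ω → ℝ}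

/-- Self-normalized concentration for the rounds selected by a predictable rule. -/
lemma noise_tail (hI : Interaction P (glmReward A μ θ) T ℱ 𝒢 a x R) (hμ : Differentiable ℝ μ)
    (hf : ∀ t ∈ Finset.Icc 1 T, ∀ a, glmReward A μ θ t a ∈ Set.Icc (0 : ℝ) 1)
    {J : ℕ → Ω → Prop} (hJ : ∀ t ∈ Finset.Icc 1 T, MeasurableSet[𝒢 t] {ω | J t ω})
    {lam : ℝ} (hlam : 0 < lam) {n : ℕ} (hn : n ≤ T) {ζ : ℝ} (hζ : 0 < ζ) :
    P {ω | ¬ quadInv (subGram (fun σ => J σ ω) lam (fun σ => a σ ω) (fun σ => R σ ω) n)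
      (subSum (fun σ => J σ ω) (fun σ => R σ ω - glmReward A μ θ σ (a σ ω))
        (fun σ => (a σ ω).1.ofLp) n) ≤
        subPotential (fun σ => J σ ω) lam (fun σ => a σ ω) (fun σ => R σ ω) n +
          Real.log (1 / ζ) / 2} ≤ ENNReal.ofReal ζ := by
  have hle : ∀ σ t, σ ∈ Finset.Icc 1 (t - 1) → t ∈ Finset.Icc 1 T → σ ∈ Finset.Icc 1 T ∧
      𝒢 σ ≤ 𝒢 t ∧ ℱ σ ≤ 𝒢 t := by
    intro σ t hσ ht
    simp only [Finset.mem_Icc] at hσ ht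
    have hσT : σ ∈ Finset.Icc 1 T := by simp; omega
    have h1 : ℱ σ ≤ 𝒢 t :=
      (ℱ.mono (by omega : σ ≤ t - 1)).trans (hI.past_le t (Finset.mem_Icc.2 ht))
    exact ⟨hσT, (hI.le_after σ hσT).trans h1, h1⟩
  -- The tilt is predictable: it involves the earlier noise, the Gram matrix before the round, and
  -- the current action and selection, all known before the current reward.
  have hs : ∀ t ∈ Finset.Icc 1 T, Measurable[𝒢 t] fun ω =>
      subTilt (fun σ => J σ ω) lam (fun σ => a σ ω) (fun σ => R σ ω)
        (fun σ => R σ ω - glmReward A μ θ σ (a σ ω)) t := by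
    intro t ht
    have ha' : ∀ σ ∈ Finset.Icc 1 (t - 1), Measurable[𝒢 t] (a σ) := fun σ hσ =>
      (hI.policy_meas σ (hle σ t hσ ht).1).mono (hle σ t hσ ht).2.1 le_rfl
    have hJ' : ∀ σ ∈ Finset.Icc 1 (t - 1), MeasurableSet[𝒢 t] {ω | J σ ω} := fun σ hσ =>
      (hle σ t hσ ht).2.1 _ (hJ σ (hle σ t hσ ht).1)
    have hη : ∀ σ ∈ Finset.Icc 1 (t - 1), Measurable[𝒢 t] fun ω =>
        R σ ω - glmReward A μ θ σ (a σ ω) := fun σ hσ =>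
      ((hI.reward_meas σ (hle σ t hσ ht).1).mono (hle σ t hσ ht).2.2 le_rfl).sub
        ((measurable_glmReward hμ θ σ).comp (ha' σ hσ))
    have hG := measurable_subGram (m := 𝒢 t) (J := J) lam R hJ' ha'
    have hS := measurable_subSum (m := 𝒢 t) hJ' ha' hη
    have hat := measurable_action_apply (m := 𝒢 t) (hI.policy_meas t ht)
    classical
    simp only [subTilt, subWidth, quadInv]
    refine Measurable.ite (hJ t ht) ?_ measurable_const
    exact (measurable_const.mul (measurable_dotProduct_inv hG hat hS)).div
      (measurable_const.add (measurable_dotProduct_inv hG hat hat))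
  have h := (hI.expSuper (fun t _ => measurable_glmReward hμ θ t) hf hs).tail hn hζ
  refine (measure_mono fun ω hω => ?_).trans h
  simp only [Set.mem_ofPred_eq, not_le] at hω ⊢
  have hη : ∀ τ ∈ Finset.Icc 1 n, |R τ ω - glmReward A μ θ τ (a τ ω)| ≤ 1 := by
    intro τ hτ
    have hτT : τ ∈ Finset.Icc 1 T := by simp at hτ ⊢; omega
    have h1 := hI.reward_mem τ hτT ω
    have h2 := hf τ hτT (a τ ω)
    rw [abs_le]; constructor <;> linarith [h1.1, h1.2, h2.1, h2.2]
  have h3 := two_mul_quadInv_subSum_le (J := fun σ => J σ ω) (a := fun σ => a σ ω)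
    (R := fun σ => R σ ω) hlam hη
  linarith

end GlmConcentration

/-! ### GLM-UCB as a base algorithm -/

section GlmAssumption

variable {κ : ℝ} {d T : ℕ} {δ : ℝ} {A : Set (EuclideanSpace ℝ (Fin d))} {μ : ℝ → ℝ} {lam : ℝ}

/-- A quarter of the coefficient of `ρ` absorbs four times the deviation bound `8 √(log (T / δ))`,
so reward deviations are always negligible against the rate. -/
lemma GlmParams.rhoCoef_lower (hp : GlmParams κ d T δ A μ lam) :
    32 * √(Real.log (T / δ)) ≤ rhoCoef (32 * (κ + 2)) d T δ μ lam / 4 ∧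
      1 ≤ rhoCoef (32 * (κ + 2)) d T δ μ lam := by
  have hκ := hp.kappa
  have hβ := hp.two_le_beta
  have hd := hp.one_le_d
  have hL := hp.log_two_le
  have h1 : √(Real.log (T / δ)) ≤ √(d * Real.log (T / δ)) :=
    Real.sqrt_le_sqrt (by nlinarith)
  have h2 : 1 / 2 ≤ √(Real.log (T / δ)) := Real.le_sqrt_of_sq_le (by linarith)
  have h3 : 32 * √(Real.log (T / δ)) ≤ rhoCoef (32 * (κ + 2)) d T δ μ lam / 4 := by
    rw [rhoCoef]
    calc 32 * √(Real.log (T / δ)) ≤ (8 * (κ + 2)) * 2 * √(d * Real.log (T / δ)) := by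
          nlinarith [Real.sqrt_nonneg (d * Real.log (T / δ))]
      _ ≤ (8 * (κ + 2)) * glmBeta d T δ μ lam * √(d * Real.log (T / δ)) := by gcongr
      _ = _ := by ring
  exact ⟨h3, by linarith⟩

lemma glmDelta_nonneg {κ₂ : ℝ} (hκ₂ : 0 ≤ κ₂) (hp : GlmParams κ d T δ A μ lam)
    (θ : ℕ → EuclideanSpace ℝ (Fin d)) (t : ℕ) : 0 ≤ glmDelta κ₂ T δ μ θ t := by
  have := hp.c_pos
  rw [glmDelta]; positivity

/-- The drift measure dominates the change of the mean rewards. -/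
lemma GlmParams.abs_glmReward_sub_le (hp : GlmParams κ d T δ A μ lam)
    {θ : ℕ → EuclideanSpace ℝ (Fin d)} (hθ : ∀ t ∈ Finset.Icc 1 T, ‖θ t‖ ≤ 1) {κ₂ : ℝ}
    (hκ₂ : 2 ≤ κ₂) {t : ℕ} (ht : t ∈ Finset.Ico 1 T) (a : A) :
    |glmReward A μ θ t a - glmReward A μ θ (t + 1) a| ≤ glmDelta κ₂ T δ μ θ t := by
  have hc := hp.c_pos
  have hk := hp.k_pos
  have ha := hp.norm_le _ a.2
  simp only [Finset.mem_Ico] at ht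
  have h1 := abs_link_sub_le hp.diff hp.mono hp.bdd
    (inner_mem_Icc ha (hθ t (by simp; omega))) (inner_mem_Icc ha (hθ (t + 1) (by simp; omega)))
  rw [← inner_sub_right] at h1
  refine h1.trans ?_
  have h2 : |inner ℝ a.1 (θ t - θ (t + 1))| ≤ ‖θ t - θ (t + 1)‖ :=
    (abs_real_inner_le_norm _ _).trans (mul_le_of_le_one_left (norm_nonneg _) ha)
  have h3 : 1 / 2 ≤ √(Real.log (T / δ)) :=
    Real.le_sqrt_of_sq_le (by linarith [hp.log_two_le])
  have h4 : kLink μ ≤ κ₂ * (kLink μ ^ 2 * d / cLink μ * √(Real.log (T / δ))) := by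
    have h5 := hp.one_le_k_div_c
    have h6 := hp.one_le_d
    have e : κ₂ * (kLink μ ^ 2 * d / cLink μ * √(Real.log (T / δ))) =
        kLink μ * ((kLink μ / cLink μ) * d * (κ₂ * √(Real.log (T / δ)))) := by ring
    rw [e]
    refine le_mul_of_one_le_right hk.le ?_
    have h7 : 1 ≤ κ₂ * √(Real.log (T / δ)) := by nlinarith
    exact one_le_mul_of_one_le_of_one_le (one_le_mul_of_one_le_of_one_le h5 h6) h7
  calc kLink μ * |inner ℝ a.1 (θ t - θ (t + 1))|
      ≤ κ₂ * (kLink μ ^ 2 * d / cLink μ * √(Real.log (T / δ))) * ‖θ t - θ (t + 1)‖ := by gcongr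
    _ = _ := by rw [glmDelta]; ring

/-- GLM-UCB satisfies the requirement on base algorithms. -/
theorem GlmParams.assumption1 (hp : GlmParams κ d T δ A μ lam)
    {θ : ℕ → EuclideanSpace ℝ (Fin d)} (hθ : ∀ t ∈ Finset.Icc 1 T, ‖θ t‖ ≤ 1)
    (hf : ∀ t ∈ Finset.Icc 1 T, ∀ a, glmReward A μ θ t a ∈ Set.Icc (0 : ℝ) 1) :
    Assumption1.{u, 0} (glmUCB A T δ μ lam) (glmReward A μ θ) T δ
      (glmDelta (100 * (32 * (κ + 2))) T δ μ θ) (glmRho (32 * (κ + 2)) d T δ μ lam) where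
  nonstationarity := fun t ht π =>
    hp.abs_glmReward_sub_le hθ (by linarith [hp.kappa]) ht π
  scalar_mem := by
    rintro h π x ⟨θhat, -, -, rfl⟩
    exact ⟨le_max_left _ _, max_le zero_le_one (min_le_left _ _)⟩
  rho_antitone := by
    intro s hs t _ hst
    have := hp.rhoCoef_lower.2
    have hs0 : (0 : ℝ) < s := by exact_mod_cast hs.1
    rw [glmRho_eq, glmRho_eq]
    gcongr
  rho_lower := by
    intro t ht
    have := hp.rhoCoef_lower.2
    rw [glmRho_eq]
    gcongr
  cum_monotone := by
    intro s _ t _ hst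
    have := hp.rhoCoef_lower.2
    have e : ∀ t : ℕ, (t : ℝ) * (rhoCoef (32 * (κ + 2)) d T δ μ lam / √t) =
        rhoCoef (32 * (κ + 2)) d T δ μ lam * √t := by
      intro t
      rw [mul_div_left_comm, Real.div_sqrt]
    simp only [glmRho_eq, e]
    gcongr
  guarantee := by
    intro Ω mΩ P _ ℱ 𝒢 π x R hrun t ht hdrift
    have hI := hrun.toInteraction
    have hζ := hp.confLevel_pos
    have htT : 1 ≤ t ∧ t ≤ T := Finset.mem_Icc.1 ht
    have hT := hp.two_le_T
    have hδ := hp.delta_pos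
    classical
    -- The indices below `T` carry the self-normalized noise bounds for each length of the history,
    -- and the index `T` carries the deviation of the rewards from their means on `[1, t]`. These `T
    -- + 1` events have total probability at most `δ / T`.
    refine ofReal_one_sub_le_of_union (Finset.range (T + 1)) (fun i => if i < T then
      {ω | ¬ quadInv (subGram (fun _ => True) lam (fun σ => π σ ω) (fun σ => R σ ω) i)
        (subSum (fun _ => True) (fun σ => R σ ω - glmReward A μ θ σ (π σ ω))
          (fun σ => (π σ ω).1.ofLp) i) ≤
          subPotential (fun _ => True) lam (fun σ => π σ ω) (fun σ => R σ ω) i +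
            Real.log (1 / confLevel T δ) / 2}
      else {ω | 8 * √(Real.log (T / δ)) * √((t - 1 + 1 : ℕ) : ℝ) <
        -1 * ∑ τ ∈ Finset.Icc 1 t, (R τ ω - glmReward A μ θ τ (π τ ω))}) hζ.le ?_ ?_ ?_
    · intro i _
      dsimp only
      split_ifs with hi
      · exact noise_tail hI hp.diff hf (J := fun _ _ => True)
          (fun t _ => MeasurableSet.univ) hp.lam_pos hi.le hζ
      · exact hI.deviation_tail (fun t _ => measurable_glmReward hp.diff θ t) hf hp.log_pos hζ
          hp.log_inv_confLevel_le le_rfl htT.1 htT.2 (Or.inr rfl)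
    · rw [Finset.card_range, confLevel]
      push_cast
      rw [← mul_div_assoc, div_le_div_iff₀ (by positivity) (by positivity)]
      have h1 : ((T : ℝ) + 1) * T ≤ 4 * T ^ 5 := by
        have : (T : ℝ) ^ 2 ≤ T ^ 5 := pow_le_pow_right₀ (by linarith) (by norm_num)
        nlinarith
      nlinarith
    · intro ω hω
      have hnoise : ∀ n < T, quadInv (subGram (fun _ => True) lam (fun σ => π σ ω)
          (fun σ => R σ ω) n) (subSum (fun _ => True) (fun σ => R σ ω - glmReward A μ θ σ (π σ ω))
          (fun σ => (π σ ω).1.ofLp) n) ≤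
          subPotential (fun _ => True) lam (fun σ => π σ ω) (fun σ => R σ ω) n +
            Real.log (1 / confLevel T δ) / 2 := by
        intro n hn
        have := hω n (by simp; omega)
        rw [if_pos hn] at this
        simpa using this
      have hdev := hω T (by simp)
      rw [if_neg (lt_irrefl T)] at hdev
      simp only [Set.mem_ofPred_eq, not_lt] at hdev
      have hg := hp.instance_guarantee hθ hf (J := fun _ => True) (a := fun σ => π σ ω)
        (x := fun σ => x σ ω) (R := fun σ => R σ ω) (s := 1) htT.1 htT.2 ?_ ?_ hnoise ?_
      · obtain ⟨h1, h2⟩ := hg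
        rw [Finset.filter_true] at h1 h2
        rw [Nat.card_Icc, Nat.add_sub_cancel] at h2
        rw [Nat.sub_add_cancel htT.1] at hdev
        -- Optimism and the regret bound are proved without any drift term; nonnegativity of the
        -- drift then gives the weaker form that is required.
        have hdr : 0 ≤ drift (glmDelta (100 * (32 * (κ + 2))) T δ μ θ) 1 t :=
          Finset.sum_nonneg fun i _ => glmDelta_nonneg (by linarith [hp.kappa]) hp θ i
        constructor
        · have hmem : optReward (glmReward A μ θ) t ∈
            optReward (glmReward A μ θ) '' Set.Icc 1 t := ⟨t, ⟨htT.1, le_rfl⟩, rfl⟩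
          have hbb : BddBelow (optReward (glmReward A μ θ) '' Set.Icc 1 t) :=
            ((Set.finite_Icc 1 t).image _).bddBelow
          have h3 := csInf_le hbb hmem
          have h4 := h1 t (Finset.mem_Icc.2 ⟨htT.1, le_rfl⟩)
          linarith
        · have h5 := hp.rhoCoef_lower.1
          have ht0 : (0 : ℝ) < t := by exact_mod_cast htT.1
          have hst : 0 < √(t : ℝ) := Real.sqrt_pos.2 ht0
          have h6 : ∑ τ ∈ Finset.Icc 1 t, (x τ ω - R τ ω) ≤
              rhoCoef (32 * (κ + 2)) d T δ μ lam * √t := by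
            have e : ∑ τ ∈ Finset.Icc 1 t, (x τ ω - R τ ω) =
                ∑ τ ∈ Finset.Icc 1 t, (x τ ω - glmReward A μ θ τ (π τ ω)) +
                  -1 * ∑ τ ∈ Finset.Icc 1 t, (R τ ω - glmReward A μ θ τ (π τ ω)) := by
              rw [Finset.mul_sum, ← Finset.sum_add_distrib]
              exact Finset.sum_congr rfl fun _ _ => by ring
            rw [e]
            have h7 : 8 * √(Real.log (T / δ)) * √(t : ℝ) ≤
                rhoCoef (32 * (κ + 2)) d T δ μ lam / 4 * √t := by
              gcongr
              linarith [Real.sqrt_nonneg (Real.log (T / δ))]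
            have h8 := hp.rhoCoef_lower.2
            nlinarith
          rw [glmRho_eq]
          have h9 : (1 / (t : ℝ)) * ∑ τ ∈ Finset.Icc 1 t, (x τ ω - R τ ω) ≤
              rhoCoef (32 * (κ + 2)) d T δ μ lam / √t := by
            calc (1 / (t : ℝ)) * ∑ τ ∈ Finset.Icc 1 t, (x τ ω - R τ ω)
                ≤ (1 / (t : ℝ)) * (rhoCoef (32 * (κ + 2)) d T δ μ lam * √t) := by gcongr
              _ = rhoCoef (32 * (κ + 2)) d T δ μ lam * (√t / t) := by ring
              _ = _ := by rw [Real.sqrt_div_self']; ring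
          linarith
      · exact fun τ hτ _ => hτ
      · intro τ hτ _
        have h3 := hrun.step τ (by simp at hτ ⊢; omega) ω
        simpa [subHistory] using h3
      · rwa [Nat.sub_add_cancel htT.1]

end GlmAssumption


/-! ### Combinatorics of blocks and instances -/

section Combinatorics

lemma card_filter_dvd_eq {k b s t : ℕ} (hk : 0 < k) (hs : 1 ≤ s) (hb : b ≤ s) :
    (((Finset.Icc s t).filter fun τ => k ∣ τ - b).card : ℤ) =
      max (⌊((t : ℚ) - b) / k⌋ - ⌊(((s - 1 : ℕ) : ℚ) - b) / k⌋) 0 := by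
  rw [← Nat.Ioc_filter_modEq_card _ _ hk b]
  congr 2
  ext τ
  simp only [Finset.mem_filter, Finset.mem_Icc, Finset.mem_Ioc]
  constructor
  · rintro ⟨⟨h1, h2⟩, h3⟩
    exact ⟨⟨by omega, h2⟩, ((Nat.modEq_iff_dvd' (hb.trans h1)).2 h3).symm⟩
  · rintro ⟨⟨h1, h2⟩, h3⟩
    exact ⟨⟨by omega, h2⟩, (Nat.modEq_iff_dvd' (by omega)).1 h3.symm⟩

lemma card_filter_dvd_le {k b s t : ℕ} (hk : 0 < k) (hs : 1 ≤ s) (hb : b ≤ s) (hst : s ≤ t) :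
    (((Finset.Icc s t).filter fun τ => k ∣ τ - b).card : ℝ) ≤
      ((t - s + 1 : ℕ) : ℝ) / k + 1 := by
  have h := card_filter_dvd_eq (t := t) hk hs hb
  set N := ((Finset.Icc s t).filter fun τ => k ∣ τ - b).card
  have hk' : (0 : ℚ) < k := by exact_mod_cast hk
  have h1 := Int.floor_le (((t : ℚ) - b) / k)
  have h2 := Int.lt_floor_add_one ((((s - 1 : ℕ) : ℚ) - b) / k)
  have h3 : (N : ℚ) ≤ ((t - s + 1 : ℕ) : ℚ) / k + 1 := by
    have e : ((t - s + 1 : ℕ) : ℚ) / k = ((t : ℚ) - b) / k - (((s - 1 : ℕ) : ℚ) - b) / k := by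
      rw [← sub_div]; congr 1; push_cast [Nat.cast_sub hst, Nat.cast_sub hs]; ring
    have h4 : 0 ≤ ((t - s + 1 : ℕ) : ℚ) / k := by positivity
    have h5 : (N : ℚ) = ((N : ℤ) : ℚ) := by simp
    rw [h5, h, Int.cast_max, Int.cast_sub, Int.cast_zero]
    refine max_le ?_ (by linarith)
    rw [e]; linarith
  have h6 := (Rat.cast_le (K := ℝ)).2 h3
  simpa only [Rat.cast_add, Rat.cast_div, Rat.cast_natCast, Rat.cast_one] using h6

lemma le_card_filter_dvd {k b s t : ℕ} (hk : 0 < k) (hs : 1 ≤ s) (hb : b ≤ s) :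
    (t : ℝ) + 1 - s ≤ k * (((Finset.Icc s t).filter fun τ => k ∣ τ - b).card + 1) := by
  have h := card_filter_dvd_eq (t := t) hk hs hb
  set N := ((Finset.Icc s t).filter fun τ => k ∣ τ - b).card
  have hk' : (0 : ℚ) < k := by exact_mod_cast hk
  have h1 := Int.lt_floor_add_one (((t : ℚ) - b) / k)
  have h2 := Int.floor_le ((((s - 1 : ℕ) : ℚ) - b) / k)
  have h3 : (t : ℚ) + 1 - s ≤ k * (N + 1) := by
    have h5 : (N : ℚ) = ((N : ℤ) : ℚ) := by simp
    have h6 : (⌊((t : ℚ) - b) / k⌋ : ℚ) - ⌊(((s - 1 : ℕ) : ℚ) - b) / k⌋ ≤ N := by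
      rw [h5, h]; push_cast; exact le_max_left _ _
    have e : ((t : ℚ) + 1 - s) / k = ((t : ℚ) - b) / k - (((s - 1 : ℕ) : ℚ) - b) / k := by
      rw [← sub_div]; congr 1; push_cast [Nat.cast_sub hs]; ring
    have h7 : ((t : ℚ) + 1 - s) / k ≤ N + 1 := by rw [e]; linarith
    rw [div_le_iff₀ hk'] at h7
    linarith
  exact_mod_cast h3

/-- The sequence of blocks of MASTER: a block restarts after a failed test and otherwise the order
increases when the block is complete. -/
structure IsBlockSeq (M : ℕ → Block) (fail : ℕ → Prop) : Prop where
  first : M 1 = ⟨1, 0⟩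
  restart : ∀ t, 1 ≤ t → fail t → M (t + 1) = ⟨t + 1, 0⟩
  next : ∀ t, 1 ≤ t → ¬ fail t → t + 1 = (M t).start + 2 ^ (M t).order →
    M (t + 1) = ⟨t + 1, (M t).order + 1⟩
  stay : ∀ t, 1 ≤ t → ¬ fail t → t + 1 ≠ (M t).start + 2 ^ (M t).order → M (t + 1) = M t

lemma isBlockSeq_masterBlock (ρ ρhat : ℕ → ℝ) (U : ℕ → ℕ → ℝ) (g R : ℕ → ℝ) :
    IsBlockSeq (masterBlock ρ ρhat U g R) (fun t =>
      (masterBlock ρ ρhat U g R t).Test1Fails ρ ρhat U g R t ∨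
        (masterBlock ρ ρhat U g R t).Test2Fails ρhat g R t) where
  first := by rw [masterBlock]
  restart := by
    rintro (_ | t) ht h
    · omega
    · rw [masterBlock]; exact if_pos h
  next := by
    rintro (_ | t) ht h h2
    · omega
    · rw [masterBlock]; exact (if_neg h).trans (if_pos h2)
  stay := by
    rintro (_ | t) ht h h2
    · omega
    · rw [masterBlock]; exact (if_neg h).trans (if_neg h2)

lemma sum_starts_succ (M : ℕ → Block) (t : ℕ) (φ : ℕ → ℝ) :
    ∑ b ∈ (Finset.Icc 1 (t + 1)).filter (fun b => (M b).start = b), φ b =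
      ∑ b ∈ (Finset.Icc 1 t).filter (fun b => (M b).start = b), φ b +
        if (M (t + 1)).start = t + 1 then φ (t + 1) else 0 := by
  rw [Finset.sum_filter, Finset.sum_Icc_succ_top (by omega), ← Finset.sum_filter]

namespace IsBlockSeq

variable {M : ℕ → Block} {fail : ℕ → Prop} (hM : IsBlockSeq M fail)
include hM

/-- One round either starts a block of order `0`, or starts the next block, or stays. -/
lemma succ_cases {t : ℕ} (ht : 1 ≤ t) :
    (fail t ∧ M (t + 1) = ⟨t + 1, 0⟩) ∨
    (¬ fail t ∧ t + 1 = (M t).start + 2 ^ (M t).order ∧ M (t + 1) = ⟨t + 1, (M t).order + 1⟩) ∨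
    (¬ fail t ∧ t + 1 ≠ (M t).start + 2 ^ (M t).order ∧ M (t + 1) = M t) := by
  by_cases h : fail t
  · exact Or.inl ⟨h, hM.restart t ht h⟩
  · by_cases h2 : t + 1 = (M t).start + 2 ^ (M t).order
    · exact Or.inr (Or.inl ⟨h, h2, hM.next t ht h h2⟩)
    · exact Or.inr (Or.inr ⟨h, h2, hM.stay t ht h h2⟩)

/-- The last bound holds because a block of order `n + 1` begins `2 ^ n` rounds after a block of
order `n`, which by induction begins no earlier than round `2 ^ n`. It limits the orders to `log₂
T`. -/
lemma bounds {t : ℕ} (ht : 1 ≤ t) :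
    (M t).start ≤ t ∧ t < (M t).start + 2 ^ (M t).order ∧ 2 ^ (M t).order ≤ (M t).start := by
  induction t, ht using Nat.le_induction with
  | base => rw [hM.first]; simp
  | succ t ht ih =>
    obtain ⟨h1, h2, h3⟩ := ih
    rcases hM.succ_cases ht with ⟨-, h⟩ | ⟨-, h4, h⟩ | ⟨-, h4, h⟩ <;> rw [h]
    · simp
    · refine ⟨le_rfl, by simp, ?_⟩
      simp only [pow_succ]; omega
    · exact ⟨by omega, by omega, h3⟩

lemma one_le_start {t : ℕ} (ht : 1 ≤ t) : 1 ≤ (M t).start :=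
  Nat.one_le_two_pow.trans (hM.bounds ht).2.2

lemma pow_order_le {t : ℕ} (ht : 1 ≤ t) : 2 ^ (M t).order ≤ t :=
  (hM.bounds ht).2.2.trans (hM.bounds ht).1

lemma eq_of_start_le {τ t : ℕ} (ht : 1 ≤ t) (h1 : (M t).start ≤ τ) (h2 : τ ≤ t) :
    M τ = M t := by
  induction t, ht using Nat.le_induction with
  | base =>
    rw [hM.first] at h1
    have : τ = 1 := le_antisymm h2 h1
    rw [this]
  | succ t ht ih =>
    rcases h2.eq_or_lt with h | h
    · rw [h]
    · rcases hM.succ_cases ht with ⟨-, h3⟩ | ⟨-, -, h3⟩ | ⟨-, -, h3⟩ <;> rw [h3] at h1 ⊢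
      · simp at h1; omega
      · simp at h1; omega
      · exact ih h1 (by omega)

lemma eq_of_le_of_le {s τ t : ℕ} (hs : 1 ≤ s) (h1 : s ≤ τ) (h2 : τ ≤ t) (h : M s = M t) :
    M τ = M t :=
  hM.eq_of_start_le (by omega) (by rw [← h]; exact (hM.bounds hs).1.trans h1) h2

/-- A failed test makes the next round the start of a new block, so a block that continues has
passed its tests. -/
lemma not_fail {s t : ℕ} (hs : 1 ≤ s) (hst : s < t) (h : M s = M t) : ¬ fail s := by
  intro hf
  have h1 := hM.restart s hs hf
  have h2 := hM.eq_of_le_of_le hs (Nat.le_succ s) hst h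
  have h3 := (hM.bounds hs).1
  rw [h, ← h2, Nat.succ_eq_add_one, h1] at h3
  simp at h3

/-- Nominal lengths are summed, even of blocks cut short by a restart. A block of order `n + 1` is
preceded by `2 ^ n` completed rounds, which pay for its length `2 ^ (n + 1)` at two per round; a
restart adds only `1`. -/
lemma sum_pow_order_le {t : ℕ} (ht : 1 ≤ t) :
    ∑ b ∈ (Finset.Icc 1 t).filter (fun b => (M b).start = b), (2 : ℝ) ^ (M b).order ≤
      2 * (M t).start - 1 := by
  induction t, ht using Nat.le_induction with
  | base => norm_num [hM.first, Finset.filter_singleton]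
  | succ t ht ih =>
    rw [sum_starts_succ]
    have hb := hM.bounds ht
    have hs : ((M t).start : ℝ) ≤ t := by exact_mod_cast hb.1
    rcases hM.succ_cases ht with ⟨-, h⟩ | ⟨-, h2, h⟩ | ⟨-, -, h⟩ <;> rw [h]
    · simp; linarith
    · have e : (t : ℝ) + 1 = (M t).start + 2 ^ (M t).order := by exact_mod_cast h2
      simp only [if_true, pow_succ]
      push_cast
      rw [e]; linarith
    · rw [if_neg (by omega)]; linarith

end IsBlockSeq

namespace Block

variable {ρ : ℕ → ℝ} {U : ℕ → ℕ → ℝ} {B : Block}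

lemma instStart_le {m t : ℕ} (ht : B.start ≤ t) : B.instStart m t ≤ t := by
  have := Nat.mul_div_le (t - B.start) (2 ^ m)
  rw [instStart]; omega

lemma lt_instStart_add {m t : ℕ} : t < B.instStart m t + 2 ^ m := by
  have := Nat.lt_mul_div_succ (t - B.start) (Nat.two_pow_pos m)
  rw [instStart]
  rw [mul_add] at this
  omega

lemma instStart_eq {m s t : ℕ} (hs : B.start ≤ s) (hd : 2 ^ m ∣ s - B.start) (h1 : s ≤ t)
    (h2 : t < s + 2 ^ m) : B.instStart m t = s := by
  obtain ⟨k, hk⟩ := hd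
  have : (t - B.start) / 2 ^ m = k := by
    apply Nat.div_eq_of_lt_le
    · rw [Nat.mul_comm]; omega
    · rw [Nat.mul_comm, Nat.mul_succ]; omega
  rw [instStart, this]; omega

/-- Dyadic intervals are nested: a shorter one that reaches beyond an end point of the coarser
partition cannot begin before it. -/
lemma le_instStart {m m' s t : ℕ} (hs : B.start ≤ s) (hd : 2 ^ m ∣ s - B.start) (hm : m' ≤ m)
    (h1 : s ≤ t) : s ≤ B.instStart m' t := by
  obtain ⟨k, hk⟩ := (pow_dvd_pow 2 hm).trans hd
  have : k ≤ (t - B.start) / 2 ^ m' := by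
    rw [Nat.le_div_iff_mul_le (Nat.two_pow_pos _), Nat.mul_comm]; omega
  have := Nat.mul_le_mul_left (2 ^ m') this
  rw [instStart]; omega

/-- The instance of the full length of the block is always scheduled, its coin having success
probability `1`. So the set of covering orders is nonempty and its infimum is attained. -/
lemma scheduled_activeOrder (hρ : ρ (2 ^ B.order) ≠ 0) (hU : U B.start B.order ≤ 1) {t : ℕ}
    (h1 : B.start ≤ t) (h2 : t < B.start + 2 ^ B.order) :
    B.Scheduled ρ U (B.activeOrder ρ U t) (B.instStart (B.activeOrder ρ U t) t) := by
  refine Nat.sInf_mem (s := {m | B.Scheduled ρ U m (B.instStart m t)}) ⟨B.order, ?_⟩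
  have e : B.instStart B.order t = B.start := instStart_eq le_rfl (by simp) h1 h2
  rw [Set.mem_ofPred_eq, e]
  exact ⟨le_rfl, le_rfl, by simp, by simp, by rw [div_self hρ]; exact hU⟩

lemma activeOrder_le {m s t : ℕ} (h : B.Scheduled ρ U m s) (h1 : s ≤ t) (h2 : t < s + 2 ^ m) :
    B.activeOrder ρ U t ≤ m := by
  refine Nat.sInf_le ?_
  rw [Set.mem_ofPred_eq, instStart_eq h.2.1 h.2.2.2.1 h1 h2]
  exact h

end Block

/-! #### Nearly stationary pieces -/

open Classical in
/-- The greedy partition into nearly stationary pieces: the first round of the piece of `t`. -/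
noncomputable def pieceStart (ρ Δ : ℕ → ℝ) : ℕ → ℕ
  | 0 => 1
  | t + 1 => if drift Δ (pieceStart ρ Δ t) (t + 1) ≤ ρ (t + 2 - pieceStart ρ Δ t) then
      pieceStart ρ Δ t else t + 1

section Pieces

variable {ρ Δ : ℕ → ℝ}

lemma drift_mono (hΔ : ∀ t, 0 ≤ Δ t) {s s' t t' : ℕ} (hs : s' ≤ s) (ht : t ≤ t') :
    drift Δ s t ≤ drift Δ s' t' :=
  Finset.sum_le_sum_of_subset_of_nonneg (Finset.Ico_subset_Ico hs ht) fun _ _ _ => hΔ _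

lemma pieceStart_succ_cases (t : ℕ) :
    (drift Δ (pieceStart ρ Δ t) (t + 1) ≤ ρ (t + 2 - pieceStart ρ Δ t) ∧
      pieceStart ρ Δ (t + 1) = pieceStart ρ Δ t) ∨
    (ρ (t + 2 - pieceStart ρ Δ t) < drift Δ (pieceStart ρ Δ t) (t + 1) ∧
      pieceStart ρ Δ (t + 1) = t + 1) := by
  by_cases h : drift Δ (pieceStart ρ Δ t) (t + 1) ≤ ρ (t + 2 - pieceStart ρ Δ t)
  · exact Or.inl ⟨h, by rw [pieceStart, if_pos h]⟩
  · exact Or.inr ⟨not_le.1 h, by rw [pieceStart, if_neg h]⟩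

/-- The artificial value at `0` is chosen so that both branches of the recursion give `1`, whatever
the sign of `ρ 1`. -/
lemma pieceStart_one : pieceStart ρ Δ 1 = 1 := by
  rcases pieceStart_succ_cases (ρ := ρ) (Δ := Δ) 0 with ⟨-, h⟩ | ⟨-, h⟩ <;> (rw [h]; try rfl)

lemma pieceStart_bounds (h1 : 0 ≤ ρ 1) {t : ℕ} (ht : 1 ≤ t) :
    1 ≤ pieceStart ρ Δ t ∧ pieceStart ρ Δ t ≤ t ∧
      drift Δ (pieceStart ρ Δ t) t ≤ ρ (t + 1 - pieceStart ρ Δ t) := by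
  induction t, ht using Nat.le_induction with
  | base => rw [pieceStart_one]; simpa [drift] using h1
  | succ t ht ih =>
    rcases pieceStart_succ_cases (ρ := ρ) (Δ := Δ) t with ⟨h, h2⟩ | ⟨-, h2⟩ <;> rw [h2]
    · exact ⟨ih.1, by omega, h⟩
    · refine ⟨by omega, le_rfl, ?_⟩
      simpa [drift] using h1

lemma pieceStart_eq_of_le {s t : ℕ} (ht : 1 ≤ t) (hs : pieceStart ρ Δ t ≤ s)
    (hst : s ≤ t) : pieceStart ρ Δ s = pieceStart ρ Δ t := by
  induction t, ht using Nat.le_induction with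
  | base =>
    rw [pieceStart_one] at hs
    rw [show s = 1 by omega]
  | succ t ht ih =>
    rcases hst.eq_or_lt with h | h
    · rw [h]
    · rcases pieceStart_succ_cases (ρ := ρ) (Δ := Δ) t with ⟨-, h2⟩ | ⟨-, h2⟩
      · rw [h2] at hs ⊢; exact ih hs (by omega)
      · rw [h2] at hs; omega

/-- A shorter window inside a piece has less drift and a larger threshold. -/
lemma drift_le_of_pieceStart_le (hΔ : ∀ t, 0 ≤ Δ t) (h1 : 0 ≤ ρ 1)
    (hρ : AntitoneOn ρ (Set.Ici 1)) {s t : ℕ} (hs1 : 1 ≤ s) (hs : pieceStart ρ Δ t ≤ s)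
    (hst : s ≤ t) : drift Δ s t ≤ ρ (t - s + 1) := by
  obtain ⟨-, h2, h3⟩ := pieceStart_bounds (ρ := ρ) (Δ := Δ) h1 (hs1.trans hst)
  refine (drift_mono hΔ hs le_rfl).trans (h3.trans (hρ ?_ ?_ ?_)) <;> simp <;> omega

/-- The number of nearly stationary pieces that start in the rounds `1, …, t`. -/
noncomputable def pieceCount (ρ Δ : ℕ → ℝ) (t : ℕ) : ℕ :=
  ((Finset.Icc 1 t).filter fun τ => pieceStart ρ Δ τ = τ).card

lemma pieceCount_succ (t : ℕ) : pieceCount ρ Δ (t + 1) =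
    pieceCount ρ Δ t + if pieceStart ρ Δ (t + 1) = t + 1 then 1 else 0 := by
  rw [pieceCount, Finset.card_filter, Finset.sum_Icc_succ_top (by omega), ← Finset.card_filter,
    ← pieceCount]

lemma pieceCount_mono {s t : ℕ} (h : s ≤ t) : pieceCount ρ Δ s ≤ pieceCount ρ Δ t :=
  Finset.card_le_card (Finset.filter_subset_filter _ (Finset.Icc_subset_Icc_right h))

lemma pieceCount_one : pieceCount ρ Δ 1 = 1 := by
  rw [pieceCount_succ, pieceStart_one]; simp [pieceCount]

-- A piece is closed only when its drift, extended to the next round, exceeds a nonnegative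
-- threshold, so it contains a nonzero change. Changes found for different pieces are distinct,
-- because the counting range stops at the start of the current piece.
open Classical in
lemma pieceCount_le_changes (hρ0 : ∀ t, 0 ≤ ρ t) {t : ℕ} (ht : 1 ≤ t) :
    pieceCount ρ Δ t ≤ 1 + ((Finset.Ico 1 (pieceStart ρ Δ t)).filter fun τ => Δ τ ≠ 0).card := by
  induction t, ht using Nat.le_induction with
  | base => rw [pieceCount_one]; omega
  | succ t ht ih =>
    rw [pieceCount_succ]
    have hb := pieceStart_bounds (ρ := ρ) (Δ := Δ) (hρ0 1) ht
    rcases pieceStart_succ_cases (ρ := ρ) (Δ := Δ) t with ⟨-, h2⟩ | ⟨h, h2⟩ <;> rw [h2]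
    · rw [if_neg (by omega)]; exact ih
    · rw [if_pos rfl]
      have h3 : drift Δ (pieceStart ρ Δ t) (t + 1) ≠ 0 := ((hρ0 _).trans_lt h).ne'
      obtain ⟨i, hi, hi0⟩ := Finset.exists_ne_zero_of_sum_ne_zero h3
      have h4 : ((Finset.Ico 1 (pieceStart ρ Δ t)).filter fun τ => Δ τ ≠ 0).card <
          ((Finset.Ico 1 (t + 1)).filter fun τ => Δ τ ≠ 0).card := by
        refine Finset.card_lt_card ((Finset.ssubset_iff_of_subset ?_).2 ⟨i, ?_, ?_⟩)
        · exact Finset.filter_subset_filter _ (Finset.Ico_subset_Ico_right (by omega))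
        · simp only [Finset.mem_Ico, Finset.mem_filter] at hi ⊢
          exact ⟨⟨by omega, by omega⟩, hi0⟩
        · simp only [Finset.mem_Ico, Finset.mem_filter] at hi ⊢
          omega
      omega

/-- Each closed piece, of length `w` say, has drift above `c / √(w + 1) ≥ c / √(2 w)`, and it
increases the right-hand side by at least `1`. The free scale `z` stands in for Hölder's inequality
and is optimized at the very end. -/
lemma pieceCount_le_drift {c z : ℝ} (hc : 0 < c) (hz : 0 < z)
    (hρ : ∀ t, ρ t = c / √(t : ℝ)) {t : ℕ} (ht : 1 ≤ t) :
    (pieceCount ρ Δ t : ℝ) - 1 ≤ √(2 * z) * drift Δ 1 (pieceStart ρ Δ t) / c +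
      ((pieceStart ρ Δ t : ℝ) - 1) / (3 * z) := by
  have h10 : 0 ≤ ρ 1 := by rw [hρ]; positivity
  induction t, ht using Nat.le_induction with
  | base => simp [pieceCount_one, pieceStart_one, drift]
  | succ t ht ih =>
    rw [pieceCount_succ]
    have hb := pieceStart_bounds (ρ := ρ) (Δ := Δ) h10 ht
    rcases pieceStart_succ_cases (ρ := ρ) (Δ := Δ) t with ⟨-, h2⟩ | ⟨h, h2⟩ <;> rw [h2]
    · rw [if_neg (by omega)]; simpa using ih
    · rw [if_pos rfl]
      set j := pieceStart ρ Δ t with hj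
      have hsplit : drift Δ 1 (t + 1) = drift Δ 1 j + drift Δ j (t + 1) :=
        (Finset.sum_Ico_consecutive _ hb.1 (by omega)).symm
      set w : ℝ := (t : ℝ) + 1 - j with hw
      have hw1 : 1 ≤ w := by
        have : (j : ℝ) ≤ t := by exact_mod_cast hb.2.1
        rw [hw]; linarith
      have hw2 : ((t + 2 - j : ℕ) : ℝ) = w + 1 := by
        rw [Nat.cast_sub (by omega), hw]; push_cast; ring
      rw [hρ, hw2] at h
      have h3 : c / √(2 * w) ≤ drift Δ j (t + 1) := by
        refine le_trans ?_ h.le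
        gcongr
        linarith
      set q := √(z / w) with hq
      have hq0 : 0 < q := Real.sqrt_pos.2 (by positivity)
      have hq2 : q ^ 2 = z / w := Real.sq_sqrt (by positivity)
      have h4 : q ≤ √(2 * z) * drift Δ j (t + 1) / c := by
        rw [le_div_iff₀ hc]
        calc q * c = √(2 * z) * (c / √(2 * w)) := by
              have : q = √(2 * z) / √(2 * w) := by
                rw [hq, ← Real.sqrt_div (by positivity)]
                congr 1; field_simp
              rw [this]; ring
          _ ≤ _ := by gcongr
      -- With `q = √(z / w)` this is `q + 1 / (3 q ^ 2) ≥ 1` for positive `q`. Pieces shorter than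
      -- `z` are paid for by their drift, longer ones by their length.
      have h5 : 1 ≤ q + w / (3 * z) := by
        have e : w / (3 * z) = 1 / (3 * q ^ 2) := by rw [hq2]; field_simp
        rw [e]
        rw [← sub_le_iff_le_add', le_div_iff₀ (by positivity)]
        nlinarith [mul_pos hq0 hq0, sq_nonneg (q - 2 / 3), mul_nonneg hq0.le (sq_nonneg (q - 2/3)),
          mul_nonneg hq0.le (sq_nonneg (3 * q - 2))]
      have e1 : √(2 * z) * drift Δ 1 (t + 1) / c =
          √(2 * z) * drift Δ 1 j / c + √(2 * z) * drift Δ j (t + 1) / c := by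
        rw [hsplit]; ring
      have e2 : (((t + 1 : ℕ) : ℝ) - 1) / (3 * z) = ((j : ℝ) - 1) / (3 * z) + w / (3 * z) := by
        rw [hw]; push_cast; ring
      rw [e1, e2]
      push_cast
      linarith

end Pieces

end Combinatorics


/-! ### MASTER along a path on which all concentration events hold -/

section GoodPath

open Classical in
/-- The rounds up to `t` in which the instance of order `m` started in round `s` of the block `B` is
active. -/
noncomputable def instRounds (ρ : ℕ → ℝ) (U : ℕ → ℕ → ℝ) (M : ℕ → Block) (B : Block)
    (m s t : ℕ) : Finset ℕ :=
  (Finset.Icc 1 t).filter fun τ =>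
    M τ = B ∧ s ≤ τ ∧ B.activeOrder ρ U τ = m ∧ B.instStart m τ = s

/-- A round `s` of the block `B` in which an instance of order `m` would reveal a gap between the
optimal reward and the scalar that was seen earlier in the same nearly stationary piece. -/
def IsCandidate (ρ ρhat Δ fs g : ℕ → ℝ) (B : Block) (m s : ℕ) : Prop :=
  2 ^ m ∣ s - B.start ∧ pieceStart ρ Δ (s + 2 ^ m - 1) = pieceStart ρ Δ s ∧
    ∃ τ, B.start ≤ τ ∧ pieceStart ρ Δ s ≤ τ ∧ τ < s ∧ g τ + 12 * ρhat (2 ^ m) ≤ fs τ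

/-- The rate `c / √t`. -/
noncomputable def sqrtRate (c : ℝ) (t : ℕ) : ℝ := c / √(t : ℝ)

open Classical in
/-- A path of MASTER, with optimal rewards `fs`, mean rewards `F`, scalars `g` and rewards `R`, along
which the base algorithm, the rewards and the coins behave as they should. -/
structure GoodPath (T : ℕ) (c h Lg : ℝ) (Δ fs F g R : ℕ → ℝ) (U : ℕ → ℕ → ℝ) (M : ℕ → Block) :
    Prop where
  one_le_c : 1 ≤ c
  one_le_h : 1 ≤ h
  Lg_nonneg : 0 ≤ Lg
  h_large : (Nat.log 2 T + 1 : ℝ) * (4 + Lg) + 1 ≤ 4 * h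
  drift_nonneg : ∀ t, 0 ≤ Δ t
  blockSeq : IsBlockSeq M fun t =>
    (M t).Test1Fails (sqrtRate c) (sqrtRate (h * c)) U g R t ∨
      (M t).Test2Fails (sqrtRate (h * c)) g R t
  seed_le : ∀ t ∈ Finset.Icc 1 T, ∀ m, U t m ≤ 1
  mean_le : ∀ t ∈ Finset.Icc 1 T, F t ≤ fs t
  opt_le : ∀ t ∈ Finset.Icc 1 T, fs t ≤ 1
  scalar_mem : ∀ t ∈ Finset.Icc 1 T, g t ∈ Set.Icc (0 : ℝ) 1
  reward_nonneg : ∀ t ∈ Finset.Icc 1 T, 0 ≤ R t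
  opt_sub_le : ∀ t ∈ Finset.Ico 1 T, |fs t - fs (t + 1)| ≤ Δ t
  instance_guarantee : ∀ B m s t, 1 ≤ s → s ≤ t → t ≤ T → B.order < T → m ≤ B.order →
    1 ≤ B.start → B.start ≤ T → drift Δ s t ≤ sqrtRate c (t - s + 1) →
    (∀ τ ∈ instRounds (sqrtRate c) U M B m s t, fs τ ≤ g τ) ∧
    ∑ τ ∈ instRounds (sqrtRate c) U M B m s t, (g τ - F τ) ≤
      c / 4 * √((instRounds (sqrtRate c) U M B m s t).card : ℝ)
  deviation : ∀ s t, 1 ≤ s → s ≤ t → t ≤ T →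
    |∑ τ ∈ Finset.Icc s t, (R τ - F τ)| ≤ c / 4 * √((t - s + 1 : ℕ) : ℝ)
  coins_upper : ∀ B m s t, 1 ≤ s → s ≤ t → t ≤ T → B.order < T → m ≤ B.order →
    1 ≤ B.start → B.start ≤ T →
    (((Finset.Icc s t).filter fun τ => M τ = B ∧ B.Scheduled (sqrtRate c) U m τ).card : ℝ) ≤
      2 * (sqrtRate c (2 ^ B.order) / sqrtRate c (2 ^ m)) *
        ((Finset.Icc s t).filter fun τ => M τ = B ∧ 2 ^ m ∣ τ - B.start).card + Lg
  coins_lower : ∀ B m, B.order < T → m ≤ B.order → 1 ≤ B.start → B.start ≤ T →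
    (sqrtRate c (2 ^ B.order) / sqrtRate c (2 ^ m)) / 2 * ((Finset.Icc 1 T).filter fun τ =>
      M τ = B ∧ IsCandidate (sqrtRate c) (sqrtRate (h * c)) Δ fs g B m τ).card ≤
    (((Finset.Icc 1 T).filter fun τ => (M τ = B ∧
      IsCandidate (sqrtRate c) (sqrtRate (h * c)) Δ fs g B m τ) ∧
        B.Scheduled (sqrtRate c) U m τ).card : ℝ) + Lg

lemma sqrtRate_nonneg {c : ℝ} (hc : 0 ≤ c) (t : ℕ) : 0 ≤ sqrtRate c t := by
  rw [sqrtRate]; positivity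

lemma sqrtRate_antitone {c : ℝ} (hc : 0 ≤ c) : AntitoneOn (sqrtRate c) (Set.Ici 1) := by
  intro s hs t _ hst
  have hs0 : (0 : ℝ) < s := by exact_mod_cast (show 0 < s from hs)
  rw [sqrtRate, sqrtRate]
  gcongr

lemma sqrtRate_mul_self (c : ℝ) (t : ℕ) : sqrtRate c t * t = c * √(t : ℝ) := by
  rw [sqrtRate, div_mul_eq_mul_div, mul_div_assoc, Real.div_sqrt]

lemma sqrtRate_ratio {c : ℝ} (hc : 0 < c) (n m : ℕ) :
    sqrtRate c (2 ^ n) / sqrtRate c (2 ^ m) = √(2 ^ m : ℝ) / √(2 ^ n : ℝ) := by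
  rw [sqrtRate, sqrtRate]
  have : 0 < √(2 ^ m : ℝ) := by positivity
  have : 0 < √(2 ^ n : ℝ) := by positivity
  push_cast
  field_simp

namespace GoodPath

variable {T : ℕ} {c h Lg : ℝ} {Δ fs F g R : ℕ → ℝ} {U : ℕ → ℕ → ℝ} {M : ℕ → Block}
  (H : GoodPath T c h Lg Δ fs F g R U M)
include H

lemma c_pos : 0 < c := zero_lt_one.trans_le H.one_le_c

lemma rate_pos (n : ℕ) : 0 < sqrtRate c (2 ^ n) := by
  have := H.c_pos
  rw [sqrtRate]; positivity

lemma order_le {t : ℕ} (ht : t ∈ Finset.Icc 1 T) : (M t).order ≤ Nat.log 2 T := by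
  rw [Finset.mem_Icc] at ht
  exact Nat.le_log_of_pow_le (by norm_num) ((H.blockSeq.pow_order_le ht.1).trans ht.2)

lemma order_lt {t : ℕ} (ht : t ∈ Finset.Icc 1 T) : (M t).order < T := by
  rw [Finset.mem_Icc] at ht
  exact (Nat.lt_two_pow_self).trans_le ((H.blockSeq.pow_order_le ht.1).trans ht.2)

lemma start_mem {t : ℕ} (ht : t ∈ Finset.Icc 1 T) : (M t).start ∈ Finset.Icc 1 T := by
  rw [Finset.mem_Icc] at ht ⊢
  exact ⟨H.blockSeq.one_le_start ht.1, (H.blockSeq.bounds ht.1).1.trans ht.2⟩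

lemma scheduled_active {t : ℕ} (ht : t ∈ Finset.Icc 1 T) :
    (M t).Scheduled (sqrtRate c) U ((M t).activeOrder (sqrtRate c) U t)
      ((M t).instStart ((M t).activeOrder (sqrtRate c) U t) t) := by
  have hb := H.blockSeq.bounds (Finset.mem_Icc.1 ht).1
  exact Block.scheduled_activeOrder (H.rate_pos _).ne' (H.seed_le _ (H.start_mem ht) _) hb.1 hb.2.1

lemma opt_le_add_drift {s t : ℕ} (hs : 1 ≤ s) (hst : s ≤ t) (ht : t ≤ T) :
    |fs s - fs t| ≤ drift Δ s t := by
  induction t, hst using Nat.le_induction with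
  | base => simp [drift]
  | succ t hst ih =>
    rw [drift, Finset.sum_Ico_succ_top hst, ← drift]
    have h1 := ih (by omega)
    have h2 := H.opt_sub_le t (by simp; omega)
    calc |fs s - fs (t + 1)| ≤ |fs s - fs t| + |fs t - fs (t + 1)| := abs_sub_le _ _ _
      _ ≤ _ := by linarith

-- The coin probability `√(2 ^ m / 2 ^ n)` is tuned for this bound. The expected number of instances
-- of order `m` in a window of length `w ≤ 2 ^ n`, each costing at most `√(2 ^ m)`, gives at most
-- order `w / √(2 ^ n) ≤ √w`. The boundary term and the fluctuation of the coins cost `√w` each, up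
-- to the factor `Lg`.
open Classical in
lemma instance_sum_le {s t : ℕ} (hs : 1 ≤ s) (hst : s ≤ t) (ht : t ≤ T) (hB : M s = M t)
    {m : ℕ} (hm : m ≤ (M t).order) :
    (((Finset.Icc s t).filter fun τ => (M t).Scheduled (sqrtRate c) U m τ).card : ℝ) *
      √(min (2 ^ m) ((t - s + 1 : ℕ) : ℝ)) ≤ (4 + Lg) * √((t - s + 1 : ℕ) : ℝ) := by
  have htT : t ∈ Finset.Icc 1 T := Finset.mem_Icc.2 ⟨hs.trans hst, ht⟩
  have hb := H.blockSeq.bounds (hs.trans hst)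
  have hbs : (M t).start ≤ s := by rw [← hB]; exact (H.blockSeq.bounds hs).1
  have hM : ∀ τ ∈ Finset.Icc s t, M τ = M t := fun τ hτ => by
    rw [Finset.mem_Icc] at hτ
    exact H.blockSeq.eq_of_le_of_le hs hτ.1 hτ.2 hB
  have hst' := H.start_mem htT
  rw [Finset.mem_Icc] at hst'
  have h1 := H.coins_upper (M t) m s t hs hst ht (H.order_lt htT) hm hst'.1 hst'.2
  have e1 : (Finset.Icc s t).filter (fun τ => M τ = M t ∧ (M t).Scheduled (sqrtRate c) U m τ) =
      (Finset.Icc s t).filter fun τ => (M t).Scheduled (sqrtRate c) U m τ :=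
    Finset.filter_congr fun τ hτ => by simp [hM τ hτ]
  have e2 : (Finset.Icc s t).filter (fun τ => M τ = M t ∧ 2 ^ m ∣ τ - (M t).start) =
      (Finset.Icc s t).filter fun τ => 2 ^ m ∣ τ - (M t).start :=
    Finset.filter_congr fun τ hτ => by simp [hM τ hτ]
  rw [e1, e2, sqrtRate_ratio H.c_pos] at h1
  have h2 := card_filter_dvd_le (Nat.two_pow_pos m) hs hbs hst
  set N := (((Finset.Icc s t).filter fun τ => (M t).Scheduled (sqrtRate c) U m τ).card : ℝ)
  set w := ((t - s + 1 : ℕ) : ℝ) with hw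
  set D := ((((Finset.Icc s t).filter fun τ => 2 ^ m ∣ τ - (M t).start).card : ℕ) : ℝ)
  have hw0 : 0 < w := by rw [hw]; exact_mod_cast Nat.succ_pos _
  have hwn : w ≤ 2 ^ (M t).order := by
    have : t - s + 1 ≤ 2 ^ (M t).order := by omega
    rw [hw]; exact_mod_cast this
  push_cast at h2
  set x := √(2 ^ m : ℝ) with hx
  set y := √(2 ^ (M t).order : ℝ) with hy
  have hx0 : 0 < x := by positivity
  have hy0 : 0 < y := by positivity
  have hxx : x * x = 2 ^ m := Real.mul_self_sqrt (by positivity)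
  have hxy : x ≤ y := Real.sqrt_le_sqrt (pow_le_pow_right₀ (by norm_num) hm)
  have hwy : √w ≤ y := Real.sqrt_le_sqrt hwn
  have hminx : √(min (2 ^ m) w) ≤ x := Real.sqrt_le_sqrt (min_le_left _ _)
  have hminw : √(min (2 ^ m) w) ≤ √w := Real.sqrt_le_sqrt (min_le_right _ _)
  have hmin0 : 0 ≤ √(min (2 ^ m) w) := Real.sqrt_nonneg _
  have hp1 : x / y ≤ 1 := (div_le_one hy0).2 hxy
  have hL := H.Lg_nonneg
  have h3 : N ≤ 2 * (x / y) * (w / 2 ^ m) + (2 + Lg) := by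
    have h4 : 2 * (x / y) * D ≤ 2 * (x / y) * (w / 2 ^ m + 1) := by gcongr
    linarith
  have h5 : 2 * (x / y) * (w / 2 ^ m) * x ≤ 2 * √w := by
    have e : 2 * (x / y) * (w / 2 ^ m) * x = 2 * (w / y) := by
      rw [← hxx]; field_simp
    rw [e]
    have : w / y ≤ √w := by
      rw [div_le_iff₀ hy0]
      nth_rewrite 1 [← Real.mul_self_sqrt hw0.le]
      gcongr
    linarith
  calc N * √(min (2 ^ m) w)
      ≤ (2 * (x / y) * (w / 2 ^ m) + (2 + Lg)) * √(min (2 ^ m) w) := by gcongr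
    _ = 2 * (x / y) * (w / 2 ^ m) * √(min (2 ^ m) w) + (2 + Lg) * √(min (2 ^ m) w) := by ring
    _ ≤ 2 * (x / y) * (w / 2 ^ m) * x + (2 + Lg) * √w := by gcongr
    _ ≤ _ := by linarith

/-- In a nearly stationary window that cuts no instance short at its start, the scalars are
optimistic and the rewards are close to them. -/
theorem window {s t : ℕ} (hs : 1 ≤ s) (hst : s ≤ t) (ht : t ≤ T) (hB : M s = M t)
    (hstart : ∀ τ ∈ Finset.Icc s t,
      s ≤ (M t).instStart ((M t).activeOrder (sqrtRate c) U τ) τ)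
    (hdrift : drift Δ s t ≤ sqrtRate c (t - s + 1)) :
    (∀ τ ∈ Finset.Icc s t, fs τ ≤ g τ) ∧
      ∑ τ ∈ Finset.Icc s t, (g τ - R τ) ≤ h * c * √((t - s + 1 : ℕ) : ℝ) := by
  classical
  have hc := H.c_pos
  have htT : t ∈ Finset.Icc 1 T := Finset.mem_Icc.2 ⟨hs.trans hst, ht⟩
  have hst' := H.start_mem htT
  rw [Finset.mem_Icc] at hst'
  have hbs : (M t).start ≤ s := by rw [← hB]; exact (H.blockSeq.bounds hs).1
  have hM : ∀ τ ∈ Finset.Icc s t, M τ = M t := fun τ hτ => by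
    rw [Finset.mem_Icc] at hτ
    exact H.blockSeq.eq_of_le_of_le hs hτ.1 hτ.2 hB
  set B := M t with hBdef
  -- The window is partitioned according to the order and the start of the active instance. Each
  -- fibre is the set of active rounds of one instance, to which the base guarantee applies.
  set key : ℕ → ℕ × ℕ := fun τ => (B.activeOrder (sqrtRate c) U τ,
    B.instStart (B.activeOrder (sqrtRate c) U τ) τ) with hkey
  have hsched : ∀ τ ∈ Finset.Icc s t, B.Scheduled (sqrtRate c) U (key τ).1 (key τ).2 := by
    intro τ hτ
    have hτT : τ ∈ Finset.Icc 1 T := by rw [Finset.mem_Icc] at hτ ⊢; omega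
    have := H.scheduled_active hτT
    rwa [hM τ hτ] at this
  set S : Finset (ℕ × ℕ) := (Finset.range (B.order + 1) ×ˢ Finset.Icc s t).filter fun p =>
    B.Scheduled (sqrtRate c) U p.1 p.2 with hS
  have hmaps : ∀ τ ∈ Finset.Icc s t, key τ ∈ S := by
    intro τ hτ
    have h1 := hsched τ hτ
    have h2 := hstart τ hτ
    have h3 : (key τ).2 ≤ τ := Block.instStart_le (by rw [Finset.mem_Icc] at hτ; omega)
    rw [hS, Finset.mem_filter, Finset.mem_product, Finset.mem_range, Finset.mem_Icc]
    rw [Finset.mem_Icc] at hτ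
    exact ⟨⟨Nat.lt_succ_of_le h1.1, h2, h3.trans hτ.2⟩, h1⟩
  have hfiber : ∀ p ∈ S, (Finset.Icc s t).filter (fun τ => key τ = p) =
      instRounds (sqrtRate c) U M B p.1 p.2 t := by
    rintro ⟨m, s'⟩ hp
    rw [hS, Finset.mem_filter, Finset.mem_product, Finset.mem_Icc] at hp
    ext τ
    simp only [instRounds, Finset.mem_filter, hkey, Prod.mk.injEq]
    constructor
    · rintro ⟨hτ, h1, h2⟩
      have h3 := hM τ hτ
      rw [h1] at h2
      have h4 : B.instStart m τ ≤ τ := Block.instStart_le (by rw [Finset.mem_Icc] at hτ; omega)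
      rw [Finset.mem_Icc] at hτ ⊢
      exact ⟨by omega, h3, by omega, h1, h2⟩
    · rintro ⟨hτ, h1, h2, h3, h4⟩
      rw [Finset.mem_Icc] at hτ ⊢
      simp only at hp
      exact ⟨by omega, h3, by rw [h3]; exact h4⟩
  have hguar : ∀ p ∈ S, (∀ τ ∈ instRounds (sqrtRate c) U M B p.1 p.2 t, fs τ ≤ g τ) ∧
      ∑ τ ∈ instRounds (sqrtRate c) U M B p.1 p.2 t, (g τ - F τ) ≤
        c / 4 * √((instRounds (sqrtRate c) U M B p.1 p.2 t).card : ℝ) := by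
    rintro ⟨m, s'⟩ hp
    rw [hS, Finset.mem_filter, Finset.mem_product, Finset.mem_Icc, Finset.mem_range] at hp
    simp only at hp
    refine H.instance_guarantee B m s' t (by omega) hp.1.2.2 ht (H.order_lt htT)
      (by omega) hst'.1 hst'.2 ?_
    -- The instance starts inside the window, so the drift since its start is at most that of the
    -- window, while its own threshold is only larger.
    refine (drift_mono H.drift_nonneg hp.1.2.1 le_rfl).trans (hdrift.trans ?_)
    exact sqrtRate_antitone hc.le (by simp) (by simp) (by omega)
  refine ⟨fun τ hτ => (hguar _ (hmaps τ hτ)).1 τ ?_, ?_⟩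
  · rw [← hfiber _ (hmaps τ hτ)]
    exact Finset.mem_filter.2 ⟨hτ, rfl⟩
  have hsum : ∑ τ ∈ Finset.Icc s t, (g τ - F τ) ≤
      (B.order + 1 : ℝ) * (c / 4 * ((4 + Lg) * √((t - s + 1 : ℕ) : ℝ))) := by
    rw [← Finset.sum_fiberwise_of_maps_to hmaps]
    calc ∑ p ∈ S, ∑ τ ∈ (Finset.Icc s t).filter (fun τ => key τ = p), (g τ - F τ)
        ≤ ∑ p ∈ S, c / 4 * √(min (2 ^ p.1) ((t - s + 1 : ℕ) : ℝ)) := by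
          refine Finset.sum_le_sum fun p hp => ?_
          rw [hfiber p hp]
          refine (hguar p hp).2.trans ?_
          gcongr
          refine le_min ?_ ?_
          · have : (instRounds (sqrtRate c) U M B p.1 p.2 t).card ≤ 2 ^ p.1 := by
              have hsub : instRounds (sqrtRate c) U M B p.1 p.2 t ⊆
                  Finset.Ico p.2 (p.2 + 2 ^ p.1) := by
                intro τ hτ
                simp only [instRounds, Finset.mem_filter] at hτ
                rw [Finset.mem_Ico]
                refine ⟨hτ.2.2.1, ?_⟩
                have := Block.lt_instStart_add (B := B) (m := p.1) (t := τ)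
                rwa [hτ.2.2.2.2] at this
              refine (Finset.card_le_card hsub).trans (by simp)
            exact_mod_cast this
          · have : (instRounds (sqrtRate c) U M B p.1 p.2 t).card ≤ t - s + 1 := by
              rw [← hfiber p hp]
              refine (Finset.card_filter_le _ _).trans ?_
              simp; omega
            exact_mod_cast this
      _ = ∑ m ∈ Finset.range (B.order + 1), c / 4 *
            ((((Finset.Icc s t).filter fun τ => B.Scheduled (sqrtRate c) U m τ).card : ℝ) *
              √(min (2 ^ m) ((t - s + 1 : ℕ) : ℝ))) := by
          rw [hS, Finset.sum_filter, Finset.sum_product]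
          refine Finset.sum_congr rfl fun m _ => ?_
          dsimp only
          rw [← Finset.sum_filter, Finset.sum_const, nsmul_eq_mul]
          ring
      _ ≤ ∑ m ∈ Finset.range (B.order + 1), c / 4 * ((4 + Lg) * √((t - s + 1 : ℕ) : ℝ)) := by
          refine Finset.sum_le_sum fun m hm => ?_
          rw [Finset.mem_range] at hm
          exact mul_le_mul_of_nonneg_left
            (H.instance_sum_le hs hst ht hB (by rw [← hBdef]; omega)) (by positivity)
      _ = _ := by rw [Finset.sum_const, Finset.card_range, nsmul_eq_mul]; push_cast; ring
  have hdev := (abs_le.1 (H.deviation s t hs hst ht)).1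
  have e : ∑ τ ∈ Finset.Icc s t, (g τ - R τ) =
      ∑ τ ∈ Finset.Icc s t, (g τ - F τ) - ∑ τ ∈ Finset.Icc s t, (R τ - F τ) := by
    rw [← Finset.sum_sub_distrib]; exact Finset.sum_congr rfl fun _ _ => by ring
  have hord : (B.order : ℝ) ≤ Nat.log 2 T := by exact_mod_cast H.order_le htT
  have hL := H.Lg_nonneg
  have hh := H.h_large
  set W := √((t - s + 1 : ℕ) : ℝ)
  have hW : 0 ≤ W := Real.sqrt_nonneg _
  -- The sum over the orders together with the deviation of the rewards is at most `h c √w`; the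
  -- size of the test factor `h` was required for this.
  have h6 : (B.order + 1 : ℝ) * (4 + Lg) + 1 ≤ 4 * h := by
    refine le_trans ?_ hh
    gcongr
  rw [e]
  have h7 := mul_le_mul_of_nonneg_right h6 (mul_nonneg (by positivity : 0 ≤ c / 4) hW)
  linarith

/-- A restart happens only if the block meets two nearly stationary pieces. -/
theorem no_false_alarm {t : ℕ} (ht : t ∈ Finset.Icc 1 T)
    (hfail : (M t).Test1Fails (sqrtRate c) (sqrtRate (h * c)) U g R t ∨
      (M t).Test2Fails (sqrtRate (h * c)) g R t) :
    (M t).start < pieceStart (sqrtRate c) Δ t := by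
  by_contra! hle
  have hc := H.c_pos
  have hh := H.one_le_h
  have ht' := Finset.mem_Icc.1 ht
  have hb := H.blockSeq.bounds ht'.1
  have hb1 := H.blockSeq.one_le_start ht'.1
  have hBs : M (M t).start = M t := H.blockSeq.eq_of_start_le ht'.1 le_rfl hb.1
  have hdr := drift_le_of_pieceStart_le H.drift_nonneg (sqrtRate_nonneg hc.le 1)
    (sqrtRate_antitone hc.le) hb1 hle hb.1
  -- If the piece of `t` began no later than the block, the whole block so far is a nearly
  -- stationary window, and no instance of the block starts before it.
  obtain ⟨hopt, hsum⟩ := H.window hb1 hb.1 ht'.2 hBs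
    (fun _ _ => Nat.le_add_right _ _) hdr
  set b := (M t).start with hbdef
  rcases hfail with ⟨m, s, hsch, hst, htest⟩ | htest
  · have hsb : b ≤ s := hsch.2.1
    have h2m := Nat.two_pow_pos m
    have hsle : s ≤ t := by omega
    have hm : ((t - s + 1 : ℕ) : ℝ) = 2 ^ m := by
      have : t - s + 1 = 2 ^ m := by omega
      rw [this]; push_cast; rfl
    have hdev := (abs_le.1 (H.deviation s t (by omega) hsle ht'.2)).2
    rw [hm] at hdev
    have hρ : drift Δ b t ≤ sqrtRate c (2 ^ m) := by
      refine hdr.trans (sqrtRate_antitone hc.le ?_ ?_ ?_)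
      · exact Nat.one_le_two_pow
      · simp
      · omega
    -- Every scalar of the block exceeds the average reward of the instance minus `2 ρ`: one `ρ` for
    -- the drift and less than one for the deviation. The first test would need an excess of `9 h
    -- ρ`.
    have hlow : ∀ σ ∈ Finset.Icc b t, (1 / (2 : ℝ) ^ m) * ∑ τ ∈ Finset.Icc s t, R τ -
        2 * sqrtRate c (2 ^ m) ≤ g σ := by
      intro σ hσ
      have hσ' := Finset.mem_Icc.1 hσ
      have hF : ∀ τ ∈ Finset.Icc s t, F τ ≤ g σ + sqrtRate c (2 ^ m) := by
        intro τ hτ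
        rw [Finset.mem_Icc] at hτ
        have h1 := H.mean_le τ (Finset.mem_Icc.2 ⟨by omega, by omega⟩)
        have h2 := hopt σ hσ
        have h3 : fs τ - fs σ ≤ drift Δ b t := by
          rcases le_total τ σ with h | h
          · exact ((le_abs_self _).trans (H.opt_le_add_drift (by omega) h (by omega))).trans
              (drift_mono H.drift_nonneg (by omega) (by omega))
          · have := H.opt_le_add_drift (by omega) h (by omega)
            rw [abs_sub_comm] at this
            exact ((le_abs_self _).trans this).trans
              (drift_mono H.drift_nonneg (by omega) (by omega))
        linarith
      have hFs := Finset.sum_le_card_nsmul _ _ _ hF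
      rw [Nat.card_Icc, nsmul_eq_mul, show t + 1 - s = t - s + 1 by omega, hm] at hFs
      rw [Finset.sum_sub_distrib] at hdev
      have e : c / 4 * √(2 ^ m : ℝ) = sqrtRate c (2 ^ m) / 4 * 2 ^ m := by
        have := sqrtRate_mul_self c (2 ^ m)
        push_cast at this
        linarith
      have hpos := H.rate_pos m
      have h4 : ∑ τ ∈ Finset.Icc s t, R τ ≤ 2 ^ m * (g σ + 2 * sqrtRate c (2 ^ m)) := by
        rw [e] at hdev
        have : (0 : ℝ) < 2 ^ m := by positivity
        nlinarith [mul_pos this hpos]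
      rw [sub_le_iff_le_add, one_div, inv_mul_le_iff₀ (by positivity)]
      exact h4
    have hinf : (1 / (2 : ℝ) ^ m) * ∑ τ ∈ Finset.Icc s t, R τ - 2 * sqrtRate c (2 ^ m) ≤
        sInf (g '' Set.Icc b t) := by
      refine le_csInf ⟨g t, t, ⟨hb.1, le_rfl⟩, rfl⟩ ?_
      rintro _ ⟨σ, hσ, rfl⟩
      exact hlow σ (Finset.mem_Icc.2 hσ)
    have e2 : sqrtRate (h * c) (2 ^ m) = h * sqrtRate c (2 ^ m) := by
      rw [sqrtRate, sqrtRate]; ring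
    rw [e2] at htest
    have hpos := H.rate_pos m
    nlinarith
  · rw [Block.Test2Fails, ← hbdef] at htest
    set w := t - b + 1
    have hw0 : (0 : ℝ) < (w : ℝ) := by exact_mod_cast Nat.succ_pos _
    rw [one_div, le_inv_mul_iff₀ hw0] at htest
    have e := sqrtRate_mul_self (h * c) w
    have h1 : (w : ℝ) * (3 * sqrtRate (h * c) w) = 3 * (h * c * √(w : ℝ)) := by rw [← e]; ring
    rw [h1] at htest
    have : 0 < h * c * √(w : ℝ) := by positivity
    linarith

/-- An instance scheduled in a candidate round makes the first test fail when it ends. -/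
theorem not_scheduled_of_isCandidate {m s : ℕ} (hs : 1 ≤ s) (ht : s + 2 ^ m ≤ T)
    (hM : M (s + 2 ^ m) = M s)
    (hcand : IsCandidate (sqrtRate c) (sqrtRate (h * c)) Δ fs g (M s) m s) :
    ¬ (M s).Scheduled (sqrtRate c) U m s := by
  intro hsch
  obtain ⟨hdvd, hps, τ', hτb, hτp, hτs, hgap⟩ := hcand
  have hc := H.c_pos
  have hh := H.one_le_h
  have h2m := Nat.two_pow_pos m
  set t := s + 2 ^ m - 1 with htdef
  have ht1 : t + 1 = s + 2 ^ m := by omega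
  have hst : s ≤ t := by omega
  have hMt : M t = M s := (H.blockSeq.eq_of_le_of_le hs hst (by omega) hM.symm).trans hM
  have hwin : t - s + 1 = 2 ^ m := by omega
  have hb := H.blockSeq.bounds hs
  have hps' := pieceStart_bounds (ρ := sqrtRate c) (Δ := Δ) (sqrtRate_nonneg hc.le 1) hs
  have hb1 := H.blockSeq.one_le_start hs
  have hdr := drift_le_of_pieceStart_le (t := t) H.drift_nonneg (sqrtRate_nonneg hc.le 1)
    (sqrtRate_antitone hc.le) hs (hps ▸ hps'.2.1) hst
  have hdr' := drift_le_of_pieceStart_le (t := t) (s := τ') H.drift_nonneg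
    (sqrtRate_nonneg hc.le 1) (sqrtRate_antitone hc.le) (by omega) (hps ▸ hτp) (by omega)
  have hdr'' : drift Δ τ' t ≤ sqrtRate c (2 ^ m) :=
    hdr'.trans (sqrtRate_antitone hc.le Nat.one_le_two_pow (by simp) (by omega))
  -- As the scheduled instance covers `[s, t]`, the active instances there have order at most `m`
  -- and hence start inside the window. This is the condition under which the window bound is
  -- available away from the start of a block.
  obtain ⟨hopt, hsum⟩ := H.window hs hst (by omega) hMt.symm (fun τ hτ => by
    rw [Finset.mem_Icc] at hτ
    rw [hMt]
    exact Block.le_instStart hb.1 hdvd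
      (Block.activeOrder_le hsch hτ.1 (by omega)) hτ.1) hdr
  rw [hwin] at hsum
  have hpos := H.rate_pos m
  have e2 : sqrtRate (h * c) (2 ^ m) = h * sqrtRate c (2 ^ m) := by
    rw [sqrtRate, sqrtRate]; ring
  have e3 := sqrtRate_mul_self (h * c) (2 ^ m)
  rw [← e3, e2] at hsum
  have hg : ∀ τ ∈ Finset.Icc s t, fs τ' - sqrtRate c (2 ^ m) ≤ g τ := by
    intro τ hτ
    have h1 := hopt τ hτ
    rw [Finset.mem_Icc] at hτ
    have h2 := (le_abs_self _).trans
      (H.opt_le_add_drift (by omega : 1 ≤ τ') (by omega : τ' ≤ τ) (by omega))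
    have h3 := drift_mono H.drift_nonneg (le_refl τ') hτ.2
    linarith
  have hgs := Finset.card_nsmul_le_sum _ _ _ hg
  rw [Nat.card_Icc, nsmul_eq_mul, show t + 1 - s = 2 ^ m by omega] at hgs
  rw [Finset.sum_sub_distrib] at hsum
  push_cast at hsum hgs
  refine H.blockSeq.not_fail (by omega : 1 ≤ t) (Nat.lt_succ_self t)
    (by rw [Nat.succ_eq_add_one, ht1, hM, hMt]) (Or.inl ?_)
  rw [hMt]
  refine ⟨m, s, hsch, ht1.symm, ?_⟩
  have hinf : sInf (g '' Set.Icc (M s).start t) ≤ g τ' :=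
    csInf_le ((Set.finite_Icc _ _).image _).bddBelow ⟨τ', ⟨hτb, by omega⟩, rfl⟩
  rw [e2] at hgap ⊢
  rw [one_div, le_inv_mul_iff₀ (by positivity)]
  have hpw : (0 : ℝ) < 2 ^ m := by positivity
  -- The gap of `12 h ρ` loses `ρ` to the drift since `τ'` and `h ρ` to the regret on the window,
  -- and more than `9 h ρ` is left. So the first test fails, although the block goes on.
  have h5 : sInf (g '' Set.Icc (M s).start t) + 9 * (h * sqrtRate c (2 ^ m)) ≤
      fs τ' - sqrtRate c (2 ^ m) - h * sqrtRate c (2 ^ m) := by nlinarith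
  have h6 := mul_le_mul_of_nonneg_left h5 hpw.le
  linarith

end GoodPath

end GoodPath


/-! ### Regret of MASTER along a good path -/

section PathRegret

-- Successive thresholds differ by a factor at most `2`. If `m` is the first scale whose threshold
-- is below `x`, then `x` is at most twice that threshold; at scale `0` this uses `x ≤ 1 ≤ C`. If
-- there is no such scale, the first term suffices.
open Classical in
lemma le_sum_dyadic {C x : ℝ} (hC : 1 ≤ C) (hx : x ≤ 1) (n : ℕ) :
    x ≤ 12 * sqrtRate C (2 ^ n) + ∑ m ∈ Finset.range (n + 1),
      if 12 * sqrtRate C (2 ^ m) ≤ x then 24 * sqrtRate C (2 ^ m) else 0 := by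
  have hpos : ∀ m, 0 ≤ sqrtRate C (2 ^ m) := fun m => sqrtRate_nonneg (by linarith) _
  induction n with
  | zero =>
    have h1 : sqrtRate C (2 ^ 0) = C := by simp [sqrtRate]
    rw [zero_add, Finset.sum_range_one, h1]
    split_ifs <;> linarith
  | succ n ih =>
    rw [Finset.sum_range_succ]
    by_cases h : 12 * sqrtRate C (2 ^ (n + 1)) ≤ x
    · rw [if_pos h]
      have h2 : sqrtRate C (2 ^ n) ≤ 2 * sqrtRate C (2 ^ (n + 1)) := by
        rw [sqrtRate, sqrtRate, ← mul_div_assoc, div_le_div_iff₀ (by positivity) (by positivity)]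
        have : √((2 ^ (n + 1) : ℕ) : ℝ) ≤ 2 * √((2 ^ n : ℕ) : ℝ) := by
          apply Real.sqrt_le_iff.2 ⟨by positivity, ?_⟩
          rw [mul_pow, Real.sq_sqrt (by positivity)]
          push_cast
          rw [pow_succ]
          have : (0:ℝ) < 2 ^ n := by positivity
          linarith
        nlinarith
      linarith [hpos (n + 1)]
    · have h3 : 0 ≤ ∑ m ∈ Finset.range (n + 1),
          if 12 * sqrtRate C (2 ^ m) ≤ x then 24 * sqrtRate C (2 ^ m) else 0 :=
        Finset.sum_nonneg fun m _ => by split_ifs <;> linarith [hpos m]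
      rw [if_neg h]; linarith

lemma sum_sqrt_le {ι : Type*} (s : Finset ι) (x : ι → ℝ) (hx : ∀ i ∈ s, 0 ≤ x i) {X : ℝ}
    (hX : ∑ i ∈ s, x i ≤ X) : ∑ i ∈ s, √(x i) ≤ √(s.card * X) := by
  refine Real.le_sqrt_of_sq_le (sq_sum_le_card_mul_sum_sq.trans ?_)
  gcongr
  refine le_trans (Finset.sum_le_sum fun i hi => ?_) hX
  rw [Real.sq_sqrt (hx i hi)]

namespace GoodPath

variable {T : ℕ} {c h Lg : ℝ} {Δ fs F g R : ℕ → ℝ} {U : ℕ → ℕ → ℝ} {M : ℕ → Block}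
  (H : GoodPath T c h Lg Δ fs F g R U M)
include H

lemma one_le_hc : 1 ≤ h * c := one_le_mul_of_one_le_of_one_le H.one_le_h H.one_le_c

lemma start_eq {t : ℕ} (ht : t ∈ Finset.Icc 1 T) : M (M t).start = M t :=
  H.blockSeq.eq_of_start_le (Finset.mem_Icc.1 ht).1 le_rfl
    (H.blockSeq.bounds (Finset.mem_Icc.1 ht).1).1

/-- Between restarts the orders increase by one, so there are at most `log₂ T + 1` blocks. A restart
needs a piece that starts strictly inside the block, so the piece count at block starts increases
with each restart. The current order measures the part of the allowance already spent. -/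
lemma card_starts_le {t : ℕ} (h1 : 1 ≤ t) (hT : t ≤ T) :
    ((Finset.Icc 1 t).filter fun b => (M b).start = b).card + (Nat.log 2 T + 1) ≤
      (Nat.log 2 T + 1) * pieceCount (sqrtRate c) Δ (M t).start + (M t).order + 1 := by
  induction t, h1 using Nat.le_induction with
  | base => simp [H.blockSeq.first, pieceCount_one, Finset.filter_singleton]; omega
  | succ t ht ih =>
    have ih := ih (by omega)
    have htT : t ∈ Finset.Icc 1 T := Finset.mem_Icc.2 ⟨ht, by omega⟩
    have hord := H.order_le htT
    have hbd := H.blockSeq.bounds ht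
    rw [Finset.card_filter] at ih ⊢
    rw [Finset.sum_Icc_succ_top (by omega)]
    rcases H.blockSeq.succ_cases ht with ⟨hf, h⟩ | ⟨-, h2, h⟩ | ⟨-, -, h⟩ <;> rw [h]
    · have hps := H.no_false_alarm htT hf
      have hps2 := pieceStart_bounds (ρ := sqrtRate c) (Δ := Δ)
        (sqrtRate_nonneg H.c_pos.le 1) ht
      have hlt : pieceCount (sqrtRate c) Δ (M t).start < pieceCount (sqrtRate c) Δ (t + 1) := by
        refine Finset.card_lt_card ((Finset.ssubset_iff_of_subset ?_).2
          ⟨pieceStart (sqrtRate c) Δ t, ?_, ?_⟩)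
        · exact Finset.filter_subset_filter _ (Finset.Icc_subset_Icc_right (by omega))
        · simp only [Finset.mem_filter, Finset.mem_Icc]
          exact ⟨by omega, pieceStart_eq_of_le ht le_rfl hps2.2.1⟩
        · simp only [Finset.mem_filter, Finset.mem_Icc]; omega
      have := Nat.mul_le_mul_left (Nat.log 2 T + 1) (Nat.succ_le_of_lt hlt)
      rw [Nat.mul_succ] at this
      simp only [if_true]
      omega
    · have := Nat.mul_le_mul_left (Nat.log 2 T + 1)
        (pieceCount_mono (ρ := sqrtRate c) (Δ := Δ) (by omega : (M t).start ≤ t + 1))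
      simp only [if_true]
      omega
    · rw [if_neg (by omega)]; simpa using ih

lemma card_starts_le_mul (hT : 1 ≤ T) :
    ((Finset.Icc 1 T).filter fun b => (M b).start = b).card ≤
      (Nat.log 2 T + 1) * pieceCount (sqrtRate c) Δ T := by
  have h1 := H.card_starts_le hT le_rfl
  have h2 := H.order_le (Finset.mem_Icc.2 ⟨hT, le_rfl⟩)
  have h3 := Nat.mul_le_mul_left (Nat.log 2 T + 1)
    (pieceCount_mono (ρ := sqrtRate c) (Δ := Δ) (H.blockSeq.bounds hT).1)
  omega

lemma sum_sqrt_pow_order_le (hT : 1 ≤ T) :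
    ∑ b ∈ (Finset.Icc 1 T).filter (fun b => (M b).start = b), √((2 : ℝ) ^ (M b).order) ≤
      √(((Finset.Icc 1 T).filter fun b => (M b).start = b).card * (2 * T)) := by
  refine sum_sqrt_le _ _ (fun b _ => by positivity) ((H.blockSeq.sum_pow_order_le hT).trans ?_)
  have : ((M T).start : ℝ) ≤ T := by exact_mod_cast (H.blockSeq.bounds hT).1
  linarith

/-- Bounds for the blocks add up. -/
lemma sum_le_of_block_le {φ : ℕ → ℝ} {C : ℝ}
    (hφ : ∀ b ∈ (Finset.Icc 1 T).filter (fun b => (M b).start = b),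
      ∑ τ ∈ (Finset.Icc 1 T).filter (fun τ => (M τ).start = b), φ τ ≤
        C * √((2 : ℝ) ^ (M b).order)) :
    ∑ τ ∈ Finset.Icc 1 T, φ τ ≤
      C * ∑ b ∈ (Finset.Icc 1 T).filter (fun b => (M b).start = b),
        √((2 : ℝ) ^ (M b).order) := by
  have hmaps : ∀ τ ∈ Finset.Icc 1 T,
      (M τ).start ∈ (Finset.Icc 1 T).filter (fun b => (M b).start = b) := fun τ hτ =>
    Finset.mem_filter.2 ⟨H.start_mem hτ, by rw [H.start_eq hτ]⟩
  rw [← Finset.sum_fiberwise_of_maps_to hmaps, Finset.mul_sum]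
  exact Finset.sum_le_sum hφ

lemma eq_of_mem_fiber {b τ : ℕ} (hτ : τ ∈ (Finset.Icc 1 T).filter fun τ => (M τ).start = b) :
    M τ = M b := by
  rw [Finset.mem_filter] at hτ
  rw [← hτ.2, H.start_eq hτ.1]

lemma card_fiber_le (b : ℕ) :
    (((Finset.Icc 1 T).filter fun τ => (M τ).start = b).card : ℝ) ≤ 2 ^ (M b).order := by
  have hsub : ((Finset.Icc 1 T).filter fun τ => (M τ).start = b) ⊆
      Finset.Ico b (b + 2 ^ (M b).order) := by
    intro τ hτ
    have h1 := H.eq_of_mem_fiber hτ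
    rw [Finset.mem_filter, Finset.mem_Icc] at hτ
    have h2 := H.blockSeq.bounds hτ.1.1
    rw [Finset.mem_Ico]
    rw [hτ.2, h1] at h2
    exact ⟨h2.1, h2.2.1⟩
  have := Finset.card_le_card hsub
  rw [Nat.card_Ico, Nat.add_sub_cancel_left] at this
  exact_mod_cast this

/-- As long as the second test passes, the rewards of a block are close to its scalars. -/
lemma block_scalar_regret_le {b : ℕ}
    (hb : b ∈ (Finset.Icc 1 T).filter fun b => (M b).start = b) :
    ∑ τ ∈ (Finset.Icc 1 T).filter (fun τ => (M τ).start = b), (g τ - R τ) ≤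
      4 * (h * c) * √((2 : ℝ) ^ (M b).order) := by
  classical
  set Q := (Finset.Icc 1 T).filter fun τ => (M τ).start = b with hQ
  have hbQ : b ∈ Q := by
    rw [Finset.mem_filter] at hb
    rw [hQ, Finset.mem_filter]
    exact hb
  have hne : Q.Nonempty := ⟨b, hbQ⟩
  obtain ⟨E, hEQ, hEmax⟩ : ∃ E ∈ Q, ∀ τ ∈ Q, τ ≤ E :=
    ⟨Q.max' hne, Q.max'_mem hne, fun τ hτ => Q.le_max' τ hτ⟩
  have hME := H.eq_of_mem_fiber hEQ
  have hET := (Finset.mem_filter.1 hEQ).1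
  have hET' := Finset.mem_Icc.1 hET
  have hEb := (Finset.mem_filter.1 hEQ).2
  have hbd := H.blockSeq.bounds hET'.1
  rw [hEb] at hbd
  have hb1 : 1 ≤ b := (Finset.mem_Icc.1 (Finset.mem_filter.1 hb).1).1
  have hQE : Q = Finset.Icc b E := by
    ext τ
    rw [Finset.mem_Icc]
    constructor
    · intro hτ
      refine ⟨?_, hEmax τ hτ⟩
      rw [hQ, Finset.mem_filter, Finset.mem_Icc] at hτ
      have := (H.blockSeq.bounds hτ.1.1).1
      omega
    · rintro ⟨h1, h2⟩
      rw [hQ, Finset.mem_filter, Finset.mem_Icc]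
      refine ⟨⟨by omega, by omega⟩, ?_⟩
      rw [H.blockSeq.eq_of_start_le hET'.1 (by rw [hEb]; exact h1) h2, hEb]
  -- The test at the last round of a block may have failed, so the passed test is used only up to
  -- the round before it, and the last round is bounded trivially.
  have hlast : g E - R E ≤ 1 := by
    have := (H.scalar_mem E hET).2
    have := H.reward_nonneg E hET
    linarith
  have hhc := H.one_le_hc
  have h1n : 1 ≤ √((2 : ℝ) ^ (M b).order) :=
    Real.one_le_sqrt.2 (one_le_pow₀ (by norm_num))
  rw [hQE]
  rcases hbd.1.eq_or_lt with h0 | h0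
  · subst h0
    rw [Finset.Icc_self, Finset.sum_singleton]
    nlinarith
  · have hE1 : E - 1 + 1 = E := by omega
    have hsplit : Finset.Icc b E = insert E (Finset.Icc b (E - 1)) := by
      ext τ; simp only [Finset.mem_insert, Finset.mem_Icc]; omega
    have hMprev : M (E - 1) = M E :=
      H.blockSeq.eq_of_start_le hET'.1 (by rw [hEb]; omega) (by omega)
    have hnf := H.blockSeq.not_fail (by omega : 1 ≤ E - 1) (by omega : E - 1 < E) hMprev
    rw [not_or] at hnf
    have ht2 := hnf.2
    rw [Block.Test2Fails, hMprev, hEb, not_le] at ht2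
    have hw : E - 1 - b + 1 = E - b := by omega
    rw [hw] at ht2
    have hw0 : (0 : ℝ) < ((E - b : ℕ) : ℝ) := by exact_mod_cast (by omega : 0 < E - b)
    rw [one_div, inv_mul_lt_iff₀ hw0] at ht2
    have e := sqrtRate_mul_self (h * c) (E - b)
    have hle : √((E - b : ℕ) : ℝ) ≤ √((2 : ℝ) ^ (M b).order) := by
      apply Real.sqrt_le_sqrt
      rw [hME] at hbd
      have : E - b ≤ 2 ^ (M b).order := by omega
      exact_mod_cast this
    rw [hsplit, Finset.sum_insert (by simp; omega)]
    have h3 : h * c * √((E - b : ℕ) : ℝ) ≤ h * c * √((2 : ℝ) ^ (M b).order) := by gcongr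
    nlinarith

open Classical in
/-- In every block there are few candidates of each order. -/
lemma card_candidates_le {b m : ℕ} (hb : b ∈ (Finset.Icc 1 T).filter fun b => (M b).start = b)
    (hm : m ≤ (M b).order) :
    √((2 : ℝ) ^ m) * ((Finset.Icc 1 T).filter fun τ =>
      M τ = M b ∧ IsCandidate (sqrtRate c) (sqrtRate (h * c)) Δ fs g (M b) m τ).card ≤
        2 * (1 + Lg) * √((2 : ℝ) ^ (M b).order) := by
  obtain ⟨hbT, hbb⟩ := Finset.mem_filter.1 hb
  have hbT' := Finset.mem_Icc.1 hbT
  have h1 := H.coins_lower (M b) m (H.order_lt hbT) hm (by rw [hbb]; exact hbT'.1)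
    (by rw [hbb]; exact hbT'.2)
  -- Two candidates of the same order are at least `2 ^ m` rounds apart. If both coins had
  -- succeeded, the instance of the earlier one would have been completed inside the block and would
  -- have ended it.
  have h2 : ((Finset.Icc 1 T).filter fun τ => (M τ = M b ∧
      IsCandidate (sqrtRate c) (sqrtRate (h * c)) Δ fs g (M b) m τ) ∧
        (M b).Scheduled (sqrtRate c) U m τ).card ≤ 1 := by
    rw [Finset.card_le_one]
    have key : ∀ s s', s < s' → s ∈ Finset.Icc 1 T → s' ∈ Finset.Icc 1 T → M s = M b →
        M s' = M b → IsCandidate (sqrtRate c) (sqrtRate (h * c)) Δ fs g (M b) m s →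
        IsCandidate (sqrtRate c) (sqrtRate (h * c)) Δ fs g (M b) m s' →
        ¬ (M b).Scheduled (sqrtRate c) U m s := by
      intro s s' hlt hs hs' hMs hMs' hc hc'
      rw [Finset.mem_Icc] at hs hs'
      have hb1 := (H.blockSeq.bounds hs.1).1
      rw [hMs] at hb1
      have hstep : s + 2 ^ m ≤ s' := by
        have := Nat.le_of_dvd (by omega) (Nat.dvd_sub hc'.1 hc.1)
        omega
      have hM2 : M (s + 2 ^ m) = M s := by
        rw [H.blockSeq.eq_of_le_of_le hs.1 (Nat.le_add_right _ _) hstep (hMs.trans hMs'.symm),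
          hMs', hMs]
      have := H.not_scheduled_of_isCandidate hs.1 (by omega) hM2 (by rw [hMs]; exact hc)
      rwa [hMs] at this
    intro s hs s' hs'
    rw [Finset.mem_filter] at hs hs'
    by_contra hne
    rcases lt_or_gt_of_ne hne with hlt | hlt
    · exact key s s' hlt hs.1 hs'.1 hs.2.1.1 hs'.2.1.1 hs.2.1.2 hs'.2.1.2 hs.2.2
    · exact key s' s hlt hs'.1 hs.1 hs'.2.1.1 hs.2.1.1 hs'.2.1.2 hs.2.1.2 hs'.2.2
  have h3 : (((Finset.Icc 1 T).filter fun τ => (M τ = M b ∧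
      IsCandidate (sqrtRate c) (sqrtRate (h * c)) Δ fs g (M b) m τ) ∧
        (M b).Scheduled (sqrtRate c) U m τ).card : ℝ) ≤ 1 := by exact_mod_cast h2
  rw [sqrtRate_ratio H.c_pos] at h1
  set N := (((Finset.Icc 1 T).filter fun τ =>
      M τ = M b ∧ IsCandidate (sqrtRate c) (sqrtRate (h * c)) Δ fs g (M b) m τ).card : ℝ)
  have hy : 0 < √((2 : ℝ) ^ (M b).order) := by positivity
  have h4 : √((2 : ℝ) ^ m) / √((2 : ℝ) ^ (M b).order) / 2 * N ≤ 1 + Lg := h1.trans (by linarith)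
  have e : √((2 : ℝ) ^ m) / √((2 : ℝ) ^ (M b).order) / 2 * N =
      √((2 : ℝ) ^ m) * N / (2 * √((2 : ℝ) ^ (M b).order)) := by field_simp
  rw [e, div_le_iff₀ (by positivity)] at h4
  linarith

open Classical in
/-- Rounds with a large gap inside one piece of one block are followed by candidates. -/
lemma card_gap_le {τ₁ : ℕ} (m : ℕ) :
    (((Finset.Icc 1 T).filter fun τ => (M τ = M τ₁ ∧
      pieceStart (sqrtRate c) Δ τ = pieceStart (sqrtRate c) Δ τ₁) ∧
        g τ + 12 * sqrtRate (h * c) (2 ^ m) ≤ fs τ).card : ℝ) ≤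
    2 ^ m * (((Finset.Icc 1 T).filter fun τ => (M τ = M τ₁ ∧
      pieceStart (sqrtRate c) Δ τ = pieceStart (sqrtRate c) Δ τ₁) ∧
        IsCandidate (sqrtRate c) (sqrtRate (h * c)) Δ fs g (M τ) m τ).card + 2) := by
  set G := (Finset.Icc 1 T).filter fun τ => (M τ = M τ₁ ∧
      pieceStart (sqrtRate c) Δ τ = pieceStart (sqrtRate c) Δ τ₁) ∧
        g τ + 12 * sqrtRate (h * c) (2 ^ m) ≤ fs τ with hG
  set K := (Finset.Icc 1 T).filter fun τ => (M τ = M τ₁ ∧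
      pieceStart (sqrtRate c) Δ τ = pieceStart (sqrtRate c) Δ τ₁) ∧
        IsCandidate (sqrtRate c) (sqrtRate (h * c)) Δ fs g (M τ) m τ with hK
  rcases G.eq_empty_or_nonempty with h0 | hne
  · rw [h0]; simp; positivity
  obtain ⟨x, hxG, hxmin⟩ : ∃ x ∈ G, ∀ τ ∈ G, x ≤ τ :=
    ⟨G.min' hne, G.min'_mem hne, fun τ hτ => G.min'_le τ hτ⟩
  obtain ⟨y, hyG, hymax⟩ : ∃ y ∈ G, ∀ τ ∈ G, τ ≤ y :=
    ⟨G.max' hne, G.max'_mem hne, fun τ hτ => G.le_max' τ hτ⟩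
  have hxy : x ≤ y := hxmin y hyG
  have hcard : G.card ≤ y + 1 - x := by
    have : G ⊆ Finset.Icc x y := fun τ hτ => Finset.mem_Icc.2 ⟨hxmin τ hτ, hymax τ hτ⟩
    simpa using Finset.card_le_card this
  simp only [hG, Finset.mem_filter, Finset.mem_Icc] at hxG hyG
  have h2m := Nat.two_pow_pos m
  have hps := pieceStart_bounds (ρ := sqrtRate c) (Δ := Δ) (sqrtRate_nonneg H.c_pos.le 1) hxG.1.1
  have hbx := (H.blockSeq.bounds hxG.1.1).1
  have hMin : ∀ τ, x ≤ τ → τ ≤ y → M τ = M τ₁ ∧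
      pieceStart (sqrtRate c) Δ τ = pieceStart (sqrtRate c) Δ τ₁ := by
    intro τ h1 h2
    constructor
    · rw [H.blockSeq.eq_of_le_of_le hxG.1.1 h1 h2 (by rw [hxG.2.1.1, hyG.2.1.1]), hyG.2.1.1]
    · rw [pieceStart_eq_of_le hyG.1.1 (by rw [hyG.2.1.2, ← hxG.2.1.2]; omega) h2, hyG.2.1.2]
  -- Between the first gap round `x` and the last one `y`, every end point of the partition that
  -- lies after `x` and leaves room for `2 ^ m` rounds up to `y` is a candidate, with `x` as its
  -- witness. The two ends cost at most two further intervals.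
  have hsub : ((Finset.Icc (x + 1) (y + 1 - 2 ^ m)).filter fun s => 2 ^ m ∣ s - (M τ₁).start) ⊆
      K := by
    intro s hs
    rw [Finset.mem_filter, Finset.mem_Icc] at hs
    have hs1 := hMin s (by omega) (by omega)
    have hs2 := hMin (s + 2 ^ m - 1) (by omega) (by omega)
    simp only [hK, Finset.mem_filter, Finset.mem_Icc]
    refine ⟨⟨by omega, by omega⟩, hs1, ?_⟩
    rw [hs1.1]
    refine ⟨hs.2, by rw [hs2.2, hs1.2], x, ?_, ?_, by omega, hxG.2.2⟩
    · rw [← hxG.2.1.1]; exact hbx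
    · rw [hs1.2, ← hxG.2.1.2]; exact hps.2.1
  have hcount := le_card_filter_dvd (t := y + 1 - 2 ^ m) h2m (by omega : 1 ≤ x + 1)
    (show (M τ₁).start ≤ x + 1 by rw [← hxG.2.1.1]; omega)
  have hKc : ((((Finset.Icc (x + 1) (y + 1 - 2 ^ m)).filter fun s =>
      2 ^ m ∣ s - (M τ₁).start).card : ℕ) : ℝ) ≤ K.card := by
    exact_mod_cast Finset.card_le_card hsub
  have hy2 : (y : ℝ) + 1 - 2 ^ m ≤ ((y + 1 - 2 ^ m : ℕ) : ℝ) := by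
    have : y + 1 ≤ (y + 1 - 2 ^ m) + 2 ^ m := by omega
    have : (y : ℝ) + 1 ≤ ((y + 1 - 2 ^ m : ℕ) : ℝ) + 2 ^ m := by exact_mod_cast this
    linarith
  have hcard' : (G.card : ℝ) ≤ y + 1 - x := by
    have : G.card + x ≤ y + 1 := by omega
    have : (G.card : ℝ) + x ≤ y + 1 := by exact_mod_cast this
    linarith
  push_cast at hcount
  have : (2 : ℝ) ^ m * ((((Finset.Icc (x + 1) (y + 1 - 2 ^ m)).filter fun s =>
      2 ^ m ∣ s - (M τ₁).start).card : ℕ) : ℝ) ≤ 2 ^ m * K.card := by gcongr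
  linarith

open Classical in
/-- The pairs of a block and a piece that meet. -/
lemma card_block_pieces_le :
    ((Finset.Icc 1 T).image fun τ => (M τ, pieceStart (sqrtRate c) Δ τ)).card ≤
      ((Finset.Icc 1 T).filter fun b => (M b).start = b).card +
        pieceCount (sqrtRate c) Δ T := by
  have hsub : ((Finset.Icc 1 T).image fun τ => (M τ, pieceStart (sqrtRate c) Δ τ)) ⊆
      (((Finset.Icc 1 T).filter fun b => (M b).start = b) ∪
        ((Finset.Icc 1 T).filter fun τ => pieceStart (sqrtRate c) Δ τ = τ)).image
          fun τ => (M τ, pieceStart (sqrtRate c) Δ τ) := by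
    intro p hp
    obtain ⟨τ, hτ, rfl⟩ := Finset.mem_image.1 hp
    have hτ' := Finset.mem_Icc.1 hτ
    have hb := H.blockSeq.bounds hτ'.1
    have hb1 := H.blockSeq.one_le_start hτ'.1
    have hps := pieceStart_bounds (ρ := sqrtRate c) (Δ := Δ) (sqrtRate_nonneg H.c_pos.le 1) hτ'.1
    rw [Finset.mem_image]
    -- The block and the piece of `τ` first meet at the later of their two starts, so each pair is
    -- represented by a block start or by a piece start.
    rcases le_total (M τ).start (pieceStart (sqrtRate c) Δ τ) with h | h
    · have h1 := H.blockSeq.eq_of_start_le hτ'.1 h hps.2.1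
      have h2 := pieceStart_eq_of_le (ρ := sqrtRate c) (Δ := Δ) hτ'.1 le_rfl hps.2.1
      refine ⟨pieceStart (sqrtRate c) Δ τ, Finset.mem_union_right _ ?_, by rw [h1, h2]⟩
      simp only [Finset.mem_filter, Finset.mem_Icc]
      exact ⟨⟨hps.1, by omega⟩, h2⟩
    · have h1 := H.blockSeq.eq_of_start_le hτ'.1 le_rfl hb.1
      have h2 := pieceStart_eq_of_le (ρ := sqrtRate c) (Δ := Δ) hτ'.1 h hb.1
      refine ⟨(M τ).start, Finset.mem_union_left _ ?_, by rw [h1, h2]⟩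
      simp only [Finset.mem_filter, Finset.mem_Icc]
      exact ⟨⟨hb1, by omega⟩, by rw [h1]⟩
  exact (Finset.card_le_card hsub).trans (Finset.card_image_le.trans (Finset.card_union_le _ _))

open Classical in
/-- The gap rounds are charged to the candidates and to the pieces. -/
lemma sum_gap_le (C : ℝ) (hC : C = h * c) :
    ∑ τ ∈ Finset.Icc 1 T, ∑ m ∈ Finset.range ((M τ).order + 1),
      (if 12 * sqrtRate C (2 ^ m) ≤ fs τ - g τ then 24 * sqrtRate C (2 ^ m) else 0) ≤
    ∑ τ ∈ Finset.Icc 1 T, ∑ m ∈ Finset.range ((M τ).order + 1),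
      (if IsCandidate (sqrtRate c) (sqrtRate C) Δ fs g (M τ) m τ then
        24 * C * √((2 : ℝ) ^ m) else 0) +
    24 * C * (Nat.log 2 T + 1) * √2 *
      √(((Finset.Icc 1 T).image fun τ => (M τ, pieceStart (sqrtRate c) Δ τ)).card * T) := by
  subst hC
  have hC0 : 0 < h * c := zero_lt_one.trans_le H.one_le_hc
  set q : ℕ → Block × ℕ := fun τ => (M τ, pieceStart (sqrtRate c) Δ τ) with hq
  set IQ := (Finset.Icc 1 T).image q with hIQ
  have hmaps : ∀ τ ∈ Finset.Icc 1 T, q τ ∈ IQ := fun τ hτ => Finset.mem_image_of_mem _ hτ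
  have hcardsum : ∑ p ∈ IQ, (((Finset.Icc 1 T).filter fun τ => q τ = p).card : ℝ) ≤ T := by
    have := Finset.card_eq_sum_card_fiberwise hmaps
    rw [Nat.card_Icc, Nat.add_sub_cancel] at this
    rw [← Nat.cast_sum, ← this]
  have hs := sum_sqrt_le IQ (fun p => (((Finset.Icc 1 T).filter fun τ => q τ = p).card : ℝ))
    (fun _ _ => by positivity) hcardsum
  have hpiece : ∀ p ∈ IQ, ∑ τ ∈ (Finset.Icc 1 T).filter (fun τ => q τ = p),
      ∑ m ∈ Finset.range ((M τ).order + 1),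
        (if 12 * sqrtRate (h * c) (2 ^ m) ≤ fs τ - g τ then 24 * sqrtRate (h * c) (2 ^ m) else 0) ≤
      ∑ τ ∈ (Finset.Icc 1 T).filter (fun τ => q τ = p), ∑ m ∈ Finset.range ((M τ).order + 1),
        (if IsCandidate (sqrtRate c) (sqrtRate (h * c)) Δ fs g (M τ) m τ then
          24 * (h * c) * √((2 : ℝ) ^ m) else 0) +
      24 * (h * c) * (Nat.log 2 T + 1) * √2 *
        √(((Finset.Icc 1 T).filter fun τ => q τ = p).card : ℝ) := by
    intro p hp
    obtain ⟨τ₁, hτ₁, rfl⟩ := Finset.mem_image.1 hp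
    set Q := (Finset.Icc 1 T).filter fun τ => q τ = q τ₁ with hQ
    have hQM : ∀ τ ∈ Q, M τ = M τ₁ := fun τ hτ =>
      (Prod.mk.inj (Finset.mem_filter.1 hτ).2).1
    have e : ∀ φ : ℕ → ℕ → ℝ, ∑ τ ∈ Q, ∑ m ∈ Finset.range ((M τ).order + 1), φ τ m =
        ∑ m ∈ Finset.range ((M τ₁).order + 1), ∑ τ ∈ Q, φ τ m := by
      intro φ
      rw [Finset.sum_comm' (s' := fun _ => Q) (t' := Finset.range ((M τ₁).order + 1))]
      intro τ m
      constructor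
      · rintro ⟨h1, h2⟩; rw [hQM τ h1] at h2; exact ⟨h1, h2⟩
      · rintro ⟨h1, h2⟩; rw [hQM τ h1]; exact ⟨h1, h2⟩
    rw [e, e]
    have hterm : ∀ m ∈ Finset.range ((M τ₁).order + 1),
        ∑ τ ∈ Q, (if 12 * sqrtRate (h * c) (2 ^ m) ≤ fs τ - g τ then
          24 * sqrtRate (h * c) (2 ^ m) else 0) ≤
        ∑ τ ∈ Q, (if IsCandidate (sqrtRate c) (sqrtRate (h * c)) Δ fs g (M τ) m τ then
          24 * (h * c) * √((2 : ℝ) ^ m) else 0) + 24 * (h * c) * (√2 * √(Q.card : ℝ)) := by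
      intro m _
      rw [← Finset.sum_filter, ← Finset.sum_filter, Finset.sum_const, Finset.sum_const,
        nsmul_eq_mul, nsmul_eq_mul]
      have hgap := H.card_gap_le (τ₁ := τ₁) m
      have e1 : (Finset.Icc 1 T).filter (fun τ => (M τ = M τ₁ ∧
          pieceStart (sqrtRate c) Δ τ = pieceStart (sqrtRate c) Δ τ₁) ∧
            g τ + 12 * sqrtRate (h * c) (2 ^ m) ≤ fs τ) =
          Q.filter fun τ => 12 * sqrtRate (h * c) (2 ^ m) ≤ fs τ - g τ := by
        rw [hQ, Finset.filter_filter]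
        refine Finset.filter_congr fun τ _ => ?_
        rw [hq, Prod.mk.injEq, le_sub_iff_add_le']
      have e2 : (Finset.Icc 1 T).filter (fun τ => (M τ = M τ₁ ∧
          pieceStart (sqrtRate c) Δ τ = pieceStart (sqrtRate c) Δ τ₁) ∧
            IsCandidate (sqrtRate c) (sqrtRate (h * c)) Δ fs g (M τ) m τ) =
          Q.filter fun τ => IsCandidate (sqrtRate c) (sqrtRate (h * c)) Δ fs g (M τ) m τ := by
        rw [hQ, Finset.filter_filter]
        refine Finset.filter_congr fun τ _ => ?_
        rw [hq, Prod.mk.injEq]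
      rw [e1, e2] at hgap
      have hgap2 : ((Q.filter fun τ => 12 * sqrtRate (h * c) (2 ^ m) ≤ fs τ - g τ).card : ℝ) ≤
          Q.card := by exact_mod_cast Finset.card_filter_le _ _
      set N := ((Q.filter fun τ => 12 * sqrtRate (h * c) (2 ^ m) ≤ fs τ - g τ).card : ℝ)
      set K := ((Q.filter fun τ =>
        IsCandidate (sqrtRate c) (sqrtRate (h * c)) Δ fs g (M τ) m τ).card : ℝ)
      set x := √((2 : ℝ) ^ m) with hx
      have hx0 : 0 < x := by positivity
      have hxx : x * x = 2 ^ m := Real.mul_self_sqrt (by positivity)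
      have hr : sqrtRate (h * c) (2 ^ m) = h * c / x := by rw [sqrtRate, hx]; push_cast; rfl
      have hK0 : 0 ≤ K := by positivity
      -- Two bounds on the number `N` of gap rounds are combined: `x ^ 2 (K + 2)` by the candidates,
      -- and the size of `Q`. The first is used when `2 x ^ 2` is at most the size of `Q`, the
      -- second otherwise.
      have hkey : N / x ≤ x * K + √2 * √(Q.card : ℝ) := by
        rw [div_le_iff₀ hx0]
        rcases le_total (√2 * x) √(Q.card : ℝ) with h1 | h1
        · have h2 : 2 * (x * x) ≤ √2 * √(Q.card : ℝ) * x := by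
            have : √2 * (√2 * x) ≤ √2 * √(Q.card : ℝ) := by gcongr
            have h3 : √2 * √2 = (2 : ℝ) := Real.mul_self_sqrt (by norm_num)
            nlinarith
          rw [← hxx] at hgap
          nlinarith
        · have h2 : (Q.card : ℝ) ≤ √2 * √(Q.card : ℝ) * x := by
            have h3 : √(Q.card : ℝ) * √(Q.card : ℝ) = Q.card := Real.mul_self_sqrt (by positivity)
            nlinarith [Real.sqrt_nonneg (Q.card : ℝ)]
          nlinarith [mul_nonneg (mul_nonneg hx0.le hK0) hx0.le]
      rw [hr]
      have h4 := mul_le_mul_of_nonneg_left hkey (by positivity : 0 ≤ 24 * (h * c))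
      calc N * (24 * (h * c / x)) = 24 * (h * c) * (N / x) := by ring
        _ ≤ 24 * (h * c) * (x * K + √2 * √(Q.card : ℝ)) := h4
        _ = _ := by ring
    refine (Finset.sum_le_sum hterm).trans ?_
    rw [Finset.sum_add_distrib, Finset.sum_const, Finset.card_range, nsmul_eq_mul]
    have hord : ((M τ₁).order : ℝ) ≤ Nat.log 2 T := by exact_mod_cast H.order_le hτ₁
    have h0 : 0 ≤ 24 * (h * c) * (√2 * √(Q.card : ℝ)) := by positivity
    refine add_le_add le_rfl ?_
    push_cast
    nlinarith [mul_le_mul_of_nonneg_right hord h0]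
  rw [← Finset.sum_fiberwise_of_maps_to hmaps,
    ← Finset.sum_fiberwise_of_maps_to hmaps (f := fun τ =>
      ∑ m ∈ Finset.range ((M τ).order + 1),
        (if IsCandidate (sqrtRate c) (sqrtRate (h * c)) Δ fs g (M τ) m τ then
          24 * (h * c) * √((2 : ℝ) ^ m) else 0))]
  refine (Finset.sum_le_sum hpiece).trans ?_
  rw [Finset.sum_add_distrib, ← Finset.mul_sum]
  gcongr

-- A candidate of order `m` costs of order `√(2 ^ m)`, which is just what cancels the rarity bound,
-- so each order contributes the same to its block.
open Classical in
lemma sum_candidates_le :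
    ∑ τ ∈ Finset.Icc 1 T, ∑ m ∈ Finset.range ((M τ).order + 1),
      (if IsCandidate (sqrtRate c) (sqrtRate (h * c)) Δ fs g (M τ) m τ then
        24 * (h * c) * √((2 : ℝ) ^ m) else 0) ≤
    48 * (h * c) * (Nat.log 2 T + 1) * (1 + Lg) *
      ∑ b ∈ (Finset.Icc 1 T).filter (fun b => (M b).start = b), √((2 : ℝ) ^ (M b).order) := by
  have hC0 : 0 < h * c := zero_lt_one.trans_le H.one_le_hc
  have hL := H.Lg_nonneg
  refine H.sum_le_of_block_le fun b hb => ?_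
  have hbT := (Finset.mem_filter.1 hb).1
  set Q := (Finset.Icc 1 T).filter fun τ => (M τ).start = b with hQ
  have hQM : ∀ τ ∈ Q, M τ = M b := fun τ hτ => H.eq_of_mem_fiber hτ
  rw [Finset.sum_congr rfl fun τ hτ => by rw [hQM τ hτ], Finset.sum_comm]
  have hterm : ∀ m ∈ Finset.range ((M b).order + 1), ∑ τ ∈ Q,
      (if IsCandidate (sqrtRate c) (sqrtRate (h * c)) Δ fs g (M b) m τ then
        24 * (h * c) * √((2 : ℝ) ^ m) else 0) ≤
          48 * (h * c) * (1 + Lg) * √((2 : ℝ) ^ (M b).order) := by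
    intro m hm
    rw [← Finset.sum_filter, Finset.sum_const, nsmul_eq_mul]
    have h1 := H.card_candidates_le hb (Nat.lt_succ_iff.1 (Finset.mem_range.1 hm))
    have e : (Finset.Icc 1 T).filter (fun τ => M τ = M b ∧
        IsCandidate (sqrtRate c) (sqrtRate (h * c)) Δ fs g (M b) m τ) =
        Q.filter fun τ => IsCandidate (sqrtRate c) (sqrtRate (h * c)) Δ fs g (M b) m τ := by
      rw [hQ, Finset.filter_filter]
      refine Finset.filter_congr fun τ hτ => ?_
      refine and_congr_left fun _ => ⟨fun h2 => ?_, fun h2 => ?_⟩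
      · rw [h2]; exact (Finset.mem_filter.1 hb).2
      · exact hQM τ (Finset.mem_filter.2 ⟨hτ, h2⟩)
    rw [e] at h1
    have := mul_le_mul_of_nonneg_left h1 (by positivity : 0 ≤ 24 * (h * c))
    linarith
  refine (Finset.sum_le_sum hterm).trans ?_
  rw [Finset.sum_const, Finset.card_range, nsmul_eq_mul]
  have hord : ((M b).order : ℝ) ≤ Nat.log 2 T := by exact_mod_cast H.order_le hbT
  push_cast
  calc ((M b).order + 1 : ℝ) * (48 * (h * c) * (1 + Lg) * √((2 : ℝ) ^ (M b).order))
      ≤ (Nat.log 2 T + 1 : ℝ) * (48 * (h * c) * (1 + Lg) * √((2 : ℝ) ^ (M b).order)) := by gcongr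
    _ = _ := by ring

/-- The dynamic regret along a good path. -/
theorem regret_le (hT : 1 ≤ T) : ∑ τ ∈ Finset.Icc 1 T, (fs τ - R τ) ≤
    176 * (h * c) * (Nat.log 2 T + 1 : ℝ) ^ 2 * (1 + Lg) *
      √(pieceCount (sqrtRate c) Δ T * T) := by
  classical
  have hC0 : 0 < h * c := zero_lt_one.trans_le H.one_le_hc
  have hL := H.Lg_nonneg
  set Lm : ℝ := (Nat.log 2 T + 1 : ℝ) with hLm
  have hLm1 : 1 ≤ Lm := by rw [hLm]; linarith [Nat.cast_nonneg (α := ℝ) (Nat.log 2 T)]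
  set S := ∑ b ∈ (Finset.Icc 1 T).filter (fun b => (M b).start = b),
    √((2 : ℝ) ^ (M b).order) with hS
  have hS0 : 0 ≤ S := Finset.sum_nonneg fun _ _ => Real.sqrt_nonneg _
  have h1 : ∑ τ ∈ Finset.Icc 1 T, (g τ - R τ) ≤ 4 * (h * c) * S :=
    H.sum_le_of_block_le fun b hb => H.block_scalar_regret_le hb
  have h2 : ∑ τ ∈ Finset.Icc 1 T, 12 * sqrtRate (h * c) (2 ^ (M τ).order) ≤ 12 * (h * c) * S := by
    refine H.sum_le_of_block_le fun b _ => ?_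
    rw [Finset.sum_congr rfl fun τ hτ => by rw [H.eq_of_mem_fiber hτ], Finset.sum_const,
      nsmul_eq_mul]
    have h3 := H.card_fiber_le b
    have h4 := sqrtRate_mul_self (h * c) (2 ^ (M b).order)
    push_cast at h4
    have h5 := sqrtRate_nonneg hC0.le (2 ^ (M b).order)
    have := mul_le_mul_of_nonneg_right h3 h5
    nlinarith
  have h3 := H.sum_gap_le (h * c) rfl
  have h4 := H.sum_candidates_le
  have h5 := H.card_block_pieces_le
  have h6 := H.card_starts_le_mul hT
  have h7 := H.sum_sqrt_pow_order_le hT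
  set N := ((Finset.Icc 1 T).filter fun b => (M b).start = b).card
  set I := ((Finset.Icc 1 T).image fun τ => (M τ, pieceStart (sqrtRate c) Δ τ)).card
  set ℓ := pieceCount (sqrtRate c) Δ T with hℓ
  set X := √((ℓ : ℝ) * T) with hX
  have hX0 : 0 ≤ X := Real.sqrt_nonneg _
  have hN : (N : ℝ) ≤ Lm * ℓ := by rw [hLm]; exact_mod_cast h6
  have hI : (I : ℝ) ≤ 2 * Lm * ℓ := by
    have : (I : ℝ) ≤ N + ℓ := by exact_mod_cast h5
    nlinarith [Nat.cast_nonneg (α := ℝ) ℓ]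
  have hSle : S ≤ 2 * Lm * X := by
    refine h7.trans (Real.sqrt_le_iff.2 ⟨by positivity, ?_⟩)
    rw [mul_pow, hX, Real.sq_sqrt (by positivity)]
    calc (N : ℝ) * (2 * T) ≤ (Lm * ℓ) * (2 * T) := by gcongr
      _ = 2 * Lm * (ℓ * T) := by ring
      _ ≤ (2 * Lm) ^ 2 * (ℓ * T) := by gcongr; nlinarith
  have hIle : √2 * √((I : ℝ) * T) ≤ 2 * Lm * X := by
    rw [← Real.sqrt_mul (by norm_num)]
    refine Real.sqrt_le_iff.2 ⟨by positivity, ?_⟩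
    rw [mul_pow, hX, Real.sq_sqrt (by positivity)]
    calc (2 : ℝ) * (I * T) ≤ 2 * ((2 * Lm * ℓ) * T) := by gcongr
      _ = 4 * Lm * (ℓ * T) := by ring
      _ ≤ (2 * Lm) ^ 2 * (ℓ * T) := by gcongr; nlinarith
  -- The split into `g - R` and `fs - g`, with the latter decomposed dyadically down to the scale of
  -- the current block.
  have hsum : ∑ τ ∈ Finset.Icc 1 T, (fs τ - R τ) ≤
      ∑ τ ∈ Finset.Icc 1 T, (g τ - R τ) +
        (∑ τ ∈ Finset.Icc 1 T, 12 * sqrtRate (h * c) (2 ^ (M τ).order) +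
        ∑ τ ∈ Finset.Icc 1 T, ∑ m ∈ Finset.range ((M τ).order + 1),
          (if 12 * sqrtRate (h * c) (2 ^ m) ≤ fs τ - g τ then
            24 * sqrtRate (h * c) (2 ^ m) else 0)) := by
    rw [← Finset.sum_add_distrib, ← Finset.sum_add_distrib]
    refine Finset.sum_le_sum fun τ hτ => ?_
    have h8 := le_sum_dyadic (x := fs τ - g τ) H.one_le_hc
      (by linarith [H.opt_le τ hτ, (H.scalar_mem τ hτ).1]) (M τ).order
    linarith
  have hA : 48 * (h * c) * Lm * (1 + Lg) * S ≤ 96 * ((h * c) * Lm ^ 2 * (1 + Lg) * X) := by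
    calc 48 * (h * c) * Lm * (1 + Lg) * S ≤ 48 * (h * c) * Lm * (1 + Lg) * (2 * Lm * X) := by
          gcongr
      _ = _ := by ring
  have hB : 24 * (h * c) * Lm * √2 * √((I : ℝ) * T) ≤
      48 * ((h * c) * Lm ^ 2 * (1 + Lg) * X) := by
    calc 24 * (h * c) * Lm * √2 * √((I : ℝ) * T) = 24 * (h * c) * Lm * (√2 * √((I : ℝ) * T)) := by
          ring
      _ ≤ 24 * (h * c) * Lm * (2 * Lm * X) := by gcongr
      _ = 48 * ((h * c) * Lm ^ 2 * 1 * X) := by ring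
      _ ≤ _ := by gcongr; linarith
  have hD : 16 * (h * c) * S ≤ 32 * ((h * c) * Lm ^ 2 * (1 + Lg) * X) := by
    calc 16 * (h * c) * S ≤ 16 * (h * c) * (2 * Lm * X) := by gcongr
      _ = 32 * ((h * c) * (Lm * 1) * 1 * X) := by ring
      _ ≤ 32 * ((h * c) * (Lm * Lm) * (1 + Lg) * X) := by gcongr; linarith
      _ = _ := by ring
  calc _ ≤ _ := hsum
    _ ≤ 176 * ((h * c) * Lm ^ 2 * (1 + Lg) * X) := by linarith
    _ = _ := by ring

end GoodPath

end PathRegret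


/-! ### Measurability along a run of MASTER -/

section MasterMeasurability

instance : Countable Block :=
  Function.Injective.countable (f := fun B : Block => (B.start, B.order)) fun B B' h => by
    cases B; cases B'; simpa using h

lemma measurableSet_sInf_nat_eq {Ω : Type u} {m : MeasurableSpace Ω} {q : ℕ → Ω → Prop}
    (hq : ∀ k, MeasurableSet {ω | q k ω}) (n : ℕ) : MeasurableSet {ω | sInf {k | q k ω} = n} := by
  -- The second set accounts for the convention that the infimum of the empty set is `0`.
  have h : {ω | sInf {k | q k ω} = n} =
      ({ω | q n ω} ∩ ⋂ k ∈ Finset.range n, {ω | q k ω}ᶜ) ∪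
        ({_ω | n = 0} ∩ ⋂ k, {ω | q k ω}ᶜ) := by
    ext ω
    simp only [Set.mem_ofPred_eq, Set.mem_union, Set.mem_inter_iff, Set.mem_iInter,
      Finset.mem_range, Set.mem_compl_iff]
    constructor
    · intro h
      by_cases hne : ∃ k, q k ω
      · have h1 : sInf {k | q k ω} ∈ {k | q k ω} := Nat.sInf_mem hne
        refine Or.inl ⟨h ▸ h1, fun k hk hk' => ?_⟩
        have : sInf {k | q k ω} ≤ k := Nat.sInf_le hk'
        omega
      · have h1 : {k | q k ω} = ∅ := Set.eq_empty_of_forall_notMem fun k hk => hne ⟨k, hk⟩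
        rw [h1, Nat.sInf_empty] at h
        exact Or.inr ⟨h.symm, fun k hk => hne ⟨k, hk⟩⟩
    · rintro (⟨h1, h2⟩ | ⟨h1, h2⟩)
      · refine le_antisymm (Nat.sInf_le h1) ?_
        by_contra hlt
        exact h2 _ (not_le.1 hlt) (Nat.sInf_mem (s := {k | q k ω}) ⟨n, h1⟩)
      · have h1' : {k | q k ω} = ∅ := Set.eq_empty_of_forall_notMem fun k hk => h2 k hk
        rw [h1', Nat.sInf_empty, h1]
  rw [h]
  exact ((hq n).inter (Finset.measurableSet_biInter _ fun k _ => (hq k).compl)).union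
    ((MeasurableSet.const _).inter (MeasurableSet.iInter fun k => (hq k).compl))

lemma measurableSet_real_le {Ω : Type u} {m : MeasurableSpace Ω} {φ ψ : Ω → ℝ}
    (hφ : Measurable φ) (hψ : Measurable ψ) : MeasurableSet {ω | φ ω ≤ ψ ω} :=
  measurableSet_le hφ hψ

lemma measurable_const_mul_sum {Ω : Type u} {m : MeasurableSpace Ω} {s : Finset ℕ}
    {φ : ℕ → Ω → ℝ} (hφ : ∀ i ∈ s, Measurable (φ i)) (c : ℝ) :
    Measurable fun ω => c * ∑ i ∈ s, φ i ω :=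
  (Finset.measurable_sum s hφ).const_mul c

/-- A property of a random block is measurable if it is so for each possible block. -/
lemma measurableSet_of_block {Ω : Type u} {m : MeasurableSpace Ω} {M : Ω → Block}
    (hM : ∀ B, MeasurableSet {ω | M ω = B}) {q : Block → Ω → Prop}
    (hq : ∀ B, (∃ ω, M ω = B) → MeasurableSet {ω | q B ω}) :
    MeasurableSet {ω | q (M ω) ω} := by
  have h : {ω | q (M ω) ω} = ⋃ B, {ω | M ω = B} ∩ {ω | q B ω} := by
    ext ω; simp
  rw [h]
  refine MeasurableSet.iUnion fun B => ?_
  by_cases hB : ∃ ω, M ω = B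
  · exact (hM B).inter (hq B hB)
  · have : {ω | M ω = B} = ∅ := Set.eq_empty_of_forall_notMem fun ω hω => hB ⟨ω, hω⟩
    rw [this, Set.empty_inter]
    exact MeasurableSet.empty

/-- The infimum over finitely many rounds is attained. This writes the first test as a countable
union of elementary events. -/
lemma sInf_image_Icc_add_le_iff {g : ℕ → ℝ} {s t : ℕ} (hst : s ≤ t) {x y : ℝ} :
    sInf (g '' Set.Icc s t) + x ≤ y ↔ ∃ τ ∈ Set.Icc s t, g τ + x ≤ y := by
  have hfin : (g '' Set.Icc s t).Finite := (Set.finite_Icc s t).image g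
  constructor
  · intro h
    obtain ⟨τ, hτ, h1⟩ := Set.Nonempty.csInf_mem (s := g '' Set.Icc s t)
      ⟨g s, s, ⟨le_rfl, hst⟩, rfl⟩ hfin
    exact ⟨τ, hτ, by rw [h1]; exact h⟩
  · rintro ⟨τ, hτ, h⟩
    have := csInf_le hfin.bddBelow (Set.mem_image_of_mem g hτ)
    linarith

variable {Pol : Type v} [MeasurableSpace Pol] {Ω : Type u} {mΩ : MeasurableSpace Ω}
  {P : Measure Ω} {alg : BaseAlg Pol} {ρ : ℕ → ℝ} {δ : ℝ} {f : ℕ → Pol → ℝ} {T : ℕ}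
  {ℱ : Filtration ℕ mΩ} {𝒢 : ℕ → MeasurableSpace Ω} {U : ℕ → ℕ → Ω → ℝ} {π : ℕ → Ω → Pol}
  {g R : ℕ → Ω → ℝ}

/-- The block of round `t` in a run of MASTER. -/
noncomputable def blockAt (ρ : ℕ → ℝ) (T : ℕ) (δ : ℝ) (U : ℕ → ℕ → Ω → ℝ) (g R : ℕ → Ω → ℝ)
    (t : ℕ) (ω : Ω) : Block :=
  masterBlock ρ (rhoHat T δ ρ) (fun s m => U s m ω) (fun τ => g τ ω) (fun τ => R τ ω) t

lemma isBlockSeq_blockAt (ρ : ℕ → ℝ) (T : ℕ) (δ : ℝ) (U : ℕ → ℕ → Ω → ℝ) (g R : ℕ → Ω → ℝ)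
    (ω : Ω) : IsBlockSeq (fun t => blockAt ρ T δ U g R t ω) fun t =>
      (blockAt ρ T δ U g R t ω).Test1Fails ρ (rhoHat T δ ρ) (fun s m => U s m ω)
          (fun τ => g τ ω) (fun τ => R τ ω) t ∨
        (blockAt ρ T δ U g R t ω).Test2Fails (rhoHat T δ ρ) (fun τ => g τ ω)
          (fun τ => R τ ω) t :=
  isBlockSeq_masterBlock _ _ _ _ _

namespace IsMasterRun

variable (hI : IsMasterRun alg ρ δ P f T ℱ 𝒢 U π g R)
include hI

lemma before_le {s t : ℕ} (hs : 1 ≤ s) (hst : s ≤ t) (ht : t ≤ T) : 𝒢 s ≤ 𝒢 t := by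
  rcases hst.eq_or_lt with rfl | h
  · exact le_rfl
  · exact (hI.le_after s (by simp; omega)).trans
      ((ℱ.mono (by omega : s ≤ t - 1)).trans (hI.past_le t (by simp; omega)))

lemma before_le_after {s t : ℕ} (hs : 1 ≤ s) (hst : s ≤ t) (ht : t ≤ T) : 𝒢 s ≤ ℱ t :=
  (hI.le_after s (by simp; omega)).trans (ℱ.mono hst)

lemma measurable_scalar {s t : ℕ} (hs : 1 ≤ s) (hst : s ≤ t) (ht : t ≤ T) :
    Measurable[ℱ t] (g s) :=
  (hI.scalar_meas s (by simp; omega)).mono (hI.before_le_after hs hst ht) le_rfl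

lemma measurable_reward {s t : ℕ} (hs : 1 ≤ s) (hst : s ≤ t) (ht : t ≤ T) :
    Measurable[ℱ t] (R s) :=
  (hI.reward_meas s (by simp; omega)).mono (ℱ.mono hst) le_rfl

lemma measurableSet_scheduled {B : Block} (hB : 1 ≤ B.start) {m s t : ℕ} (hst : s ≤ t)
    (ht : t ≤ T) : MeasurableSet[𝒢 t] {ω | B.Scheduled ρ (fun s m => U s m ω) m s} := by
  by_cases h : m ≤ B.order ∧ B.start ≤ s ∧ s < B.start + 2 ^ B.order ∧ 2 ^ m ∣ s - B.start
  · have e : {ω | B.Scheduled ρ (fun s m => U s m ω) m s} =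
        {ω | U s m ω ≤ ρ (2 ^ B.order) / ρ (2 ^ m)} := by
      ext ω
      simp only [Set.mem_ofPred_eq, Block.Scheduled]
      exact ⟨fun h' => h'.2.2.2.2, fun h' => ⟨h.1, h.2.1, h.2.2.1, h.2.2.2, h'⟩⟩
    rw [e]
    exact measurableSet_real_le ((hI.seed_meas s (by simp; omega) m).mono
      (hI.before_le (by omega) hst ht) le_rfl) measurable_const
  · have e : {ω | B.Scheduled ρ (fun s m => U s m ω) m s} = ∅ :=
      Set.eq_empty_of_forall_notMem fun ω h' => h ⟨h'.1, h'.2.1, h'.2.2.1, h'.2.2.2.1⟩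
    rw [e]
    exact @MeasurableSet.empty _ (𝒢 t)

lemma measurableSet_activeOrder {B : Block} (hB : 1 ≤ B.start) {m t : ℕ} (hBt : B.start ≤ t)
    (ht : t ≤ T) : MeasurableSet[𝒢 t] {ω | B.activeOrder ρ (fun s m => U s m ω) t = m} :=
  @measurableSet_sInf_nat_eq _ (𝒢 t)
    (fun k ω => B.Scheduled ρ (fun s m => U s m ω) k (B.instStart k t))
    (fun _ => hI.measurableSet_scheduled hB (Block.instStart_le hBt) ht) m

lemma measurableSet_test1Fails {B : Block} (hB : 1 ≤ B.start) {t : ℕ} (hBt : B.start ≤ t)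
    (ht : t ≤ T) : MeasurableSet[ℱ t] {ω | B.Test1Fails ρ (rhoHat T δ ρ) (fun s m => U s m ω)
      (fun τ => g τ ω) (fun τ => R τ ω) t} := by
  have e : {ω | B.Test1Fails ρ (rhoHat T δ ρ) (fun s m => U s m ω)
      (fun τ => g τ ω) (fun τ => R τ ω) t} = ⋃ m, ⋃ s, ⋃ (_ : s + 2 ^ m = t + 1),
        ⋃ τ, ⋃ (_ : τ ∈ Set.Icc B.start t), ({ω | B.Scheduled ρ (fun s m => U s m ω) m s} ∩
          {ω | g τ ω + 9 * rhoHat T δ ρ (2 ^ m) ≤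
            (1 / (2 : ℝ) ^ m) * ∑ τ ∈ Finset.Icc s t, R τ ω}) := by
    ext ω
    simp only [Set.mem_ofPred_eq, Block.Test1Fails, sInf_image_Icc_add_le_iff hBt, Set.mem_iUnion,
      Set.mem_inter_iff, exists_prop]
    constructor
    · rintro ⟨m, s, h1, h2, τ, h3, h4⟩
      exact ⟨m, s, h2, τ, h3, h1, h4⟩
    · rintro ⟨m, s, h2, τ, h3, h1, h4⟩
      exact ⟨m, s, h1, h2, τ, h3, h4⟩
  rw [e]
  refine MeasurableSet.iUnion fun m => MeasurableSet.iUnion fun s => MeasurableSet.iUnion fun hs =>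
    MeasurableSet.iUnion fun τ => MeasurableSet.iUnion fun hτ => ?_
  have hpow := Nat.one_le_two_pow (n := m)
  have h1 := hI.before_le_after (hB.trans hBt) le_rfl ht _
    (hI.measurableSet_scheduled hB (m := m) (by omega : s ≤ t) ht)
  by_cases hs1 : B.start ≤ s
  · refine h1.inter (measurableSet_real_le
      ((hI.measurable_scalar (hB.trans hτ.1) hτ.2 ht).add_const _) ?_)
    refine measurable_const_mul_sum (fun σ hσ => ?_) _
    rw [Finset.mem_Icc] at hσ
    exact hI.measurable_reward (by omega) hσ.2 ht
  · have e2 : {ω | B.Scheduled ρ (fun s m => U s m ω) m s} = ∅ :=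
      Set.eq_empty_of_forall_notMem fun ω h' => hs1 h'.2.1
    rw [e2, Set.empty_inter]
    exact @MeasurableSet.empty _ (ℱ t)

lemma measurableSet_test2Fails {B : Block} (hB : 1 ≤ B.start) {t : ℕ}
    (ht : t ≤ T) : MeasurableSet[ℱ t] {ω | B.Test2Fails (rhoHat T δ ρ)
      (fun τ => g τ ω) (fun τ => R τ ω) t} := by
  refine measurableSet_real_le measurable_const (measurable_const_mul_sum
    (φ := fun σ ω => g σ ω - R σ ω) (fun σ hσ => ?_) _)
  rw [Finset.mem_Icc] at hσ
  exact (hI.measurable_scalar (by omega) hσ.2 ht).sub (hI.measurable_reward (by omega) hσ.2 ht)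

/-- The block of a round is determined by the past. -/
lemma measurableSet_blockAt {t : ℕ} (ht1 : 1 ≤ t) (ht : t ≤ T) (B : Block) :
    MeasurableSet[ℱ (t - 1)] {ω | blockAt ρ T δ U g R t ω = B} := by
  induction t, ht1 using Nat.le_induction generalizing B with
  | base => simp only [blockAt, masterBlock]; exact MeasurableSet.const _
  | succ t ht1 ih =>
    rw [Nat.add_sub_cancel]
    have ih' : ∀ B, MeasurableSet[ℱ t] {ω | blockAt ρ T δ U g R t ω = B} := fun B =>
      ℱ.mono (Nat.sub_le t 1) _ (ih (by omega) B)
    have hpast : ∀ q : Block → Prop, MeasurableSet[ℱ t] {ω | q (blockAt ρ T δ U g R t ω)} :=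
      fun q => @measurableSet_of_block _ (ℱ t) _ ih' (fun B _ => q B) fun B _ => MeasurableSet.const _
    set fail : Block → Ω → Prop := fun B ω =>
      B.Test1Fails ρ (rhoHat T δ ρ) (fun s m => U s m ω) (fun τ => g τ ω) (fun τ => R τ ω) t ∨
        B.Test2Fails (rhoHat T δ ρ) (fun τ => g τ ω) (fun τ => R τ ω) t
    have hfail : MeasurableSet[ℱ t] {ω | fail (blockAt ρ T δ U g R t ω) ω} := by
      refine @measurableSet_of_block _ (ℱ t) _ ih' fail fun B ⟨ω, hω⟩ => ?_
      have hseq := isBlockSeq_blockAt ρ T δ U g R ω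
      have h1 : 1 ≤ B.start := hω ▸ hseq.one_le_start ht1
      have h2 : B.start ≤ t := hω ▸ (hseq.bounds ht1).1
      exact (hI.measurableSet_test1Fails h1 h2 (by omega)).union
        (hI.measurableSet_test2Fails h1 (by omega))
    -- The recursion for blocks read as an identity of events: a failed test forces one value, and
    -- otherwise the new block is a function of the old one.
    have e : {ω | blockAt ρ T δ U g R (t + 1) ω = B} =
        ({ω | fail (blockAt ρ T δ U g R t ω) ω} ∩ {_ω | (⟨t + 1, 0⟩ : Block) = B}) ∪
        ({ω | fail (blockAt ρ T δ U g R t ω) ω}ᶜ ∩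
          {ω | (fun B' : Block => (t + 1 = B'.start + 2 ^ B'.order ∧ ⟨t + 1, B'.order + 1⟩ = B) ∨
            (t + 1 ≠ B'.start + 2 ^ B'.order ∧ B' = B)) (blockAt ρ T δ U g R t ω)}) := by
      ext ω
      have hseq := isBlockSeq_blockAt ρ T δ U g R ω
      have h1 := hseq.restart t ht1
      have h2 := hseq.next t ht1
      have h3 := hseq.stay t ht1
      simp only [Set.mem_ofPred_eq, Set.mem_union, Set.mem_inter_iff, Set.mem_compl_iff]
      by_cases hf : fail (blockAt ρ T δ U g R t ω) ω
      · simp [hf, h1 hf]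
      · by_cases hn : t + 1 = (blockAt ρ T δ U g R t ω).start + 2 ^ (blockAt ρ T δ U g R t ω).order
        · rw [h2 hf hn]; simp [hf, ← hn]
        · rw [h3 hf hn]; simp [hf, hn]
    rw [e]
    exact (hfail.inter (MeasurableSet.const _)).union (hfail.compl.inter (hpast (fun B' : Block =>
      (t + 1 = B'.start + 2 ^ B'.order ∧ ⟨t + 1, B'.order + 1⟩ = B) ∨
        (t + 1 ≠ B'.start + 2 ^ B'.order ∧ B' = B))))

/-- Whether the instance of order `m` started in round `s` of the block `B` is active in round `t`
is known when the policy of round `t` is played. -/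
lemma measurableSet_active {t : ℕ} (ht : t ∈ Finset.Icc 1 T) (B : Block) (m s : ℕ) :
    MeasurableSet[𝒢 t] {ω | blockAt ρ T δ U g R t ω = B ∧ s ≤ t ∧
      B.activeOrder ρ (fun s m => U s m ω) t = m ∧ B.instStart m t = s} := by
  have ht' := Finset.mem_Icc.1 ht
  have h1 := hI.past_le t ht _ (hI.measurableSet_blockAt ht'.1 ht'.2 B)
  by_cases hB : ∃ ω, blockAt ρ T δ U g R t ω = B
  · obtain ⟨ω, hω⟩ := hB
    have hseq := isBlockSeq_blockAt ρ T δ U g R ω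
    have h2 : 1 ≤ B.start := hω ▸ hseq.one_le_start ht'.1
    have h3 : B.start ≤ t := hω ▸ (hseq.bounds ht'.1).1
    exact MeasurableSet.inter h1 ((MeasurableSet.const _).inter
      ((hI.measurableSet_activeOrder h2 h3 ht'.2).inter (MeasurableSet.const _)))
  · have e : {ω | blockAt ρ T δ U g R t ω = B ∧ s ≤ t ∧
      B.activeOrder ρ (fun s m => U s m ω) t = m ∧ B.instStart m t = s} = ∅ :=
      Set.eq_empty_of_forall_notMem fun ω hω => hB ⟨ω, hω.1⟩
    rw [e]
    exact @MeasurableSet.empty _ (𝒢 t)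

lemma measurableSet_isCandidate {ρ' ρhat Δ fs : ℕ → ℝ} {t : ℕ} (ht : t ∈ Finset.Icc 1 T)
    (h1 : 0 ≤ ρ' 1) (B : Block) (m : ℕ) :
    MeasurableSet[ℱ (t - 1)] {ω | blockAt ρ T δ U g R t ω = B ∧
      IsCandidate ρ' ρhat Δ fs (fun τ => g τ ω) B m t} := by
  have ht' := Finset.mem_Icc.1 ht
  refine MeasurableSet.inter (hI.measurableSet_blockAt ht'.1 ht'.2 B)
    ((MeasurableSet.const _).inter ((MeasurableSet.const _).inter ?_))
  have e : {ω | ∃ τ, B.start ≤ τ ∧ pieceStart ρ' Δ t ≤ τ ∧ τ < t ∧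
      g τ ω + 12 * ρhat (2 ^ m) ≤ fs τ} = ⋃ τ, ⋃ (_ : B.start ≤ τ ∧ pieceStart ρ' Δ t ≤ τ ∧ τ < t),
        {ω | g τ ω + 12 * ρhat (2 ^ m) ≤ fs τ} := by
    ext ω; simp [and_assoc]
  have hps := pieceStart_bounds (Δ := Δ) h1 ht'.1
  change MeasurableSet[ℱ (t - 1)] {ω | ∃ τ, B.start ≤ τ ∧ pieceStart ρ' Δ t ≤ τ ∧ τ < t ∧
      g τ ω + 12 * ρhat (2 ^ m) ≤ fs τ}
  rw [e]
  refine MeasurableSet.iUnion fun τ => MeasurableSet.iUnion fun hτ => ?_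
  exact measurableSet_real_le
    ((hI.measurable_scalar (by omega) (by omega) (by omega)).add_const _) measurable_const

end IsMasterRun

/-- The history of the active instance, as a part of the whole history. -/
lemma activeHistory_eq_subHistory {Q : Type v} {M : ℕ → Block} {fail : ℕ → Prop} (hM : IsBlockSeq M fail)
    (ρ : ℕ → ℝ) (U : ℕ → ℕ → ℝ) (π : ℕ → Q) (R : ℕ → ℝ) {t m s : ℕ} (ht : 1 ≤ t)
    (hm : (M t).activeOrder ρ U t = m) (hs : (M t).instStart m t = s) :
    (M t).activeHistory ρ U π R t = subHistory (fun τ => M τ = M t ∧ s ≤ τ ∧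
      (M t).activeOrder ρ U τ = m ∧ (M t).instStart m τ = s) π R (t - 1) := by
  classical
  have hb := hM.bounds ht
  have hst : s ≤ t := hs ▸ Block.instStart_le hb.1
  have hbs : (M t).start ≤ s := by rw [← hs, Block.instStart]; omega
  have hs1 : 1 ≤ s := (hM.one_le_start ht).trans hbs
  have hlt : t < s + 2 ^ m := hs ▸ Block.lt_instStart_add
  have hd : 2 ^ m ∣ s - (M t).start := by rw [← hs, Block.instStart]; simp
  simp only [Block.activeHistory, subHistory, hm, hs]
  congr 1
  -- Rounds before `s` are excluded by the selection rule. From `s` on the round `τ` lies in the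
  -- same block and in the same interval of the partition, so only the condition on the active order
  -- is left.
  have e : List.range' 1 (t - 1) = List.range' 1 (s - 1) ++ List.range' s (t - s) := by
    have h := List.range'_append_1 (s := 1) (m := s - 1) (n := t - s)
    rw [show 1 + (s - 1) = s by omega, show s - 1 + (t - s) = t - 1 by omega] at h
    exact h.symm
  rw [e, List.filter_append]
  rw [List.filter_eq_nil_iff (l := List.range' 1 (s - 1)) |>.2, List.nil_append]
  swap
  · intro τ hτ
    rw [List.mem_range'_1] at hτ
    simp only [decide_eq_true_eq]
    omega
  refine List.filter_congr fun τ hτ => ?_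
  rw [List.mem_range'_1] at hτ
  have h1 : M τ = M t := hM.eq_of_start_le ht (by omega) (by omega)
  have h2 : (M t).instStart m τ = s := Block.instStart_eq hbs hd hτ.1 (by omega)
  simp only [h1, h2, hτ.1, true_and, and_true]

end MasterMeasurability


/-! ### Concentration of the coins of MASTER -/

section Coins

lemma sum_indicator_coin {Ω : Type u} {D : ℕ → Set Ω} {u : ℕ → Ω → ℝ} (p x y : ℝ) (n : ℕ) (ω : Ω)
    [DecidablePred fun τ => ω ∈ D τ] [DecidablePred fun τ => ω ∈ D τ ∧ u τ ω ≤ p] :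
    ∑ τ ∈ Finset.Icc 1 n, (D τ).indicator (fun ω => x * Set.indicator {v | v ≤ p} 1 (u τ ω) + y) ω =
      x * ((Finset.Icc 1 n).filter fun τ => ω ∈ D τ ∧ u τ ω ≤ p).card +
        y * ((Finset.Icc 1 n).filter fun τ => ω ∈ D τ).card := by
  rw [Finset.card_filter, Finset.card_filter]
  push_cast
  rw [Finset.mul_sum, Finset.mul_sum, ← Finset.sum_add_distrib]
  refine Finset.sum_congr rfl fun τ _ => ?_
  by_cases h1 : ω ∈ D τ <;> by_cases h2 : u τ ω ≤ p <;> simp [h1, h2]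

/-- The exponential moment of a biased coin made from a uniform variable. -/
lemma integral_exp_coin {Ω : Type u} {mΩ : MeasurableSpace Ω} {P : Measure Ω}
    [IsProbabilityMeasure P] {u : Ω → ℝ} (hu : Measurable u)
    (hlaw : P.map u = (volume : Measure ℝ).restrict (Set.Icc 0 1)) {p : ℝ} (hp0 : 0 ≤ p)
    (hp1 : p ≤ 1) (x y : ℝ) :
    ∫ ω, Real.exp (x * Set.indicator {v | v ≤ p} 1 (u ω) + y) ∂P =
      Real.exp y * (1 + p * (Real.exp x - 1)) := by
  have hmeas : MeasurableSet {v : ℝ | v ≤ p} := measurableSet_Iic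
  have hprob : P.real (u ⁻¹' {v | v ≤ p}) = p := by
    rw [measureReal_def, ← Measure.map_apply hu hmeas, hlaw, Measure.restrict_apply hmeas]
    have e : {v : ℝ | v ≤ p} ∩ Set.Icc 0 1 = Set.Icc 0 p := by
      ext v
      simp only [Set.mem_inter_iff, Set.mem_ofPred_eq, Set.mem_Icc]
      constructor
      · rintro ⟨h1, h2, -⟩; exact ⟨h2, h1⟩
      · rintro ⟨h1, h2⟩; exact ⟨h2, h1, h2.trans hp1⟩
    rw [e, Real.volume_Icc, sub_zero, ENNReal.toReal_ofReal hp0]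
  have e : ∀ ω, Real.exp (x * Set.indicator {v | v ≤ p} 1 (u ω) + y) = Real.exp y +
      (u ⁻¹' {v | v ≤ p}).indicator (fun _ => Real.exp y * (Real.exp x - 1)) ω := fun ω => by
    by_cases h : u ω ≤ p
    · simp [h, Real.exp_add]; ring
    · simp [h]
  simp_rw [e]
  rw [integral_add (integrable_const _) ((integrable_const _).indicator (hu hmeas)),
    integral_indicator (hu hmeas), setIntegral_const, hprob]
  simp
  ring

variable {Pol : Type v} [MeasurableSpace Pol] {Ω : Type u} {mΩ : MeasurableSpace Ω}
  {P : Measure Ω} [IsProbabilityMeasure P] {alg : BaseAlg Pol} {ρ : ℕ → ℝ} {δ : ℝ}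
  {f : ℕ → Pol → ℝ} {T : ℕ} {ℱ : Filtration ℕ mΩ} {𝒢 : ℕ → MeasurableSpace Ω}
  {U : ℕ → ℕ → Ω → ℝ} {π : ℕ → Ω → Pol} {g R : ℕ → Ω → ℝ}

namespace IsMasterRun

variable (hI : IsMasterRun alg ρ δ P f T ℱ 𝒢 U π g R)
include hI

/-- The seeds of a round are independent of the past, whereas the event `D t` selecting the round is
determined by it. Hence coins may be counted along an adaptively chosen set of rounds. -/
lemma expSuper_coin {D : ℕ → Set Ω} (hD : ∀ t ∈ Finset.Icc 1 T, MeasurableSet[ℱ (t - 1)] (D t))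
    (m : ℕ) {p : ℝ} (hp0 : 0 ≤ p) (hp1 : p ≤ 1) {x y : ℝ}
    (hxy : Real.exp y * (1 + p * (Real.exp x - 1)) ≤ 1) :
    ExpSuper P T ℱ fun t => (D t).indicator
      fun ω => x * Set.indicator {v | v ≤ p} 1 (U t m ω) + y := by
  have hφ : Measurable fun u : ℝ => x * Set.indicator {v | v ≤ p} 1 u + y :=
    ((measurable_one.indicator measurableSet_Iic).const_mul x).add_const y
  have hφb : ∀ u : ℝ, x * Set.indicator {v | v ≤ p} 1 u + y ≤ |x| + |y| := fun u => by
    have h1 := le_abs_self x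
    have h2 := le_abs_self y
    have h3 := abs_nonneg x
    by_cases h : u ≤ p
    · simp [h]; linarith
    · simp [h]; linarith
  refine ⟨fun t ht => ?_, ⟨|x| + |y|, fun t _ ω => ?_⟩, fun t ht W hW hW0 ⟨c, hc⟩ => ?_⟩
  · exact (hφ.comp ((hI.seed_meas t ht m).mono (hI.le_after t ht) le_rfl)).indicator
      (ℱ.mono (Nat.sub_le t 1) _ (hD t ht))
  · by_cases h : ω ∈ D t
    · rw [Set.indicator_of_mem h]; exact hφb _
    · rw [Set.indicator_of_notMem h]; positivity
  · have hU : Measurable (U t m) :=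
      (hI.seed_meas t ht m).mono ((hI.le_after t ht).trans (ℱ.le t)) le_rfl
    refine integral_mul_exp_indicator_le (ℱ.le (t - 1)) ?_
      (indep_of_indep_of_le_left (hI.seed_fresh t ht)
        (le_iSup (fun m => MeasurableSpace.comap (U t m) inferInstance) m))
      (hD t ht) (hφ.comp (comap_measurable (U t m))) (fun ω => hφb _) ?_ hW hW0 hc
    · exact hU.comap_le
    · exact (integral_exp_coin hU (hI.seed_law t ht m) hp0 hp1 x y).le.trans hxy

open Classical in
lemma coins_upper_tail {D : ℕ → Set Ω}
    (hD : ∀ t ∈ Finset.Icc 1 T, MeasurableSet[ℱ (t - 1)] (D t)) (m : ℕ) {p : ℝ} (hp0 : 0 ≤ p)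
    (hp1 : p ≤ 1) {ζ : ℝ} (hζ : 0 < ζ) :
    P {ω | 2 * p * ((Finset.Icc 1 T).filter fun τ => ω ∈ D τ).card + Real.log (1 / ζ) <
      ((Finset.Icc 1 T).filter fun τ => ω ∈ D τ ∧ U τ m ω ≤ p).card} ≤ ENNReal.ofReal ζ := by
  -- Each success counts `1` and each trial costs `2 p`; admissible because `e - 1 < 2`.
  have hxy : Real.exp (-(2 * p)) * (1 + p * (Real.exp 1 - 1)) ≤ 1 := by
    have h1 : 1 + p * (Real.exp 1 - 1) ≤ Real.exp (2 * p) := by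
      have := Real.add_one_le_exp (2 * p)
      have := Real.exp_one_lt_three
      nlinarith
    calc _ ≤ Real.exp (-(2 * p)) * Real.exp (2 * p) := by gcongr
      _ = 1 := by rw [← Real.exp_add]; simp
  refine (measure_mono fun ω hω => ?_).trans
    ((hI.expSuper_coin hD m hp0 hp1 hxy).tail le_rfl hζ)
  rw [Set.mem_ofPred_eq] at hω ⊢
  rw [sum_indicator_coin]
  linarith

open Classical in
lemma coins_lower_tail {D : ℕ → Set Ω}
    (hD : ∀ t ∈ Finset.Icc 1 T, MeasurableSet[ℱ (t - 1)] (D t)) (m : ℕ) {p : ℝ} (hp0 : 0 ≤ p)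
    (hp1 : p ≤ 1) {ζ : ℝ} (hζ : 0 < ζ) :
    P {ω | (((Finset.Icc 1 T).filter fun τ => ω ∈ D τ ∧ U τ m ω ≤ p).card : ℝ) +
      Real.log (1 / ζ) < p / 2 * ((Finset.Icc 1 T).filter fun τ => ω ∈ D τ).card} ≤
        ENNReal.ofReal ζ := by
  -- Each success counts `-1` and each trial gains `p / 2`; admissible because `exp (-1) ≤ 1 / 2`.
  have hxy : Real.exp (p / 2) * (1 + p * (Real.exp (-1) - 1)) ≤ 1 := by
    have h1 : 1 + p * (Real.exp (-1) - 1) ≤ Real.exp (-(p / 2)) := by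
      have h2 := Real.add_one_le_exp (-(p / 2))
      have h3 : Real.exp (-1) ≤ 1 / 2 := by
        rw [Real.exp_neg, ← one_div]
        exact one_div_le_one_div_of_le (by norm_num) (by linarith [Real.add_one_le_exp (1 : ℝ)])
      nlinarith
    calc _ ≤ Real.exp (p / 2) * Real.exp (-(p / 2)) := by gcongr
      _ = 1 := by rw [← Real.exp_add]; simp
  refine (measure_mono fun ω hω => ?_).trans
    ((hI.expSuper_coin hD m hp0 hp1 hxy).tail le_rfl hζ)
  rw [Set.mem_ofPred_eq] at hω ⊢
  rw [sum_indicator_coin]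
  linarith

end IsMasterRun

end Coins

/-! ### Good paths of MASTER with GLM-UCB are likely -/

section LikelyPaths

variable {κ : ℝ} {d T : ℕ} {δ : ℝ} {A : Set (EuclideanSpace ℝ (Fin d))} {μ : ℝ → ℝ} {lam : ℝ}
  {θ : ℕ → EuclideanSpace ℝ (Fin d)}

/-- The ratio of `ρhat` and `ρ`. -/
noncomputable def testFactor (T : ℕ) (δ : ℝ) : ℝ := 6 * (Real.logb 2 T + 1) * Real.log (T / δ)

lemma glmRho_eq_sqrtRate (κ₁ : ℝ) :
    glmRho κ₁ d T δ μ lam = sqrtRate (rhoCoef κ₁ d T δ μ lam) :=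
  funext fun t => glmRho_eq κ₁ t

lemma rhoHat_sqrtRate (c : ℝ) : rhoHat T δ (sqrtRate c) = sqrtRate (testFactor T δ * c) :=
  funext fun t => by rw [rhoHat, sqrtRate, sqrtRate, testFactor]; ring

lemma GlmParams.nat_log_le_logb (hp : GlmParams κ d T δ A μ lam) :
    (Nat.log 2 T : ℝ) ≤ Real.logb 2 T := by
  have h0 : (0 : ℝ) < T := by linarith [hp.two_le_T]
  rw [Real.le_logb_iff_rpow_le (by norm_num) h0, Real.rpow_natCast]
  have := Nat.pow_log_le_self 2 (x := T) (by have := hp.horizon; omega)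
  exact_mod_cast this

/-- The factor has to pay for at most `log₂ T + 1` orders, each losing `4 + log (1 / ζ)` through the
counting of instances, and once for the deviation of the rewards. -/
lemma GlmParams.testFactor_bounds (hp : GlmParams κ d T δ A μ lam) :
    1 ≤ testFactor T δ ∧ (Nat.log 2 T + 1 : ℝ) * (4 + Real.log (1 / confLevel T δ)) + 1 ≤
      4 * testFactor T δ := by
  have h1 := hp.nat_log_le_logb
  have h2 := hp.log_inv_confLevel_le
  have h3 := hp.log_two_le
  have h4 : (1 : ℝ) ≤ Nat.log 2 T := by
    exact_mod_cast Nat.le_log_of_pow_le (by norm_num) (by simpa using hp.horizon)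
  rw [testFactor]
  set ℓ := Real.logb 2 T
  set L := Real.log (T / δ)
  have h5 : (Nat.log 2 T + 1 : ℝ) * (4 + Real.log (1 / confLevel T δ)) ≤
      (ℓ + 1) * (4 + 7 * L) := by
    refine (mul_le_mul_of_nonneg_left (by linarith) (by positivity)).trans
      (mul_le_mul_of_nonneg_right (by linarith) (by linarith))
  constructor <;> nlinarith

variable (hp : GlmParams κ d T δ A μ lam) (hθ : ∀ t ∈ Finset.Icc 1 T, ‖θ t‖ ≤ 1)
  (hf : ∀ t ∈ Finset.Icc 1 T, ∀ a, glmReward A μ θ t a ∈ Set.Icc (0 : ℝ) 1)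

include hf in
lemma glmReward_le_optReward {t : ℕ} (ht : t ∈ Finset.Icc 1 T) (a : A) :
    glmReward A μ θ t a ≤ optReward (glmReward A μ θ) t :=
  le_ciSup (f := glmReward A μ θ t) ⟨1, by rintro _ ⟨b, rfl⟩; exact (hf t ht b).2⟩ a

include hp hθ hf in
lemma abs_optReward_sub_le {κ₂ : ℝ} (hκ₂ : 2 ≤ κ₂) {t : ℕ} (ht : t ∈ Finset.Ico 1 T) :
    |optReward (glmReward A μ θ) t - optReward (glmReward A μ θ) (t + 1)| ≤
      glmDelta κ₂ T δ μ θ t := by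
  have : Nonempty A := hp.nonempty.to_subtype
  have ht' := Finset.mem_Ico.1 ht
  have h1 : t ∈ Finset.Icc 1 T := by simp; omega
  have h2 : t + 1 ∈ Finset.Icc 1 T := by simp; omega
  have key := fun a => abs_le.1 (hp.abs_glmReward_sub_le hθ hκ₂ ht a)
  rw [abs_le]
  constructor
  · have : optReward (glmReward A μ θ) (t + 1) ≤
        optReward (glmReward A μ θ) t + glmDelta κ₂ T δ μ θ t := ciSup_le fun a => by
      linarith [(key a).1, glmReward_le_optReward hf h1 a]
    linarith
  · have : optReward (glmReward A μ θ) t ≤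
        optReward (glmReward A μ θ) (t + 1) + glmDelta κ₂ T δ μ θ t := ciSup_le fun a => by
      linarith [(key a).2, glmReward_le_optReward hf h2 a]
    linarith

variable {Ω : Type u} {mΩ : MeasurableSpace Ω} {P : Measure Ω} [IsProbabilityMeasure P]
  {ℱ : Filtration ℕ mΩ} {𝒢 : ℕ → MeasurableSpace Ω} {U : ℕ → ℕ → Ω → ℝ} {a : ℕ → Ω → A}
  {g R : ℕ → Ω → ℝ}

-- A union bound over four families of events: noise of an instance, deviation of rewards, too many
-- scheduled instances, too few successes among candidates. Blocks are random, so each family ranges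
-- over all possible blocks, and the event that a round belongs to a given block is part of the
-- predictable selection rule.
include hp hθ hf in
open Classical in
theorem GlmParams.goodPath (hI : IsMasterRun (glmUCB A T δ μ lam)
    (sqrtRate (rhoCoef (32 * (κ + 2)) d T δ μ lam)) δ P (glmReward A μ θ) T ℱ 𝒢 U a g R) :
    ENNReal.ofReal (1 - δ) ≤ P {ω | GoodPath T (rhoCoef (32 * (κ + 2)) d T δ μ lam)
      (testFactor T δ) (Real.log (1 / confLevel T δ)) (glmDelta (100 * (32 * (κ + 2))) T δ μ θ)
      (optReward (glmReward A μ θ)) (fun t => glmReward A μ θ t (a t ω)) (fun t => g t ω)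
      (fun t => R t ω) (fun s m => U s m ω)
      (fun t => blockAt (sqrtRate (rhoCoef (32 * (κ + 2)) d T δ μ lam)) T δ U g R t ω)} := by
  have : Nonempty A := hp.nonempty.to_subtype
  have hκ := hp.kappa
  set c := rhoCoef (32 * (κ + 2)) d T δ μ lam with hc
  set ζ := confLevel T δ with hζ
  set Δ := glmDelta (100 * (32 * (κ + 2))) T δ μ θ with hΔ
  have hζ0 : 0 < ζ := hp.confLevel_pos
  have hT := hp.horizon
  have hcl := hp.rhoCoef_lower
  have hc0 : 0 < c := zero_lt_one.trans_le hcl.2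
  set M : ℕ → Ω → Block := fun t ω => blockAt (sqrtRate c) T δ U g R t ω with hM
  set J : Block → ℕ → ℕ → ℕ → Ω → Prop := fun B m s t ω => M t ω = B ∧ s ≤ t ∧
      B.activeOrder (sqrtRate c) (fun s m => U s m ω) t = m ∧ B.instStart m t = s with hJ
  set prob : ℕ → ℕ → ℝ := fun n m => sqrtRate c (2 ^ n) / sqrtRate c (2 ^ m) with hprob
  have hprob0 : ∀ n m, 0 ≤ prob n m := fun n m =>
    div_nonneg (sqrtRate_nonneg hc0.le _) (sqrtRate_nonneg hc0.le _)
  have hprob1 : ∀ n m, m ≤ n → prob n m ≤ 1 := fun n m h => by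
    refine div_le_one_of_le₀ (sqrtRate_antitone hc0.le ?_ ?_ ?_) (sqrtRate_nonneg hc0.le _)
    · exact Nat.one_le_two_pow
    · exact Nat.one_le_two_pow
    · exact Nat.pow_le_pow_right (by norm_num) h
  set DU : Block → ℕ → ℕ → ℕ → ℕ → Set Ω := fun B m s t τ =>
    {ω | M τ ω = B ∧ s ≤ τ ∧ τ ≤ t ∧ 2 ^ m ∣ τ - B.start} with hDU
  set DL : Block → ℕ → ℕ → Set Ω := fun B m τ => {ω | M τ ω = B ∧
    IsCandidate (sqrtRate c) (sqrtRate (testFactor T δ * c)) Δ (optReward (glmReward A μ θ))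
      (fun τ => g τ ω) B m τ} with hDL
  have hDUm : ∀ B m s t, ∀ τ ∈ Finset.Icc 1 T, MeasurableSet[ℱ (τ - 1)] (DU B m s t τ) :=
    fun B m s t τ hτ => MeasurableSet.inter
      (hI.measurableSet_blockAt (Finset.mem_Icc.1 hτ).1 (Finset.mem_Icc.1 hτ).2 B)
      (MeasurableSet.const _)
  have hDLm : ∀ B m, ∀ τ ∈ Finset.Icc 1 T, MeasurableSet[ℱ (τ - 1)] (DL B m τ) :=
    fun B m τ hτ => hI.measurableSet_isCandidate hτ (sqrtRate_nonneg hc0.le _) B m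
  have hfm : ∀ t ∈ Finset.Icc 1 T, Measurable (glmReward A μ θ t) :=
    fun t _ => measurable_glmReward hp.diff θ t
  let noise : Block → ℕ → ℕ → ℕ → Set Ω := fun B m s n =>
    {ω | ¬ quadInv (subGram (fun σ => J B m s σ ω) lam (fun σ => a σ ω) (fun σ => R σ ω) n)
      (subSum (fun σ => J B m s σ ω) (fun σ => R σ ω - glmReward A μ θ σ (a σ ω))
        (fun σ => (a σ ω).1.ofLp) n) ≤
        subPotential (fun σ => J B m s σ ω) lam (fun σ => a σ ω) (fun σ => R σ ω) n +
          Real.log (1 / ζ) / 2}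
  let dev : ℕ → ℕ → ℕ → Set Ω := fun b s t => {ω | s ≤ t ∧
    8 * √(Real.log (T / δ)) * √((t - s + 1 : ℕ) : ℝ) <
      (-1) ^ b * ∑ τ ∈ Finset.Icc s t, (R τ ω - glmReward A μ θ τ (a τ ω))}
  let upper : Block → ℕ → ℕ → ℕ → Set Ω := fun B m s t => {ω | m ≤ B.order ∧
    2 * prob B.order m * ((Finset.Icc 1 T).filter fun τ => ω ∈ DU B m s t τ).card +
      Real.log (1 / ζ) < ((Finset.Icc 1 T).filter fun τ =>
        ω ∈ DU B m s t τ ∧ U τ m ω ≤ prob B.order m).card}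
  let lower : Block → ℕ → Set Ω := fun B m => {ω | m ≤ B.order ∧
    (((Finset.Icc 1 T).filter fun τ => ω ∈ DL B m τ ∧ U τ m ω ≤ prob B.order m).card : ℝ) +
      Real.log (1 / ζ) <
        prob B.order m / 2 * ((Finset.Icc 1 T).filter fun τ => ω ∈ DL B m τ).card}
  -- One index set serves all families: start and order of the block, order of the instance, and two
  -- rounds. The shift in the noise family is due to history lengths starting at `0`; in the
  -- deviation family the first coordinate only encodes the sign, through its parity; the last
  -- family ignores the two rounds.
  let bad : Fin 4 × ℕ × ℕ × ℕ × ℕ × ℕ → Set Ω := fun i =>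
    ![noise ⟨i.2.1, i.2.2.1⟩ i.2.2.2.1 i.2.2.2.2.1 (i.2.2.2.2.2 - 1),
      dev i.2.1 i.2.2.2.2.1 i.2.2.2.2.2,
      upper ⟨i.2.1, i.2.2.1⟩ i.2.2.2.1 i.2.2.2.2.1 i.2.2.2.2.2,
      lower ⟨i.2.1, i.2.2.1⟩ i.2.2.2.1] i.1
  refine ofReal_one_sub_le_of_union ((Finset.univ : Finset (Fin 4)) ×ˢ Finset.Icc 1 T ×ˢ
    Finset.range T ×ˢ Finset.range T ×ˢ Finset.Icc 1 T ×ˢ Finset.Icc 1 T) bad hζ0.le ?_ ?_ ?_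
  · rintro ⟨k, b, n, m, s, t⟩ hi
    simp only [Finset.mem_product, Finset.mem_range, Finset.mem_Icc] at hi
    obtain ⟨-, hb, hn, hm, hs, ht⟩ := hi
    fin_cases k
    · exact noise_tail hI.toInteraction hp.diff hf
        (fun t ht => hI.measurableSet_active ht ⟨b, n⟩ m s) hp.lam_pos (show t - 1 ≤ T by omega) hζ0
    · by_cases hst : s ≤ t
      · have := hI.toInteraction.deviation_tail hfm hf hp.log_pos hζ0 hp.log_inv_confLevel_le
          hs.1 hst ht.2 (neg_one_pow_eq_or ℝ b)
        exact (measure_mono fun ω hω => hω.2).trans this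
      · have e : dev b s t = ∅ := Set.eq_empty_of_forall_notMem fun ω hω => hst hω.1
        change P (dev b s t) ≤ _
        rw [e]; simp
    · by_cases hmn : m ≤ n
      · change P (upper ⟨b, n⟩ m s t) ≤ _
        refine (measure_mono fun ω hω => ?_).trans (hI.coins_upper_tail
          (hDUm ⟨b, n⟩ m s t) m (hprob0 n m) (hprob1 n m hmn) hζ0)
        rw [Set.mem_ofPred_eq]
        convert hω.2
      · have e : upper ⟨b, n⟩ m s t = ∅ := Set.eq_empty_of_forall_notMem fun ω hω => hmn hω.1
        change P (upper ⟨b, n⟩ m s t) ≤ _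
        rw [e]; simp
    · by_cases hmn : m ≤ n
      · change P (lower ⟨b, n⟩ m) ≤ _
        refine (measure_mono fun ω hω => ?_).trans (hI.coins_lower_tail
          (hDLm ⟨b, n⟩ m) m (hprob0 n m) (hprob1 n m hmn) hζ0)
        rw [Set.mem_ofPred_eq]
        convert hω.2
      · have e : lower ⟨b, n⟩ m = ∅ := Set.eq_empty_of_forall_notMem fun ω hω => hmn hω.1
        change P (lower ⟨b, n⟩ m) ≤ _
        rw [e]; simp
  · simp only [Finset.card_product, Finset.card_univ, Fintype.card_fin, Nat.card_Icc,
      Finset.card_range, Nat.add_sub_cancel]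
    have hT0 : (0 : ℝ) < T := by linarith [hp.two_le_T]
    -- The index set has exactly `4 T ^ 5` elements, which is where the denominator of the
    -- confidence level comes from.
    rw [hζ, confLevel]
    push_cast
    apply le_of_eq
    field_simp
  · intro ω hω
    have hmem : ∀ k b n m s t, b ∈ Finset.Icc 1 T → n < T → m < T → s ∈ Finset.Icc 1 T →
        t ∈ Finset.Icc 1 T → ω ∉ bad (k, b, n, m, s, t) := fun k b n m s t hb hn hm hs ht =>
      hω _ (by
        simp only [Finset.mem_product, Finset.mem_range, Finset.mem_univ, true_and]
        exact ⟨hb, hn, hm, hs, ht⟩)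
    have h1T : 1 ∈ Finset.Icc 1 T := by simp; omega
    have hnoise : ∀ B m s n, 1 ≤ B.start → B.start ≤ T → B.order < T → m < T →
        s ∈ Finset.Icc 1 T → n < T → ω ∉ noise B m s n :=
      fun B m s n h1 h2 h3 h4 h5 h6 => by
        have := hmem 0 B.start B.order m s (n + 1) (by simp; omega) h3 h4 h5 (by simp; omega)
        simpa [bad] using this
    have hdev : ∀ s t, 1 ≤ s → s ≤ t → t ≤ T → ω ∉ dev 1 s t ∧ ω ∉ dev 2 s t :=
      fun s t h1 h2 h3 => by
        have e1 := hmem 1 1 0 0 s t h1T (by omega) (by omega) (by simp; omega) (by simp; omega)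
        have e2 := hmem 1 2 0 0 s t (by simp; omega) (by omega) (by omega) (by simp; omega)
          (by simp; omega)
        exact ⟨e1, e2⟩
    have hupper : ∀ B m s t, 1 ≤ B.start → B.start ≤ T → B.order < T → m < T →
        s ∈ Finset.Icc 1 T → t ∈ Finset.Icc 1 T → ω ∉ upper B m s t :=
      fun B m s t h1 h2 h3 h4 h5 h6 => hmem 2 B.start B.order m s t (by simp; omega) h3 h4 h5 h6
    have hlower : ∀ B m, 1 ≤ B.start → B.start ≤ T → B.order < T → m < T → ω ∉ lower B m :=
      fun B m h1 h2 h3 h4 => hmem 3 B.start B.order m 1 1 (by simp; omega) h3 h4 h1T h1T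
    have hseq := isBlockSeq_blockAt (sqrtRate c) T δ U g R ω
    have hactive : ∀ B m s τ, τ ∈ Finset.Icc 1 T → J B m s τ ω → glmUCB A T δ μ lam
        (subHistory (fun σ => J B m s σ ω) (fun σ => a σ ω) (fun σ => R σ ω) (τ - 1))
        (a τ ω) (g τ ω) := by
      rintro B m s τ hτ ⟨rfl, -, h1, h2⟩
      have h3 := hI.step τ hτ ω
      have h4 := activeHistory_eq_subHistory hseq (sqrtRate c) (fun s m => U s m ω)
        (fun σ => a σ ω) (fun σ => R σ ω) (Finset.mem_Icc.1 hτ).1 h1 h2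
      rw [← h4]
      exact h3
    have hpow : ∀ B : Block, ∀ m, ∀ τ ∈ Finset.Icc 1 T, M τ ω = B → m ≤ B.order → 2 ^ m ∣ τ - B.start →
        (B.Scheduled (sqrtRate c) (fun s m => U s m ω) m τ ↔ U τ m ω ≤ prob B.order m) := by
      rintro B m τ hτ rfl hm hd
      have hb := hseq.bounds (Finset.mem_Icc.1 hτ).1
      exact ⟨fun h => h.2.2.2.2, fun h => ⟨hm, hb.1, hb.2.1, hd, h⟩⟩
    exact
      { one_le_c := hcl.2
        one_le_h := hp.testFactor_bounds.1
        Lg_nonneg := by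
          have hT1 : (1 : ℝ) ≤ T := by linarith [hp.two_le_T]
          have hT5 := one_le_pow₀ hT1 (n := 5)
          refine Real.log_nonneg ((one_le_div hζ0).2 ?_)
          rw [hζ, confLevel, div_le_one (by positivity)]
          linarith [hp.delta_lt]
        h_large := hp.testFactor_bounds.2
        drift_nonneg := glmDelta_nonneg (by linarith) hp θ
        blockSeq := by
          have := hseq
          rw [rhoHat_sqrtRate] at this
          exact this
        seed_le := fun t ht m => (hI.seed_mem t ht m ω).2
        mean_le := fun t ht => glmReward_le_optReward hf ht _
        opt_le := fun t ht => ciSup_le fun b => (hf t ht b).2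
        scalar_mem := fun t ht => by
          obtain ⟨θhat, -, -, h⟩ := hI.step t ht ω
          rw [h]
          exact ⟨le_max_left _ _, max_le zero_le_one (min_le_left _ _)⟩
        reward_nonneg := fun t ht => (hI.reward_mem t ht ω).1
        opt_sub_le := fun t ht => abs_optReward_sub_le hp hθ hf (by linarith) ht
        instance_guarantee := by
          intro B m s t hs hst ht hB hm hb1 hbT hdr
          have key := hp.instance_guarantee hθ hf (J := fun τ => J B m s τ ω) hst ht
            (fun τ _ h => h.2.1)
            (fun τ hτ h => hactive B m s τ (by rw [Finset.mem_Icc] at hτ ⊢; omega) h)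
            (fun n hn => not_not.1 (hnoise B m s n hb1 hbT hB (by omega) (by simp; omega) hn))
            (by rw [glmRho_eq_sqrtRate]; exact hdr)
          rw [instRounds]
          convert key
        deviation := by
          intro s t hs hst ht
          obtain ⟨h1, h2⟩ := hdev s t hs hst ht
          simp only [dev, Set.mem_ofPred_eq, not_and, not_lt] at h1 h2
          have h3 := h1 hst
          have h4 := h2 hst
          have h5 := mul_le_mul_of_nonneg_right hcl.1 (Real.sqrt_nonneg ((t - s + 1 : ℕ) : ℝ))
          have h6 := Real.sqrt_nonneg (Real.log (T / δ))
          have h7 := mul_nonneg h6 (Real.sqrt_nonneg ((t - s + 1 : ℕ) : ℝ))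
          rw [abs_le]
          constructor <;> nlinarith
        coins_upper := by
          intro B m s t hs hst ht hB hm hb1 hbT
          have h1 := hupper B m s t hb1 hbT hB (by omega) (by simp; omega) (by simp; omega)
          simp only [upper, Set.mem_ofPred_eq, not_and, not_lt] at h1
          have h2 := h1 hm
          have e1 : (Finset.Icc 1 T).filter (fun τ => ω ∈ DU B m s t τ) =
              (Finset.Icc s t).filter fun τ => M τ ω = B ∧ 2 ^ m ∣ τ - B.start := by
            ext τ
            simp only [Finset.mem_filter, Finset.mem_Icc, hDU, Set.mem_ofPred_eq]
            constructor
            · rintro ⟨-, h3, h4, h5, h6⟩; exact ⟨⟨h4, h5⟩, h3, h6⟩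
            · rintro ⟨⟨h4, h5⟩, h3, h6⟩; exact ⟨⟨by omega, by omega⟩, h3, h4, h5, h6⟩
          have e2 : (Finset.Icc s t).filter (fun τ => M τ ω = B ∧
                B.Scheduled (sqrtRate c) (fun s m => U s m ω) m τ) =
              (Finset.Icc 1 T).filter fun τ =>
                ω ∈ DU B m s t τ ∧ U τ m ω ≤ prob B.order m := by
            ext τ
            simp only [Finset.mem_filter, Finset.mem_Icc, hDU, Set.mem_ofPred_eq]
            constructor
            · rintro ⟨⟨h4, h5⟩, h3, h6⟩
              exact ⟨⟨by omega, by omega⟩, ⟨h3, h4, h5, h6.2.2.2.1⟩, h6.2.2.2.2⟩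
            · rintro ⟨h7, ⟨h3, h4, h5, h6⟩, h8⟩
              exact ⟨⟨h4, h5⟩, h3, (hpow B m τ (Finset.mem_Icc.2 h7) h3 hm h6).2 h8⟩
          rw [e1, ← e2] at h2
          exact h2
        coins_lower := by
          intro B m hB hm hb1 hbT
          have h1 := hlower B m hb1 hbT hB (by omega)
          simp only [lower, Set.mem_ofPred_eq, not_and, not_lt] at h1
          have h2 := h1 hm
          have e2 : (Finset.Icc 1 T).filter (fun τ => ω ∈ DL B m τ ∧ U τ m ω ≤ prob B.order m) =
              (Finset.Icc 1 T).filter fun τ => ω ∈ DL B m τ ∧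
                B.Scheduled (sqrtRate c) (fun s m => U s m ω) m τ :=
            Finset.filter_congr fun τ hτ => and_congr_right fun h3 =>
              (hpow B m τ hτ h3.1 hm h3.2.1).symm
          rw [e2] at h2
          exact h2 }

end LikelyPaths


/-! ### From the number of nearly stationary pieces to the final rates -/

section Rates

/-- If `N` is the number of pieces forced by the total drift `D`, then `c √(N T)` is of order
`c ^ (2 / 3) D ^ (1 / 3) T ^ (2 / 3)`. -/
lemma mul_sqrt_pow_three_le {N T D c : ℝ} (hN : 0 ≤ N) (hT : 0 < T) (hD : 0 ≤ D) (hc : 0 < c)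
    (h : ∀ z : ℝ, 0 < z → N ≤ √(2 * z) * D / c + T / (3 * z)) :
    (c * √(N * T)) ^ 3 ≤ 3 * c ^ 2 * D * T ^ 2 := by
  rcases hN.eq_or_lt with rfl | hN0
  · simp; positivity
  -- The scale is the average length of a piece: the second term becomes `N / 3`, which is absorbed
  -- on the left.
  have h1 := h (T / N) (by positivity)
  have hsN : 0 < √N := Real.sqrt_pos.2 hN0
  have hsT : 0 < √T := Real.sqrt_pos.2 hT
  have hNN : √N * √N = N := Real.mul_self_sqrt hN
  have hTT : √T * √T = T := Real.mul_self_sqrt hT.le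
  have e1 : T / (3 * (T / N)) = N / 3 := by field_simp
  have e2 : √(2 * (T / N)) = √2 * (√T / √N) := by
    rw [Real.sqrt_mul (by norm_num), Real.sqrt_div hT.le]
  rw [e1, e2] at h1
  have h2 : √2 ≤ 3 / 2 := by rw [Real.sqrt_le_iff]; norm_num
  have h3 : 2 / 3 * N ≤ 3 / 2 * (√T / √N) * D / c := by
    have : √2 * (√T / √N) * D / c ≤ 3 / 2 * (√T / √N) * D / c := by gcongr
    linarith
  have h4 : c * √N ^ 3 ≤ 3 * √T * D := by
    have e : 3 / 2 * (√T / √N) * D / c = 3 / 2 * √T * D / (√N * c) := by field_simp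
    rw [e, le_div_iff₀ (by positivity)] at h3
    have : c * √N ^ 3 = N * (√N * c) := by linear_combination c * √N * hNN
    have : 0 ≤ √T * D := by positivity
    nlinarith
  rw [Real.sqrt_mul hN]
  calc (c * (√N * √T)) ^ 3 = c ^ 2 * √T ^ 3 * (c * √N ^ 3) := by ring
    _ ≤ c ^ 2 * √T ^ 3 * (3 * √T * D) := by gcongr
    _ = 3 * c ^ 2 * D * ((√T * √T) * (√T * √T)) := by ring
    _ = 3 * c ^ 2 * D * T ^ 2 := by rw [hTT]; ring

variable {κ : ℝ} {d T : ℕ} {δ : ℝ} {A : Set (EuclideanSpace ℝ (Fin d))} {μ : ℝ → ℝ} {lam : ℝ}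
  {θ : ℕ → EuclideanSpace ℝ (Fin d)}

lemma GlmParams.rhoCoef_le (hp : GlmParams κ d T δ A μ lam) {κ₁ : ℝ} (hκ₁ : 0 ≤ κ₁) :
    rhoCoef κ₁ d T δ μ lam ≤
      16 * κ * κ₁ * (kLink μ / cLink μ * d) * Real.log (T / δ) := by
  have hL := hp.log_pos
  have h1 := hp.beta_le
  have h2 : 0 ≤ √(d * Real.log (T / δ)) := Real.sqrt_nonneg _
  have h3 : √(d * Real.log (T / δ)) * √(d * Real.log (T / δ)) = d * Real.log (T / δ) :=
    Real.mul_self_sqrt (by positivity)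
  rw [rhoCoef]
  calc κ₁ * glmBeta d T δ μ lam * √(d * Real.log (T / δ))
      ≤ κ₁ * (16 * κ * (kLink μ / cLink μ) * √(d * Real.log (T / δ))) *
        √(d * Real.log (T / δ)) := by gcongr
    _ = 16 * κ * κ₁ * (kLink μ / cLink μ) *
        (√(d * Real.log (T / δ)) * √(d * Real.log (T / δ))) := by ring
    _ = _ := by rw [h3]; ring

lemma pieceCount_le_numPieces (hp : GlmParams κ d T δ A μ lam) {c κ₂ : ℝ} (hc : 0 ≤ c) :
    pieceCount (sqrtRate c) (glmDelta κ₂ T δ μ θ) T ≤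
      numPieces (fun t => ‖θ t - θ (t + 1)‖) T := by
  classical
  have hT : 1 ≤ T := by have := hp.horizon; omega
  have hps := pieceStart_bounds (Δ := glmDelta κ₂ T δ μ θ) (sqrtRate_nonneg hc 1) hT
  refine (pieceCount_le_changes (sqrtRate_nonneg hc) hT).trans ?_
  rw [numPieces]
  refine Nat.add_le_add_left (Finset.card_le_card fun τ hτ => ?_) 1
  rw [Finset.mem_filter, Finset.mem_Ico] at hτ ⊢
  refine ⟨⟨hτ.1.1, by omega⟩, fun h => hτ.2 ?_⟩
  rw [glmDelta, h]; ring

/-- The first piece is not forced by any drift and gives the term in `√T`. The remaining pieces are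
bounded by the total drift. -/
lemma mul_sqrt_pieces_le (hp : GlmParams κ d T δ A μ lam) {c κ₂ : ℝ} (hc : 0 < c)
    (hκ₂ : 0 ≤ κ₂) :
    c * √((pieceCount (sqrtRate c) (glmDelta κ₂ T δ μ θ) T : ℝ) * T) ≤ c * √T +
      (3 * c ^ 2 * drift (glmDelta κ₂ T δ μ θ) 1 T * (T : ℝ) ^ 2) ^ ((1 : ℝ) / 3) := by
  have hT : 1 ≤ T := by have := hp.horizon; omega
  have hT0 : (0 : ℝ) < T := by exact_mod_cast hT
  set Δ := glmDelta κ₂ T δ μ θ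
  have hΔ : ∀ t, 0 ≤ Δ t := glmDelta_nonneg hκ₂ hp θ
  have hps := pieceStart_bounds (Δ := Δ) (sqrtRate_nonneg hc.le 1) hT
  have hℓ1 : 1 ≤ pieceCount (sqrtRate c) Δ T := by
    rw [← pieceCount_one (ρ := sqrtRate c) (Δ := Δ)]; exact pieceCount_mono hT
  have hℓ : (1 : ℝ) ≤ pieceCount (sqrtRate c) Δ T := by exact_mod_cast hℓ1
  have hD0 : 0 ≤ drift Δ 1 T := Finset.sum_nonneg fun t _ => hΔ t
  have hD : drift Δ 1 (pieceStart (sqrtRate c) Δ T) ≤ drift Δ 1 T :=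
    drift_mono hΔ le_rfl hps.2.1
  have hpT : (pieceStart (sqrtRate c) Δ T : ℝ) ≤ T := by exact_mod_cast hps.2.1
  set N : ℝ := (pieceCount (sqrtRate c) Δ T : ℝ) - 1 with hN
  have hcube := mul_sqrt_pow_three_le (N := N) (by linarith) hT0 hD0 hc fun z hz => by
    refine (pieceCount_le_drift (ρ := sqrtRate c) hc hz (fun _ => rfl) hT).trans ?_
    gcongr
    linarith
  have h1 : c * √(N * T) ≤ (3 * c ^ 2 * drift Δ 1 T * (T : ℝ) ^ 2) ^ ((1 : ℝ) / 3) := by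
    have h0 : 0 ≤ c * √(N * T) := by positivity
    calc c * √(N * T) = ((c * √(N * T)) ^ 3) ^ ((1 : ℝ) / 3) := by
          rw [← Real.rpow_natCast, ← Real.rpow_mul h0]; norm_num
      _ ≤ _ := Real.rpow_le_rpow (by positivity) hcube (by norm_num)
  have h2 : √((pieceCount (sqrtRate c) Δ T : ℝ) * T) ≤ √T + √(N * T) := by
    have e : (pieceCount (sqrtRate c) Δ T : ℝ) * T = T + N * T := by rw [hN]; ring
    rw [e]
    have hNT : 0 ≤ N * T := mul_nonneg (by linarith) hT0.le
    rw [Real.sqrt_le_iff]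
    refine ⟨by positivity, ?_⟩
    rw [add_sq, Real.sq_sqrt hT0.le, Real.sq_sqrt hNT]
    have : 0 ≤ 2 * √T * √(N * T) := by positivity
    linarith
  calc _ ≤ c * (√T + √(N * T)) := by gcongr
    _ ≤ _ := by rw [mul_add]; gcongr

/-- The drift term of the regret bound. -/
lemma rpow_drift_le (hp : GlmParams κ d T δ A μ lam) {c κ₂ Y a : ℝ} (hc : 0 < c)
    (hκ₂ : 1 ≤ κ₂) (ha : 1 ≤ a) (hY : 1 ≤ Y) (hLY : Real.log (T / δ) ≤ Y)
    (hca : c ≤ a * (kLink μ / cLink μ * d) * Y) :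
    (3 * c ^ 2 * drift (glmDelta κ₂ T δ μ θ) 1 T * (T : ℝ) ^ 2) ^ ((1 : ℝ) / 3) ≤
      3 * a ^ 2 * κ₂ * Y * (kLink μ ^ ((4 : ℝ) / 3) / cLink μ * d *
        drift (fun t => ‖θ t - θ (t + 1)‖) 1 T ^ ((1 : ℝ) / 3) * (T : ℝ) ^ ((2 : ℝ) / 3)) := by
  have hk := hp.k_pos
  have hcl := hp.c_pos
  set D := drift (fun t => ‖θ t - θ (t + 1)‖) 1 T with hD
  have hD0 : 0 ≤ D := Finset.sum_nonneg fun _ _ => norm_nonneg _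
  set V := kLink μ ^ ((4 : ℝ) / 3) / cLink μ * d * D ^ ((1 : ℝ) / 3) * (T : ℝ) ^ ((2 : ℝ) / 3)
    with hV
  have hV0 : 0 ≤ V := by positivity
  -- Cubing avoids fractional powers: the square of `c` brings `(k_μ d / c_μ) ^ 2` and the drift
  -- brings `k_μ ^ 2 d / c_μ`. The product has `k_μ ^ 4`, hence the exponent `4 / 3` in the rate.
  have hV3 : V ^ 3 = kLink μ ^ 4 / cLink μ ^ 3 * d ^ 3 * D * (T : ℝ) ^ 2 := by
    have e1 : (kLink μ ^ ((4 : ℝ) / 3)) ^ 3 = kLink μ ^ 4 := by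
      rw [← Real.rpow_natCast, ← Real.rpow_mul hk.le, ← Real.rpow_natCast]; norm_num
    have e2 : (D ^ ((1 : ℝ) / 3)) ^ 3 = D := by
      rw [← Real.rpow_natCast, ← Real.rpow_mul hD0]; norm_num
    have e3 : ((T : ℝ) ^ ((2 : ℝ) / 3)) ^ 3 = (T : ℝ) ^ 2 := by
      rw [← Real.rpow_natCast, ← Real.rpow_mul (Nat.cast_nonneg T), ← Real.rpow_natCast]; norm_num
    rw [hV, mul_pow, mul_pow, mul_pow, div_pow, e1, e2, e3]
  have hsq : √(Real.log (T / δ)) ≤ Y := by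
    rw [Real.sqrt_le_iff]; constructor <;> nlinarith
  have hdr : drift (glmDelta κ₂ T δ μ θ) 1 T ≤ κ₂ * (kLink μ ^ 2 * d / cLink μ * Y * D) := by
    rw [drift_glmDelta, hD, drift]; gcongr
  have hb : 1 ≤ 3 * a ^ 2 * κ₂ := by nlinarith [one_le_pow₀ ha (n := 2)]
  have hb3 : 3 * a ^ 2 * κ₂ ≤ (3 * a ^ 2 * κ₂) ^ 3 := le_self_pow₀ hb (by norm_num)
  have hdr0 : 0 ≤ drift (glmDelta κ₂ T δ μ θ) 1 T :=
    Finset.sum_nonneg fun t _ => glmDelta_nonneg (by linarith) hp θ t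
  have hcube : 3 * c ^ 2 * drift (glmDelta κ₂ T δ μ θ) 1 T * (T : ℝ) ^ 2 ≤
      (3 * a ^ 2 * κ₂ * Y * V) ^ 3 := by
    calc 3 * c ^ 2 * drift (glmDelta κ₂ T δ μ θ) 1 T * (T : ℝ) ^ 2
        ≤ 3 * (a * (kLink μ / cLink μ * d) * Y) ^ 2 *
          (κ₂ * (kLink μ ^ 2 * d / cLink μ * Y * D)) * (T : ℝ) ^ 2 := by gcongr
      _ = (3 * a ^ 2 * κ₂) * (Y ^ 3 * V ^ 3) := by rw [hV3]; field_simp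
      _ ≤ (3 * a ^ 2 * κ₂) ^ 3 * (Y ^ 3 * V ^ 3) := by gcongr
      _ = _ := by ring
  refine (Real.rpow_le_rpow (by positivity) hcube (by norm_num)).trans (le_of_eq ?_)
  rw [← Real.rpow_natCast, ← Real.rpow_mul (by positivity)]
  norm_num

/-- The constant in the final rates. -/
noncomputable def rateConst (κ κ₁ κ₂ : ℝ) : ℝ :=
  67584 * (16 * κ * κ₁ + 3 * (16 * κ * κ₁) ^ 2 * κ₂)

/-- The dynamic regret along a good path, in terms of the parameters of the problem. -/
theorem GoodPath.dynRegret_le (hp : GlmParams κ d T δ A μ lam) {κ₁ κ₂ Y : ℝ} (hκ₁ : 1 ≤ κ₁)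
    (hκ₂ : 1 ≤ κ₂) (hY : Y = Real.log (T / δ) / Real.log 2) {fs F g R : ℕ → ℝ} {U : ℕ → ℕ → ℝ}
    {M : ℕ → Block} (H : GoodPath T (rhoCoef κ₁ d T δ μ lam) (testFactor T δ)
      (Real.log (1 / confLevel T δ)) (glmDelta κ₂ T δ μ θ) fs F g R U M) :
    ∑ t ∈ Finset.Icc 1 T, (fs t - R t) ≤ rateConst κ κ₁ κ₂ * Y ^ 6 *
      min (kLink μ / cLink μ * d * √(numPieces (fun t => ‖θ t - θ (t + 1)‖) T * T))
        (kLink μ ^ ((4 : ℝ) / 3) / cLink μ * d *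
          drift (fun t => ‖θ t - θ (t + 1)‖) 1 T ^ ((1 : ℝ) / 3) * (T : ℝ) ^ ((2 : ℝ) / 3) +
            kLink μ / cLink μ * d * √T) := by
  have hκ := hp.kappa
  have hk := hp.k_pos
  have hcl := hp.c_pos
  have hT : 1 ≤ T := by have := hp.horizon; omega
  have hL := hp.log_pos
  have hlog2 : 0 < Real.log 2 := Real.log_pos (by norm_num)
  have hlog2' : Real.log 2 < 1 := by linarith [Real.log_two_lt_d9]
  have hLY : Real.log (T / δ) ≤ Y := by
    rw [hY, le_div_iff₀ hlog2]; nlinarith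
  have hY1 : 1 ≤ Y := by
    rw [hY, one_le_div hlog2]; exact Real.log_le_log (by norm_num) hp.two_le_ratio
  have hlogb : Real.logb 2 T ≤ Y := by
    rw [hY, Real.logb]
    have := Real.log_le_log (by linarith [hp.two_le_T]) hp.T_le_ratio
    gcongr
  have hlogb0 : 0 ≤ Real.logb 2 T := (Nat.cast_nonneg _).trans hp.nat_log_le_logb
  set a := 16 * κ * κ₁ with ha
  have ha1 : 1 ≤ a := by rw [ha]; nlinarith
  set c := rhoCoef κ₁ d T δ μ lam with hc
  have hc0 : 0 < c := H.c_pos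
  have hca : c ≤ a * (kLink μ / cLink μ * d) * Y :=
    (hp.rhoCoef_le (by linarith)).trans (by gcongr)
  have htf : testFactor T δ ≤ 12 * Y ^ 2 := by
    rw [testFactor]
    calc _ ≤ 6 * (Y + Y) * Y := by gcongr
      _ = _ := by ring
  have hLg : 1 + Real.log (1 / confLevel T δ) ≤ 8 * Y := by linarith [hp.log_inv_confLevel_le]
  have hnl : (Nat.log 2 T + 1 : ℝ) ≤ 2 * Y := by linarith [hp.nat_log_le_logb]
  have hLg0 := H.Lg_nonneg
  set X := √((pieceCount (sqrtRate c) (glmDelta κ₂ T δ μ θ) T : ℝ) * T) with hX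
  have hX0 : 0 ≤ X := Real.sqrt_nonneg _
  -- The constant is `176 * 12 * 2 ^ 2 * 8`: test factor, number of orders squared, and coin
  -- fluctuation. They carry `Y ^ 5`; the sixth power comes from `c` or from the drift term.
  have hreg : ∑ t ∈ Finset.Icc 1 T, (fs t - R t) ≤ 67584 * Y ^ 5 * (c * X) := by
    have htf1 := H.one_le_h
    calc _ ≤ _ := H.regret_le hT
      _ ≤ 176 * (12 * Y ^ 2 * c) * (2 * Y) ^ 2 * (8 * Y) * X := by gcongr
      _ = _ := by ring
  set S := kLink μ / cLink μ * d with hS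
  have hS0 : 0 ≤ S := by rw [hS]; positivity
  set V := kLink μ ^ ((4 : ℝ) / 3) / cLink μ * d *
    drift (fun t => ‖θ t - θ (t + 1)‖) 1 T ^ ((1 : ℝ) / 3) * (T : ℝ) ^ ((2 : ℝ) / 3) with hV
  have hV0 : 0 ≤ V := by
    have : 0 ≤ drift (fun t => ‖θ t - θ (t + 1)‖) 1 T :=
      Finset.sum_nonneg fun _ _ => norm_nonneg _
    rw [hV]; positivity
  set b := 3 * a ^ 2 * κ₂ with hb
  have hb0 : 0 ≤ b := by rw [hb]; positivity
  rw [mul_min_of_nonneg _ _ (by rw [rateConst]; positivity), rateConst, ← ha, ← hb]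
  refine le_min ?_ ?_
  · have hX1 : X ≤ √(numPieces (fun t => ‖θ t - θ (t + 1)‖) T * T) := by
      refine Real.sqrt_le_sqrt ?_
      gcongr
      exact_mod_cast pieceCount_le_numPieces hp hc0.le
    set W := √((numPieces (fun t => ‖θ t - θ (t + 1)‖) T : ℝ) * T)
    calc _ ≤ _ := hreg
      _ ≤ 67584 * Y ^ 5 * ((a * S * Y) * W) := by gcongr
      _ = 67584 * a * Y ^ 6 * (S * W) := by ring
      _ ≤ 67584 * (a + b) * Y ^ 6 * (S * W) := by gcongr; linarith
  · have h1 := mul_sqrt_pieces_le (θ := θ) hp hc0 (by linarith : 0 ≤ κ₂)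
    have h2 := rpow_drift_le (θ := θ) hp hc0 hκ₂ ha1 hY1 hLY hca
    have h3 : c * X ≤ a * S * Y * √T + b * Y * V := h1.trans (add_le_add (by gcongr) h2)
    calc _ ≤ _ := hreg
      _ ≤ 67584 * Y ^ 5 * (a * S * Y * √T + b * Y * V) := by gcongr
      _ = 67584 * Y ^ 6 * (a * (S * √T) + b * V) := by ring
      _ ≤ 67584 * Y ^ 6 * ((a + b) * (S * √T) + (a + b) * V) := by gcongr <;> linarith
      _ = _ := by ring

end Rates

/-! ### The final theorem -/

theorem mainTheorem5 (κ : ℝ) (hκ : 1 ≤ κ) :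
    ∃ (κ₁ κ₂ K : ℝ) (p : ℕ), 0 < κ₁ ∧ 0 < κ₂ ∧ 0 < K ∧
      ∀ (d : ℕ) (_ : 1 ≤ d) (T : ℕ) (_ : 2 ≤ T) (δ : ℝ) (_ : 0 < δ) (_ : δ < 1)
        (A : Set (EuclideanSpace ℝ (Fin d))) (_ : IsCompact A) (_ : A.Nonempty)
        (_ : ∀ a ∈ A, ‖a‖ ≤ 1)
        (μ : ℝ → ℝ) (_ : Differentiable ℝ μ) (_ : Monotone μ)
        (_ : BddAbove (deriv μ '' Set.Icc (-1) 1)) (_ : 0 < cLink μ)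
        (lam : ℝ) (_ : ((T : ℝ) / δ) ^ (-κ) ≤ lam) (_ : lam ≤ cLink μ * Real.sqrt (T / δ))
        (_ : cLink μ ≤ ((T : ℝ) / δ) ^ κ) (_ : cLink μ * Real.sqrt lam ≤ κ * Real.sqrt d)
        (θ : ℕ → EuclideanSpace ℝ (Fin d)) (_ : ∀ t ∈ Finset.Icc 1 T, ‖θ t‖ ≤ 1)
        (_ : ∀ t ∈ Finset.Icc 1 T, ∀ a, glmReward A μ θ t a ∈ Set.Icc (0 : ℝ) 1),
        -- GLM-UCB satisfies the assumption on base algorithms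
        Assumption1.{u, 0} (glmUCB A T δ μ lam) (glmReward A μ θ) T δ
          (glmDelta κ₂ T δ μ θ) (glmRho κ₁ d T δ μ lam) ∧
        -- the order of `C(t) = t ρ(t)`
        (∀ t ∈ Finset.Icc 1 T, (t : ℝ) * glmRho κ₁ d T δ μ lam t ≤
          K * Real.log (T / δ) ^ p * (kLink μ * d / cLink μ * Real.sqrt t)) ∧
        -- the order of `Δ(t)`
        (∀ t ∈ Finset.Ico 1 T,
          glmDelta κ₂ T δ μ θ t ≤
            K * Real.log (T / δ) ^ p * (kLink μ ^ 2 * d / cLink μ * ‖θ t - θ (t + 1)‖) ∧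
          kLink μ ^ 2 * d / cLink μ * ‖θ t - θ (t + 1)‖ ≤
            K * Real.log (T / δ) ^ p * glmDelta κ₂ T δ μ θ t) ∧
        -- the dynamic regret of MASTER with GLM-UCB
        ∀ (Ω : Type u) (mΩ : MeasurableSpace Ω) (P : Measure Ω) [IsProbabilityMeasure P]
          (ℱ : Filtration ℕ mΩ) (𝒢 : ℕ → MeasurableSpace Ω) (U : ℕ → ℕ → Ω → ℝ)
          (a : ℕ → Ω → A) (g R : ℕ → Ω → ℝ),
          IsMasterRun (glmUCB A T δ μ lam) (glmRho κ₁ d T δ μ lam) δ P (glmReward A μ θ) T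
            ℱ 𝒢 U a g R →
          ENNReal.ofReal (1 - δ) ≤ P {ω |
            dynRegret (glmReward A μ θ) T (fun t => R t ω) ≤
              K * Real.log (T / δ) ^ p *
                min (kLink μ / cLink μ * d *
                    Real.sqrt (numPieces (fun t => ‖θ t - θ (t + 1)‖) T * T))
                  (kLink μ ^ ((4 : ℝ) / 3) / cLink μ * d *
                      drift (fun t => ‖θ t - θ (t + 1)‖) 1 T ^ ((1 : ℝ) / 3) *
                      (T : ℝ) ^ ((2 : ℝ) / 3) +
                    kLink μ / cLink μ * d * Real.sqrt T)} := by
  -- A quarter of `κ₁` is the constant in the regret of one instance. The ratio `κ₂ / κ₁ = 100`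
  -- makes the bias at most a hundredth of the confidence radius while the drift is at most `ρ`.
  set κ₁ : ℝ := 32 * (κ + 2) with hκ₁
  set κ₂ : ℝ := 100 * (32 * (κ + 2)) with hκ₂
  have hκ₁1 : 1 ≤ κ₁ := by linarith
  have hκ₂1 : 100 ≤ κ₂ := by linarith
  set K₀ := rateConst κ κ₁ κ₂ with hK₀
  have ha1 : 1 ≤ 16 * κ * κ₁ := by nlinarith
  have ha2 : 1 ≤ (16 * κ * κ₁) ^ 2 := one_le_pow₀ ha1
  have hK₀a : 16 * κ * κ₁ ≤ K₀ := by
    rw [hK₀, rateConst]; nlinarith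
  have hK₀b : κ₂ ≤ K₀ := by
    rw [hK₀, rateConst]; nlinarith
  have hlog2 : 0 < Real.log 2 := Real.log_pos (by norm_num)
  have hlog2' : Real.log 2 < 1 := by linarith [Real.log_two_lt_d9]
  -- Dividing by `Real.log 2 ^ 6` passes to `log (T / δ) / log 2`, which is at least `1`, so its
  -- powers can be raised freely; `log (T / δ)` itself may be below `1`.
  refine ⟨κ₁, κ₂, K₀ / Real.log 2 ^ 6, 6, by linarith, by linarith,
    div_pos (by linarith) (by positivity), ?_⟩
  intro d hd T hT δ hδ hδ1 A _ hAne hA μ hμ hmono hbdd hc lam hlam1 hlam2 hck hclam θ hθ hf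
  have hp : GlmParams κ d T δ A μ lam :=
    ⟨hκ, hd, hT, hδ, hδ1, hAne, hA, hμ, hmono, hbdd, hc, hlam1, hlam2, hck, hclam⟩
  have hk := hp.k_pos
  have hL := hp.log_pos
  have hY1 : 1 ≤ Real.log (T / δ) / Real.log 2 := by
    rw [one_le_div hlog2]; exact Real.log_le_log (by norm_num) hp.two_le_ratio
  have hLY : Real.log (T / δ) ≤ Real.log (T / δ) / Real.log 2 := by
    rw [le_div_iff₀ hlog2]; nlinarith
  have hK : K₀ / Real.log 2 ^ 6 * Real.log (T / δ) ^ 6 =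
      K₀ * (Real.log (T / δ) / Real.log 2) ^ 6 := by
    rw [div_pow]; ring
  rw [hK]
  set Y := Real.log (T / δ) / Real.log 2 with hY
  have hY6 : Y ≤ Y ^ 6 := le_self_pow₀ hY1 (by norm_num)
  have hKY : K₀ ≤ K₀ * Y ^ 6 := le_mul_of_one_le_right (by linarith) (one_le_pow₀ hY1)
  refine ⟨hp.assumption1 hθ hf, fun t ht => ?_, fun t ht => ?_, ?_⟩
  · have h1 := hp.rhoCoef_le (κ₁ := κ₁) (by linarith)
    have e := sqrtRate_mul_self (rhoCoef κ₁ d T δ μ lam) t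
    rw [glmRho_eq_sqrtRate, mul_comm, e, ← mul_assoc]
    gcongr
    calc _ ≤ _ := h1
      _ ≤ K₀ * (kLink μ / cLink μ * d) * Y ^ 6 := by
        have : 0 ≤ K₀ := by linarith
        have := hLY.trans hY6
        gcongr
      _ = _ := by ring
  · set B := kLink μ ^ 2 * d / cLink μ * ‖θ t - θ (t + 1)‖ with hB
    have hB0 : 0 ≤ B := by rw [hB]; positivity
    have e : glmDelta κ₂ T δ μ θ t = κ₂ * √(Real.log (T / δ)) * B := by
      rw [glmDelta, hB]; ring
    have hs1 : √(Real.log (T / δ)) ≤ Y := by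
      rw [Real.sqrt_le_iff]; constructor <;> nlinarith
    have hs2 : 1 / 2 ≤ √(Real.log (T / δ)) :=
      Real.le_sqrt_of_sq_le (by linarith [hp.log_two_le])
    rw [e]
    constructor
    · have : 0 ≤ K₀ := by linarith
      have := hs1.trans hY6
      gcongr
    · have h1 : 1 ≤ κ₂ * √(Real.log (T / δ)) := by nlinarith
      have h2 : 1 ≤ K₀ * Y ^ 6 := by linarith
      calc B = 1 * (1 * B) := by ring
        _ ≤ _ := by gcongr
  · intro Ω mΩ P _ ℱ 𝒢 U a g R hI
    rw [glmRho_eq_sqrtRate] at hI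
    refine (hp.goodPath hθ hf hI).trans (measure_mono fun ω hω => ?_)
    exact GoodPath.dynRegret_le hp hκ₁1 (by linarith) hY hω
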